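/- For $\Theta\in(0,\pi/2)$ let $D_\Theta\subset\mathbb C$ be the open rhombus with vertices $0,\ \frac{\pi}{2}(1-i\tan\Theta),\ \pi,\ \frac{\pi}{2}(1+i\tan\Theta)$. For $\delta\geq 0$ let $A^2_\delta(D_\Theta)$ be the Hilbert space of all holomorphic $f$ on $D_\Theta$ with $$\|f\|^2_{A^2_\delta(D_\Theta)}=\int_{D_\Theta}|f(s)|^2\,|s|^\delta|\pi-s|^\delta\,dA(s)<\infty ,$$ where $dA$ is the area measure; such an $f$ is identified with its restriction to $(0,\pi)$. For $\tau>0$ and $u=(u_0,u_\pi)\in L^2([0,\tau];\mathbb C^2)$ let $\Phi^D_\tau u=z(\tau,\cdot)$, where $z\in C([0,\tau];W^{-1,2}(0,\pi))$ is the (weak) solution of $$\partial_t z=\partial_x^2 z \ \text{ on } (0,\tau)\times(0,\pi),\qquad z(t,0)=u_0(t),\quad z(t,\pi)=u_\pi(t),\qquad z(0,\cdot)=0,$$ i.e. for all $t\in[0,\tau]$ and all smooth $\psi$ on $[0,\pi]$ such that $\psi$ and $\psi''$ vanish at $0$ and $\pi$, $$\langle z(t),\psi\rangle=\int_0^t\big(\langle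 z(\sigma),\psi''\rangle+u_0(\sigma)\psi'(0)-u_\pi(\sigma)\psi'(\pi)\big)\,d\sigma .$$ **Proposition.** Let $\tau>0$ and suppose that either $\delta=0$ and $\Theta\in(0,\frac{\pi}{4})$, or $\delta\in(0,1)$ and $\Theta=\frac{\pi}{4}$. Then the solution $z$ exists for every $u\in L^2([0,\tau];\mathbb C^2)$, the Dirichlet input map $\Phi^D_\tau$ is well defined and bounded from $L^2([0,\tau];\mathbb C^2)$ into $A^2_\delta(D_\Theta)$, and it is not Hilbert–Schmidt between these spaces. -/

import Mathlib

open MeasureTheory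
open scoped ContDiff Real

noncomputable section

namespace DirichletHeat

/-! ### Hilbert–Schmidt operators -/

/-- A bounded operator between complex Hilbert spaces is Hilbert–Schmidt if `∑ ‖T eᵢ‖²` converges
for some (equivalently, for every) orthonormal basis `(eᵢ)` of its domain. -/
def IsHilbertSchmidt {H K : Type} [NormedAddCommGroup H] [InnerProductSpace ℂ H]
    [NormedAddCommGroup K] [InnerProductSpace ℂ K] (T : H →L[ℂ] K) : Prop :=
  ∃ (ι : Type) (b : HilbertBasis ι ℂ H), Summable fun i => ‖T (b i)‖ ^ 2

/-! ### Weighted Bergman spaces on rhombi -/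

/-- The open rhombus `D_Θ` with vertices `0`, `(π/2)(1 - i tan Θ)`, `π`, `(π/2)(1 + i tan Θ)`
(for `0 < Θ < π/2`). -/
def rhombus (Θ : ℝ) : Set ℂ :=
  {s | |s.im| < Real.tan Θ * s.re ∧ |s.im| < Real.tan Θ * (π - s.re)}

/-- The weight `ρ_δ(s) = |s|^δ |π - s|^δ`. -/
def weight (δ : ℝ) (s : ℂ) : ℝ := ‖s‖ ^ δ * ‖(π : ℂ) - s‖ ^ δ

/-- The measure `ρ_δ dA` on `D_Θ`, where `dA` is the area measure. -/
def bergmanMeasure (δ Θ : ℝ) : Measure ℂ :=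
  (volume.restrict (rhombus Θ)).withDensity fun s => ENNReal.ofReal (weight δ s)

/-- `F` is holomorphic on `D_Θ` and is a representative of the class `f ∈ L²(D_Θ, ρ_δ dA)`. -/
def IsHolomorphicRep {δ Θ : ℝ} (f : Lp ℂ 2 (bergmanMeasure δ Θ)) (F : ℂ → ℂ) : Prop :=
  DifferentiableOn ℂ F (rhombus Θ) ∧ f =ᵐ[bergmanMeasure δ Θ] F

/-- The weighted Bergman space `A²_δ(D_Θ)`: the classes in `L²(D_Θ, ρ_δ dA)` of the holomorphic
functions, with the inner product of `L²(D_Θ, ρ_δ dA)`. -/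
def bergman (δ Θ : ℝ) : Submodule ℂ (Lp ℂ 2 (bergmanMeasure δ Θ)) where
  carrier := {f | ∃ F, IsHolomorphicRep f F}
  zero_mem' := ⟨0, differentiableOn_const 0, Lp.coeFn_zero ..⟩
  add_mem' := by
    rintro f g ⟨F, hF, hfF⟩ ⟨G, hG, hgG⟩
    exact ⟨F + G, hF.add hG, (Lp.coeFn_add f g).trans (hfF.add hgG)⟩
  smul_mem' := by
    rintro c f ⟨F, hF, hfF⟩
    exact ⟨c • F, hF.const_smul c, (Lp.coeFn_smul c f).trans (hfF.const_smul c)⟩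

/-! ### The Sobolev spaces `W_0^{1,2}(0,π)` and `W^{-1,2}(0,π)` -/

/-- Lebesgue measure on `(0,π)`. -/
abbrev rodMeasure : Measure ℝ := volume.restrict (Set.Ioo 0 π)

/-- The space `L²(0,π)`. -/
abbrev L2Rod : Type := Lp ℂ 2 rodMeasure

lemma intervalIntegrable_of_L2 (g : L2Rod) {a b : ℝ} (ha : a ∈ Set.Icc 0 π)
    (hb : b ∈ Set.Icc 0 π) : IntervalIntegrable g volume a b := by
  have h : IntegrableOn g (Set.Icc 0 π) := by
    rw [integrableOn_Icc_iff_integrableOn_Ioo]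
    exact (Lp.memLp g).integrable (by norm_num)
  rw [intervalIntegrable_iff]
  refine h.mono_set ?_
  intro x hx
  rw [Set.mem_uIoc] at hx
  rcases hx with hx | hx
  · exact ⟨ha.1.trans hx.1.le, hx.2.trans hb.2⟩
  · exact ⟨hb.1.trans hx.1.le, hx.2.trans ha.2⟩

lemma ae_restrict_interval {p : ℝ → Prop} (h : ∀ᵐ x ∂rodMeasure, p x) {a : ℝ}
    (ha : a ∈ Set.Icc 0 π) : ∀ᵐ x ∂volume, x ∈ Set.uIoc 0 a → p x := by
  have h' : ∀ᵐ x ∂(volume.restrict (Set.Ioc 0 π)), p x := by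
    rwa [← restrict_Ioo_eq_restrict_Ioc]
  rw [ae_restrict_iff' measurableSet_Ioc] at h'
  filter_upwards [h'] with x hx hxa
  rw [Set.uIoc_of_le ha.1] at hxa
  exact hx ⟨hxa.1, hxa.2.trans ha.2⟩

/-- The space `W_0^{1,2}(0,π)`: the pairs `(f, f')` of functions in `L²(0,π)` such that `f` is the
absolutely continuous function with `f(0) = f(π) = 0` and derivative `f'`, normed by
`(‖f‖² + ‖f'‖²)^{1/2}`. -/
def W01 : Submodule ℂ (WithLp 2 (L2Rod × L2Rod)) where
  carrier := {p | (∀ᵐ x ∂rodMeasure, p.fst x = ∫ t in (0 : ℝ)..x, p.snd t) ∧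
    ∫ t in (0 : ℝ)..π, p.snd t = 0}
  zero_mem' := by
    have h0 := Lp.coeFn_zero ℂ 2 rodMeasure
    have hint : ∀ x ∈ Set.Icc 0 π, ∫ t in (0 : ℝ)..x, (0 : L2Rod) t = 0 := by
      intro x hx
      rw [intervalIntegral.integral_congr_ae (ae_restrict_interval h0 hx)]
      simp
    refine ⟨?_, hint π ⟨Real.pi_pos.le, le_rfl⟩⟩
    filter_upwards [h0, ae_restrict_mem measurableSet_Ioo] with x hx hx'
    rw [WithLp.zero_fst, WithLp.zero_snd, hint x ⟨hx'.1.le, hx'.2.le⟩, hx]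
    rfl
  add_mem' := by
    rintro p q ⟨hp, hp'⟩ ⟨hq, hq'⟩
    have h0 := Lp.coeFn_add p.snd q.snd
    have hz : (0 : ℝ) ∈ Set.Icc 0 π := ⟨le_rfl, Real.pi_pos.le⟩
    have hint : ∀ x ∈ Set.Icc 0 π, ∫ t in (0 : ℝ)..x, (p.snd + q.snd : L2Rod) t
        = (∫ t in (0 : ℝ)..x, p.snd t) + ∫ t in (0 : ℝ)..x, q.snd t := by
      intro x hx
      rw [intervalIntegral.integral_congr_ae (ae_restrict_interval h0 hx)]
      exact intervalIntegral.integral_add (intervalIntegrable_of_L2 _ hz hx)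
        (intervalIntegrable_of_L2 _ hz hx)
    refine ⟨?_, by rw [WithLp.add_snd, hint π ⟨Real.pi_pos.le, le_rfl⟩, hp', hq', add_zero]⟩
    filter_upwards [Lp.coeFn_add p.fst q.fst, hp, hq, ae_restrict_mem measurableSet_Ioo]
      with x hx hpx hqx hx'
    rw [WithLp.add_fst, WithLp.add_snd, hint x ⟨hx'.1.le, hx'.2.le⟩, hx, ← hpx, ← hqx]
    rfl
  smul_mem' := by
    rintro c p ⟨hp, hp'⟩
    have h0 := Lp.coeFn_smul c p.snd
    have hint : ∀ x ∈ Set.Icc 0 π, ∫ t in (0 : ℝ)..x, (c • p.snd : L2Rod) t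
        = c * ∫ t in (0 : ℝ)..x, p.snd t := by
      intro x hx
      rw [intervalIntegral.integral_congr_ae (ae_restrict_interval h0 hx)]
      exact intervalIntegral.integral_const_mul c _
    refine ⟨?_, by rw [WithLp.smul_snd, hint π ⟨Real.pi_pos.le, le_rfl⟩, hp', mul_zero]⟩
    filter_upwards [Lp.coeFn_smul c p.fst, hp, ae_restrict_mem measurableSet_Ioo]
      with x hx hpx hx'
    rw [WithLp.smul_fst, WithLp.smul_snd, hint x ⟨hx'.1.le, hx'.2.le⟩, hx, ← hpx]
    rfl

/-- The space `W^{-1,2}(0,π)`, the dual of `W_0^{1,2}(0,π)` with respect to the bilinear pairing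
that extends `∫₀^π f ψ dx`. -/
abbrev Wneg : Type := StrongDual ℂ W01

lemma memLp_rod {ψ : ℝ → ℂ} (h : Continuous ψ) : MemLp ψ 2 rodMeasure := by
  obtain ⟨C, hC⟩ := isCompact_Icc.exists_bound_of_continuousOn
    (s := Set.Icc (0 : ℝ) π) h.continuousOn
  refine MemLp.of_bound h.aestronglyMeasurable C ?_
  filter_upwards [ae_restrict_mem measurableSet_Ioo] with x hx
  exact hC x ⟨hx.1.le, hx.2.le⟩

/-- A `C¹` function vanishing at `0` and `π`, as an element of `W_0^{1,2}(0,π)`. -/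
def W01.ofC1 (ψ : ℝ → ℂ) (hψ : ContDiff ℝ 1 ψ) (h0 : ψ 0 = 0) (hπ : ψ π = 0) : W01 :=
  ⟨WithLp.toLp 2 ((memLp_rod hψ.continuous).toLp ψ,
      (memLp_rod (hψ.continuous_deriv le_rfl)).toLp (deriv ψ)), by
    have hint : ∀ x ∈ Set.Icc 0 π,
        ∫ t in (0 : ℝ)..x, (memLp_rod (hψ.continuous_deriv le_rfl)).toLp (deriv ψ) t = ψ x := by
      intro x hx
      rw [intervalIntegral.integral_congr_ae (ae_restrict_interval (MemLp.coeFn_toLp _) hx),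
        intervalIntegral.integral_deriv_eq_sub
          (fun y _ => (hψ.differentiable (by norm_num)).differentiableAt)
          ((hψ.continuous_deriv le_rfl).intervalIntegrable _ _), h0, sub_zero]
    refine ⟨?_, (hint π ⟨Real.pi_pos.le, le_rfl⟩).trans hπ⟩
    filter_upwards [MemLp.coeFn_toLp (memLp_rod hψ.continuous),
      ae_restrict_mem measurableSet_Ioo] with x hx hx'
    exact hx.trans (hint x ⟨hx'.1.le, hx'.2.le⟩).symm⟩

/-! ### The heat equation with Dirichlet boundary inputs -/

/-- The space `L²([0,τ]; ℂ²)` of inputs; the coordinates `0` and `1` of `ℂ²` are the boundary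
values at `x = 0` and at `x = π`. -/
abbrev Input (τ : ℝ) : Type :=
  Lp (EuclideanSpace ℂ (Fin 2)) 2 (volume.restrict (Set.Icc 0 τ))

/-- Smooth functions `ψ` on `[0,π]` such that `ψ` and `ψ''` vanish at both ends. They belong to the
domain of the Dirichlet Laplacian with values in `W_0^{1,2}(0,π)`, and are dense in it. -/
structure HeatTest where
  ψ : ℝ → ℂ
  smooth : ContDiff ℝ ∞ ψ
  zero_left : ψ 0 = 0
  zero_right : ψ π = 0
  zero_left' : deriv (deriv ψ) 0 = 0
  zero_right' : deriv (deriv ψ) π = 0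

/-- The element `ψ` of `W_0^{1,2}(0,π)`. -/
def HeatTest.toW01 (φ : HeatTest) : W01 :=
  W01.ofC1 φ.ψ (φ.smooth.of_le (by exact_mod_cast le_top)) φ.zero_left φ.zero_right

/-- The element `ψ''` of `W_0^{1,2}(0,π)`. -/
def HeatTest.laplacian (φ : HeatTest) : W01 :=
  W01.ofC1 (deriv (deriv φ.ψ))
    ((contDiff_infty_iff_deriv.1 (contDiff_infty_iff_deriv.1 φ.smooth).2).2.of_le
      (by exact_mod_cast le_top)) φ.zero_left' φ.zero_right'

/-- `z ∈ C([0,τ]; W^{-1,2}(0,π))` is the solution on `[0,τ]` of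
`∂z/∂t = ∂²z/∂x²`, `z(t,0) = u₀(t)`, `z(t,π) = u_π(t)`, `z(0,·) = 0`, in the weak sense: for every
test function `ψ`,
`⟨z(t), ψ⟩ = ∫₀ᵗ (⟨z(s), ψ''⟩ + u₀(s) ψ'(0) - u_π(s) ψ'(π)) ds`. -/
def IsHeatSolution (τ : ℝ) (u : Input τ) (z : ℝ → Wneg) : Prop :=
  ContinuousOn z (Set.Icc 0 τ) ∧ ∀ φ : HeatTest, ∀ t ∈ Set.Icc 0 τ,
    z t φ.toW01 =
      ∫ s in (0 : ℝ)..t, (z s φ.laplacian + u s 0 * deriv φ.ψ 0 - u s 1 * deriv φ.ψ π)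

/-- The distribution `w ∈ W^{-1,2}(0,π)` is the trace on `(0,π)` of the function `f ∈ A²_δ(D_Θ)`:
`⟨w, φ⟩ = ∫₀^π f φ dx` for all `φ ∈ C_c^∞(0,π)`. -/
def IsTrace {δ Θ : ℝ} (f : bergman δ Θ) (w : Wneg) : Prop :=
  ∃ F, IsHolomorphicRep (f : Lp ℂ 2 (bergmanMeasure δ Θ)) F ∧
    ∀ (φ : ℝ → ℂ) (hφ : ContDiff ℝ ∞ φ) (hs : tsupport φ ⊆ Set.Ioo 0 π),
      w (W01.ofC1 φ (hφ.of_le (by exact_mod_cast le_top))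
        (image_eq_zero_of_notMem_tsupport fun h => (hs h).1.false)
        (image_eq_zero_of_notMem_tsupport fun h => (hs h).2.false)) =
      ∫ x in (0 : ℝ)..π, F x * φ x

/-- `Φ` is the Dirichlet input map `u ↦ z(τ,·)`, regarded as an operator from `L²([0,τ]; ℂ²)` into
`A²_δ(D_Θ)` by identifying holomorphic functions on `D_Θ` with their traces on `(0,π)`; here `z` is
the solution of the heat equation with boundary inputs `u`. -/
def IsInputMap (τ : ℝ) {δ Θ : ℝ} (Φ : Input τ →L[ℂ] bergman δ Θ) : Prop :=
  ∀ (u : Input τ) (z : ℝ → Wneg), IsHeatSolution τ u z → IsTrace (Φ u) (z τ)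

end DirichletHeat

end

/-!
# The Dirichlet input map of the heat equation on a rod

With `K(t,s) = (2/π) ∑ n sin(ns) e^{-n²t}`, the state reached at time `τ` with the boundary values
`u₀` and `u_π` is
`z(τ,s) = ∫₀^τ K(τ-σ,s) u₀(σ) dσ + ∫₀^τ K(τ-σ,π-s) u_π(σ) dσ` (`inputFun`),
and this formula makes sense for `s` in the open square with diagonal `(0,π)`, which contains the
rhombi in question.

*Boundedness.* Summation over image points (`hasSum_gaussTerm`, the functional equation of the theta
function) shows that on the square `K(t,s)` is, up to a bounded remainder, the kernel
`s / (2 √π t^{3/2}) e^{-s²/(4t)}` of the half-line. In the variables `w = s²/4` and `v = 1/t` this is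
the kernel of a Laplace transform, and Plancherel's theorem on vertical lines shows that the
transform is bounded from `L²(0,∞)` into the unweighted Bergman space of the half-plane, hence of the
sector `|arg s| < π/4` (`lintegral_sector_le`). So the input map is bounded into the unweighted
Bergman space of the square (`lintegral_inputFun_le`), and a fortiori into those with bounded weights
on rhombi inside it.

*Failure of the Hilbert–Schmidt property.* The square of the Hilbert–Schmidt norm is the integral of
`‖K(τ-·,s)‖²` over the rhombus. The times of order `Re s²` show that this integrand is at least
a constant times `|s|² / (Re s²)²`, up to a bounded function
(`lintegral_lt_top_of_isHilbertSchmidt`). Without a weight this is not integrable at the vertex `0`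
(`lintegral_vertex_eq_top`). On the square, where `Re s²` vanishes on the sides at `0`, it is not
integrable at these sides, for any `δ ≥ 0` (`lintegral_side_eq_top`).

*The weak solution.* Testing with `sin(nx)` reduces the weak equation to ordinary differential
equations, so every solution satisfies
`⟨z(t), sin(n·)⟩ = n ∫₀ᵗ e^{-n²(t-s)} (u₀(s) - (-1)ⁿ u_π(s)) ds` (`IsHeatSolution.apply_sinTest`).
These numbers are bounded in `n` and `t`, so that the corresponding series of cosines, with
coefficients `O(1/n)`, converges in `L²(0,π)` uniformly in time, to a function `H(t)` for which
`⟨z(t), p⟩ = ⟨H(t), p'⟩` defines a solution (`isHeatSolution_heatSolution`). Expanding `K` in its sine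
series shows that `z(τ)` is the trace of `inputFun τ u` (`IsHeatSolution.apply_eq_integral`). By the
identity theorem, any operator that is an input map is therefore given by `inputFun`
(`IsInputMap.isHolomorphicRep`), so the two arguments above apply to it.
-/

noncomputable section

namespace DirichletHeat

/-! ### Plancherel's theorem for the Fourier integral -/

theorem eLpNorm_two_sq {α E : Type*} [MeasurableSpace α] [NormedAddCommGroup E] (μ : Measure α)
    (f : α → E) : eLpNorm f 2 μ ^ 2 = ∫⁻ x, ‖f x‖ₑ ^ 2 ∂μ := by
  have := eLpNorm_nnreal_pow_eq_lintegral (p := 2) (f := f) (μ := μ) (by simp)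
  simpa using! this

theorem Lp.enorm_sq_eq_lintegral {α E : Type*} [MeasurableSpace α] [NormedAddCommGroup E]
    {μ : Measure α} (f : Lp E 2 μ) : ‖f‖ₑ ^ 2 = ∫⁻ x, ‖f x‖ₑ ^ 2 ∂μ := by
  rw [Lp.enorm_def, eLpNorm_two_sq]

open FourierTransform in
theorem continuous_fourier_of_integrable {f : ℝ → ℂ} (h1 : Integrable f) : Continuous (𝓕 f) :=
  VectorFourier.fourierIntegral_continuous Real.continuous_fourierChar
    (by exact continuous_inner) h1

open FourierTransform in
/-- On `L¹ ∩ L²` the unitary Fourier transform of `L²`, which is defined by density, is given by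
the Fourier integral: the two define the same tempered distribution. -/
theorem fourier_toLp_ae_eq {f : ℝ → ℂ} (h1 : Integrable f) (h2 : MemLp f 2) :
    (𝓕 (h2.toLp f) : Lp ℂ 2 (volume : Measure ℝ)) =ᵐ[volume] 𝓕 f := by
  have hc : Continuous (𝓕 f) := continuous_fourier_of_integrable h1
  refine ae_eq_of_integral_contDiff_smul_eq ?_ hc.locallyIntegrable ?_
  · exact (Lp.memLp _).locallyIntegrable (by norm_num)
  intro g hg hgs
  have hgs' : HasCompactSupport (fun x => (g x : ℂ)) := hgs.comp_left (g := ((↑) : ℝ → ℂ)) rfl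
  have hg' : ContDiff ℝ ∞ (fun x => (g x : ℂ)) := Complex.ofRealCLM.contDiff.comp hg
  have := Lp.fourier_toTemperedDistribution_eq (h2.toLp f)
  set φ : SchwartzMap ℝ ℂ := hgs'.toSchwartzMap hg'
  have hφ : ∀ x, φ x = g x := fun x => rfl
  have h := congrArg (fun T => T φ) this
  simp only [TemperedDistribution.fourier_apply, Lp.toTemperedDistribution_apply, smul_eq_mul,
    hφ] at h
  simp only [Complex.real_smul]
  rw [← h]
  have h3 := VectorFourier.integral_fourierIntegral_smul_eq_flip (μ := (volume : Measure ℝ))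
    (ν := (volume : Measure ℝ)) (e := Real.fourierChar) (L := innerₗ ℝ) (f := φ) (g := f)
    Real.continuous_fourierChar (by exact continuous_inner) φ.integrable h1
  rw [flip_innerₗ] at h3
  simp only [smul_eq_mul] at h3
  trans ∫ x, (𝓕 φ) x * f x
  · refine integral_congr_ae ?_
    filter_upwards [h2.coeFn_toLp] with x hx
    rw [hx]
  · rw [SchwartzMap.fourier_coe]
    exact h3

/-- **Plancherel** for functions in `L¹ ∩ L²`. -/
theorem lintegral_enorm_fourier_sq {f : ℝ → ℂ} (h1 : Integrable f) (h2 : MemLp f 2) :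
    ∫⁻ ξ, ‖(FourierTransform.fourier f : ℝ → ℂ) ξ‖ₑ ^ 2 = ∫⁻ x, ‖f x‖ₑ ^ 2 := by
  have h := Lp.norm_fourier_eq (h2.toLp f)
  rw [← eLpNorm_two_sq, ← eLpNorm_two_sq]
  congr 1
  rw [Lp.norm_def, Lp.norm_def, ENNReal.toReal_eq_toReal_iff' (Lp.eLpNorm_ne_top _)
    (Lp.eLpNorm_ne_top _), eLpNorm_congr_ae (fourier_toLp_ae_eq h1 h2),
    eLpNorm_congr_ae h2.coeFn_toLp] at h
  exact h

/-! ### Holomorphic parameter integrals -/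

/-- A parameter integral of holomorphic functions is holomorphic if the integrand has locally uniform
integrable bounds; Cauchy's estimate bounds the derivative of the integrand. -/
theorem differentiableOn_integral {α : Type*} [MeasurableSpace α] {μ : Measure α} {U : Set ℂ}
    (hU : IsOpen U) {F : ℂ → α → ℂ} (hmeas : ∀ s ∈ U, AEStronglyMeasurable (F s) μ)
    (hd : ∀ᵐ a ∂μ, DifferentiableOn ℂ (F · a) U)
    (hb : ∀ s ∈ U, ∃ r > 0, ∃ g : α → ℝ, Integrable g μ ∧
      ∀ᵐ a ∂μ, ∀ s' ∈ Metric.ball s r, ‖F s' a‖ ≤ g a) :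
    DifferentiableOn ℂ (fun s => ∫ a, F s a ∂μ) U := by
  intro s hs
  obtain ⟨r₁, hr₁, g, hg, hgb⟩ := hb s hs
  obtain ⟨r₂, hr₂, hsub⟩ := Metric.isOpen_iff.1 hU s hs
  set r := min r₁ r₂ / 2 with hr
  have hmin : 0 < min r₁ r₂ := lt_min hr₁ hr₂
  have hr0 : 0 < r := by positivity
  have hrr : r + r = min r₁ r₂ := by rw [hr]; ring
  have hball : ∀ s' ∈ Metric.ball s r, ∀ z ∈ Metric.closedBall s' (r / 2),
      z ∈ Metric.ball s (min r₁ r₂) := by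
    intro s' hs' z hz
    rw [Metric.mem_ball] at hs' ⊢
    rw [Metric.mem_closedBall] at hz
    have := dist_triangle z s' s
    linarith
  have hballU : Metric.ball s (min r₁ r₂) ⊆ U :=
    (Metric.ball_subset_ball (min_le_right _ _)).trans hsub
  have hsr : s ∈ Metric.ball s r := Metric.mem_ball_self hr0
  have hderiv : ∀ᵐ a ∂μ, ∀ s' ∈ Metric.ball s r,
      HasDerivAt (F · a) (deriv (F · a) s') s' := by
    filter_upwards [hd] with a ha s' hs'
    have : s' ∈ U := hballU (hball s' hs' s' (Metric.mem_closedBall_self (by positivity)))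
    exact ((ha s' this).differentiableAt (hU.mem_nhds this)).hasDerivAt
  refine (hasDerivAt_integral_of_dominated_loc_of_deriv_le (F' := fun s a => deriv (F · a) s)
    (bound := fun a => g a / (r / 2)) (Metric.ball_mem_nhds s hr0) ?_ ?_ ?_ ?_ ?_
    hderiv).2.differentiableAt.differentiableWithinAt
  · filter_upwards [hU.mem_nhds hs] with z hz using hmeas z hz
  · refine hg.mono' (hmeas s hs) ?_
    filter_upwards [hgb] with a ha using ha s (Metric.mem_ball_self hr₁)
  · -- the derivative is an a.e. limit of difference quotients
    have hh : Filter.Tendsto (fun n : ℕ => ((r / 2 * (1 / ((n : ℝ) + 1)) : ℝ) : ℂ)) Filter.atTop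
        (nhdsWithin 0 {0}ᶜ) := by
      refine tendsto_nhdsWithin_iff.2 ⟨?_, Filter.Eventually.of_forall fun n => ?_⟩
      · have := (tendsto_one_div_add_atTop_nhds_zero_nat (𝕜 := ℝ)).const_mul (r / 2)
        rw [mul_zero] at this
        exact_mod_cast (Complex.continuous_ofReal.tendsto 0).comp this
      · have : 0 < r / 2 * (1 / ((n : ℝ) + 1)) := by positivity
        simp only [Set.mem_compl_iff, Set.mem_singleton_iff]
        exact_mod_cast this.ne'
    refine aestronglyMeasurable_of_tendsto_ae Filter.atTop
      (f := fun n : ℕ => fun a => (((r / 2 * (1 / ((n : ℝ) + 1)) : ℝ) : ℂ))⁻¹ *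
        (F (s + ((r / 2 * (1 / ((n : ℝ) + 1)) : ℝ) : ℂ)) a - F s a)) (fun n => ?_) ?_
    · refine ((hmeas _ ?_).sub (hmeas s hs)).const_mul _
      refine hballU (hball s hsr _ ?_)
      rw [Metric.mem_closedBall, dist_self_add_left, Complex.norm_real, Real.norm_of_nonneg
        (by positivity)]
      have : (1 : ℝ) / ((n : ℝ) + 1) ≤ 1 := by
        rw [div_le_one (by positivity)]; linarith [(Nat.cast_nonneg n : (0 : ℝ) ≤ n)]
      nlinarith
    · filter_upwards [hderiv] with a ha
      exact (hasDerivAt_iff_tendsto_slope_zero.1 (ha s hsr)).comp hh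
  · filter_upwards [hd, hgb] with a ha hga s' hs'
    refine Complex.norm_deriv_le_of_forall_mem_sphere_norm_le (by positivity) ?_ ?_
    · refine DifferentiableOn.diffContOnCl ?_
      refine ha.mono ?_
      rw [closure_ball _ (by positivity)]
      exact fun z hz => hballU (hball s' hs' z hz)
    · intro z hz
      exact hga z (Metric.ball_subset_ball (min_le_left _ _)
        (hball s' hs' z (Metric.sphere_subset_closedBall hz)))
  · exact hg.div_const _

theorem mul_sqrt_le_exp {x : ℝ} (hx : 0 ≤ x) : x * √x ≤ Real.exp x := by
  have h1 := Real.quadratic_le_exp_of_nonneg hx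
  have h2 : √x ≤ (1 + x) / 2 := by
    nlinarith [Real.sq_sqrt hx, sq_nonneg (√x - 1)]
  nlinarith

/-- A bound for `t^{-3/2} e^{-x/t}` that is uniform in `t`. -/
theorem inv_mul_sqrt_mul_exp_le {x t : ℝ} (hx : 0 < x) (ht : 0 < t) :
    (t * √t)⁻¹ * Real.exp (-(x / t)) ≤ (x * √x)⁻¹ := by
  have h := mul_sqrt_le_exp (x := x / t) (by positivity)
  rw [Real.sqrt_div' _ ht.le] at h
  have h1 : x * √x ≤ Real.exp (x / t) * (t * √t) := by
    have : x / t * (√x / √t) = x * √x / (t * √t) := by field_simp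
    rw [this, div_le_iff₀ (by positivity)] at h
    exact h
  rw [Real.exp_neg, ← mul_inv]
  exact inv_anti₀ (by positivity) (by linarith)

/-! ### A Laplace transform on the half-plane and on the sector -/

/-- The transform `w ↦ ∫₀^∞ g(t) t^{-3/2} e^{-w/t} dt`; the substitution `v = 1/t` turns it into the
Laplace transform of `v^{-1/2} g(1/v)`. -/
def invLaplace (g : ℝ → ℂ) (w : ℂ) : ℂ :=
  ∫ t in Set.Ioi (0 : ℝ), g t * (((t * √t)⁻¹ : ℝ) : ℂ) * Complex.exp (-(w / t))

theorem image_inv_Ioi : Inv.inv '' Set.Ioi (0 : ℝ) = Set.Ioi 0 := by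
  ext t
  simp only [Set.mem_image, Set.mem_Ioi]
  exact ⟨fun ⟨_, hv, h⟩ => h ▸ inv_pos.2 hv, fun h => ⟨t⁻¹, inv_pos.2 h, inv_inv t⟩⟩

theorem hasDerivWithinAt_inv_Ioi : ∀ v ∈ Set.Ioi (0 : ℝ),
    HasDerivWithinAt (fun v : ℝ => v⁻¹) (-(v ^ 2)⁻¹) (Set.Ioi 0) v :=
  fun _ hv => (hasDerivAt_inv (ne_of_gt hv)).hasDerivWithinAt

/-- The function whose Fourier transform is `η ↦ invLaplace g (x + 2πiη)`. -/
def dampedInv (g : ℝ → ℂ) (x : ℝ) : ℝ → ℂ :=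
  (Set.Ioi (0 : ℝ)).indicator fun v => (((√v)⁻¹ * Real.exp (-(x * v)) : ℝ) : ℂ) * g v⁻¹

theorem abs_deriv_inv_mul {v : ℝ} (hv : 0 < v) :
    |-(v ^ 2)⁻¹| * (v⁻¹ * √v⁻¹)⁻¹ = (√v)⁻¹ := by
  rw [abs_neg, abs_of_nonneg (by positivity), Real.sqrt_inv]
  have := Real.sq_sqrt hv.le
  have h2 : 0 < √v := Real.sqrt_pos.2 hv
  field_simp
  nlinarith

theorem norm_invLaplace_integrand {x t : ℝ} (ht : 0 < t) (g : ℝ → ℂ) {w : ℂ} (hw : w.re = x) :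
    ‖g t * (((t * √t)⁻¹ : ℝ) : ℂ) * Complex.exp (-(w / t))‖
      = ‖g t‖ * ((t * √t)⁻¹ * Real.exp (-(x / t))) := by
  rw [norm_mul, norm_mul, Complex.norm_real, Complex.norm_exp, Real.norm_of_nonneg (by positivity),
    Complex.neg_re, Complex.div_ofReal_re, hw, mul_assoc]

theorem integrableOn_invLaplace_integrand {g : ℝ → ℂ} (hg : IntegrableOn g (Set.Ioi 0)) {w : ℂ}
    (hw : 0 < w.re) : IntegrableOn
      (fun t : ℝ => g t * (((t * √t)⁻¹ : ℝ) : ℂ) * Complex.exp (-(w / t))) (Set.Ioi 0) := by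
  refine (hg.norm.mul_const ((w.re * √w.re)⁻¹)).mono' ?_ ?_
  · refine (hg.aestronglyMeasurable.mul ?_).mul ?_
    · exact (by fun_prop : Measurable fun t : ℝ => (((t * √t)⁻¹ : ℝ) : ℂ)).aestronglyMeasurable
    · exact (by fun_prop : Measurable fun t : ℝ => Complex.exp (-(w / t))).aestronglyMeasurable
  · filter_upwards [ae_restrict_mem measurableSet_Ioi] with t ht
    rw [norm_invLaplace_integrand ht g rfl]
    exact mul_le_mul_of_nonneg_left (inv_mul_sqrt_mul_exp_le hw ht) (norm_nonneg _)

theorem invLaplace_comp_inv {v : ℝ} (hv : 0 < v) (g : ℝ → ℂ) (x y : ℝ) :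
    |-(v ^ 2)⁻¹| • (g v⁻¹ * (((v⁻¹ * √v⁻¹)⁻¹ : ℝ) : ℂ) *
        Complex.exp (-((x + y * Complex.I) / (v⁻¹ : ℝ)))) =
      Complex.exp (-(y * v) * Complex.I) * ((((√v)⁻¹ * Real.exp (-(x * v)) : ℝ) : ℂ) * g v⁻¹) := by
  rw [← abs_deriv_inv_mul hv, Complex.real_smul]
  have : Complex.exp (-((x + y * Complex.I) / (v⁻¹ : ℝ)))
      = Complex.exp (-(y * v) * Complex.I) * ((Real.exp (-(x * v)) : ℝ) : ℂ) := by
    rw [Complex.ofReal_exp, ← Complex.exp_add]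
    congr 1
    push_cast
    rw [div_inv_eq_mul]
    ring
  rw [this]
  push_cast
  ring

theorem integrable_dampedInv {g : ℝ → ℂ} (hg : IntegrableOn g (Set.Ioi 0)) {x : ℝ} (hx : 0 < x) :
    Integrable (dampedInv g x) := by
  have h := integrableOn_invLaplace_integrand hg (w := x + (0 : ℝ) * Complex.I) (by simpa using hx)
  rw [← image_inv_Ioi, integrableOn_image_iff_integrableOn_abs_deriv_smul measurableSet_Ioi
    hasDerivWithinAt_inv_Ioi inv_injective.injOn] at h
  rw [dampedInv, integrable_indicator_iff measurableSet_Ioi]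
  refine h.congr_fun (fun v hv => ?_) measurableSet_Ioi
  simpa using invLaplace_comp_inv hv g x 0

theorem fourier_dampedInv (g : ℝ → ℂ) (x η : ℝ) :
    (FourierTransform.fourier (dampedInv g x) : ℝ → ℂ) η
      = invLaplace g (x + (2 * π * η : ℝ) * Complex.I) := by
  rw [Real.fourier_real_eq_integral_exp_smul, invLaplace]
  conv_rhs => rw [← image_inv_Ioi]
  rw [integral_image_eq_integral_abs_deriv_smul measurableSet_Ioi
    hasDerivWithinAt_inv_Ioi inv_injective.injOn, ← integral_indicator measurableSet_Ioi]
  refine integral_congr_ae (Filter.Eventually.of_forall fun v => ?_)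
  by_cases hv : v ∈ Set.Ioi (0 : ℝ)
  · simp only [dampedInv, Set.indicator_of_mem hv, smul_eq_mul]
    rw [invLaplace_comp_inv hv]
    congr 2
    push_cast
    ring
  · simp [dampedInv, Set.indicator_of_notMem hv]

/-- The substitution `v = 1/t` maps `|v^{-1/2} g(1/v)|² dv` to `t⁻¹ |g(t)|² dt`. -/
theorem lintegral_enorm_dampedInv (g : ℝ → ℂ) (x : ℝ) :
    ∫⁻ v, ‖dampedInv g x v‖ₑ ^ 2 =
      ∫⁻ t in Set.Ioi (0 : ℝ), ENNReal.ofReal (t⁻¹ * Real.exp (-(2 * x / t))) * ‖g t‖ₑ ^ 2 := by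
  conv_rhs => rw [← image_inv_Ioi]
  rw [lintegral_image_eq_lintegral_abs_deriv_mul measurableSet_Ioi
    hasDerivWithinAt_inv_Ioi inv_injective.injOn, ← lintegral_indicator measurableSet_Ioi]
  refine lintegral_congr fun v => ?_
  by_cases hv : v ∈ Set.Ioi (0 : ℝ)
  · simp only [dampedInv, Set.indicator_of_mem hv]
    have hv' : 0 < v := hv
    rw [enorm_mul, mul_pow, ← mul_assoc, ← ENNReal.ofReal_mul (abs_nonneg _), ← ofReal_norm,
      Complex.norm_real, Real.norm_of_nonneg (by positivity), ← ENNReal.ofReal_pow (by positivity)]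
    congr 2
    rw [mul_pow, ← Real.exp_nat_mul, abs_neg, abs_of_nonneg (by positivity), inv_pow,
      Real.sq_sqrt hv'.le, inv_inv, ← mul_assoc]
    congr 1
    · field_simp
    · congr 1
      rw [div_inv_eq_mul]
      push_cast
      ring
  · simp [dampedInv, Set.indicator_of_notMem hv]

theorem memLp_dampedInv {g : ℝ → ℂ} (hg : IntegrableOn g (Set.Ioi 0))
    (hg2 : ∫⁻ t in Set.Ioi (0 : ℝ), ‖g t‖ₑ ^ 2 ≠ ⊤) {x : ℝ} (hx : 0 < x) :
    MemLp (dampedInv g x) 2 := by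
  refine ⟨(integrable_dampedInv hg hx).aestronglyMeasurable, ?_⟩
  rw [eLpNorm_lt_top_iff_lintegral_rpow_enorm_lt_top (by norm_num) (by norm_num)]
  have := lintegral_enorm_dampedInv g x
  simp only [ENNReal.toReal_ofNat, ENNReal.rpow_ofNat]
  rw [this]
  refine lt_of_le_of_lt (b := ∫⁻ t in Set.Ioi (0 : ℝ), ENNReal.ofReal ((2 * x)⁻¹) * ‖g t‖ₑ ^ 2)
    ?_ ?_
  · refine setLIntegral_mono' measurableSet_Ioi fun t ht => ?_
    gcongr
    have ht' : 0 < t := ht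
    have h1 := Real.add_one_le_exp (2 * x / t)
    rw [Real.exp_neg, ← mul_inv]
    refine inv_anti₀ (by positivity) ?_
    have : t * (2 * x / t) = 2 * x := by field_simp
    nlinarith
  · rw [lintegral_const_mul' _ _ ENNReal.ofReal_ne_top]
    exact ENNReal.mul_lt_top ENNReal.ofReal_lt_top hg2.lt_top

theorem lintegral_comp_const_mul (f : ℝ → ENNReal) {a : ℝ} (ha : 0 < a) :
    ∫⁻ y, f y = ENNReal.ofReal a * ∫⁻ η, f (a * η) := by
  have h := lintegral_image_eq_lintegral_abs_deriv_mul (s := Set.univ) (f := fun η => a * η)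
    (f' := fun _ => a) MeasurableSet.univ
    (fun η _ => (by simpa using (hasDerivAt_id η).const_mul a : HasDerivAt (fun η => a * η) a η).hasDerivWithinAt)
    (mul_right_injective₀ ha.ne').injOn f
  have himg : (fun η => a * η) '' Set.univ = Set.univ := by
    rw [Set.image_univ]
    exact (mul_left_surjective₀ ha.ne').range_eq
  rw [himg] at h
  simpa [abs_of_pos ha, lintegral_const_mul'] using h

/-- Plancherel's theorem on the line `Re w = x`. -/
theorem lintegral_vertical_invLaplace {g : ℝ → ℂ} (hg : IntegrableOn g (Set.Ioi 0))
    (hg2 : ∫⁻ t in Set.Ioi (0 : ℝ), ‖g t‖ₑ ^ 2 ≠ ⊤) {x : ℝ} (hx : 0 < x) :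
    ∫⁻ y : ℝ, ‖invLaplace g (x + y * Complex.I)‖ₑ ^ 2 = ENNReal.ofReal (2 * π) *
      ∫⁻ t in Set.Ioi (0 : ℝ), ENNReal.ofReal (t⁻¹ * Real.exp (-(2 * x / t))) * ‖g t‖ₑ ^ 2 := by
  rw [lintegral_comp_const_mul _ Real.two_pi_pos, ← lintegral_enorm_dampedInv,
    ← lintegral_enorm_fourier_sq (integrable_dampedInv hg hx) (memLp_dampedInv hg hg2 hx)]
  simp_rw [fourier_dampedInv]

theorem differentiableOn_invLaplace {g : ℝ → ℂ} (hg : IntegrableOn g (Set.Ioi 0)) :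
    DifferentiableOn ℂ (invLaplace g) {w | 0 < w.re} := by
  refine differentiableOn_integral (isOpen_lt continuous_const Complex.continuous_re)
    (fun w hw => (integrableOn_invLaplace_integrand hg hw).aestronglyMeasurable) ?_ ?_
  · exact Filter.Eventually.of_forall fun t => by fun_prop
  · intro w hw
    have hw' : 0 < w.re := hw
    refine ⟨w.re / 2, by positivity, fun t => ‖g t‖ * ((w.re / 2 * √(w.re / 2))⁻¹),
      hg.norm.mul_const _, ?_⟩
    filter_upwards [ae_restrict_mem measurableSet_Ioi] with t ht z hz
    have ht' : 0 < t := ht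
    rw [norm_invLaplace_integrand ht g rfl]
    have h1 : |(z - w).re| < w.re / 2 :=
      (Complex.abs_re_le_norm _).trans_lt (by simpa [dist_eq_norm] using hz)
    rw [Complex.sub_re, abs_lt] at h1
    refine mul_le_mul_of_nonneg_left ?_ (norm_nonneg _)
    refine le_trans ?_ (inv_mul_sqrt_mul_exp_le (x := w.re / 2) (by positivity) ht)
    gcongr
    linarith

theorem lintegral_Ioi_exp {c : ℝ} (hc : 0 < c) :
    ∫⁻ x in Set.Ioi (0 : ℝ), ENNReal.ofReal (Real.exp (-(c * x))) = ENNReal.ofReal c⁻¹ := by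
  have h1 := integral_exp_mul_Ioi (neg_lt_zero.2 hc) 0
  have h2 := integrableOn_exp_mul_Ioi (neg_lt_zero.2 hc) 0
  simp only [neg_mul, mul_zero, Real.exp_zero, neg_div_neg_eq, one_div] at h1 h2
  rw [← ofReal_integral_eq_lintegral_ofReal h2
    (Filter.Eventually.of_forall fun x => (Real.exp_pos _).le), h1]

/-- Tonelli's theorem in the coordinates `x + iy` of the plane. -/
theorem lintegral_complex_eq {f : ℂ → ENNReal} (hf : AEMeasurable f) :
    ∫⁻ z, f z = ∫⁻ x : ℝ, ∫⁻ y : ℝ, f (x + y * Complex.I) := by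
  have hm := Complex.volume_preserving_equiv_real_prod.symm
  rw [← hm.lintegral_comp_emb Complex.measurableEquivRealProd.symm.measurableEmbedding]
  change ∫⁻ p, f (Complex.measurableEquivRealProd.symm p) ∂(volume.prod volume) = _
  rw [lintegral_prod]
  · refine lintegral_congr fun x => lintegral_congr fun y => ?_
    rw [Complex.measurableEquivRealProd_symm_apply, Complex.mk_eq_add_mul_I]
  · exact hf.comp_quasiMeasurePreserving hm.quasiMeasurePreserving

theorem isOpen_rightHalfPlane : IsOpen {w : ℂ | 0 < w.re} :=
  isOpen_lt continuous_const Complex.continuous_re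

/-- `π^{-1/2} invLaplace` is an isometry from `L²(0,∞)` into the Bergman space of the half-plane. -/
theorem lintegral_halfPlane_invLaplace {g : ℝ → ℂ} (hg : IntegrableOn g (Set.Ioi 0))
    (hg2 : ∫⁻ t in Set.Ioi (0 : ℝ), ‖g t‖ₑ ^ 2 ≠ ⊤) :
    ∫⁻ w in {w : ℂ | 0 < w.re}, ‖invLaplace g w‖ₑ ^ 2 =
      ENNReal.ofReal π * ∫⁻ t in Set.Ioi (0 : ℝ), ‖g t‖ₑ ^ 2 := by
  have hH := isOpen_rightHalfPlane.measurableSet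
  have hmeas : AEMeasurable (fun w => ‖invLaplace g w‖ₑ ^ 2)
      (volume.restrict {w : ℂ | 0 < w.re}) :=
    (((differentiableOn_invLaplace hg).continuousOn.aemeasurable hH).enorm).pow_const 2
  rw [← lintegral_indicator hH, lintegral_complex_eq ((aemeasurable_indicator_iff hH).2 hmeas)]
  have hx : ∀ x : ℝ, (∫⁻ y : ℝ, {w : ℂ | 0 < w.re}.indicator (fun w => ‖invLaplace g w‖ₑ ^ 2)
      (x + y * Complex.I)) = (Set.Ioi 0).indicator (fun x => ENNReal.ofReal (2 * π) *
      ∫⁻ t in Set.Ioi (0 : ℝ), ENNReal.ofReal (t⁻¹ * Real.exp (-(2 * x / t))) * ‖g t‖ₑ ^ 2) x := by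
    intro x
    by_cases h : 0 < x
    · rw [Set.indicator_of_mem (Set.mem_Ioi.2 h), ← lintegral_vertical_invLaplace hg hg2 h]
      refine lintegral_congr fun y => ?_
      rw [Set.indicator_of_mem]
      simpa using h
    · rw [Set.indicator_of_notMem (by simpa using h)]
      simp [Set.indicator, h]
  simp_rw [hx]
  rw [lintegral_indicator measurableSet_Ioi, lintegral_const_mul' _ _ ENNReal.ofReal_ne_top,
    lintegral_lintegral_swap]
  · have : ∀ t ∈ Set.Ioi (0 : ℝ), (∫⁻ x in Set.Ioi (0 : ℝ),
        ENNReal.ofReal (t⁻¹ * Real.exp (-(2 * x / t))) * ‖g t‖ₑ ^ 2) =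
        ENNReal.ofReal 2⁻¹ * ‖g t‖ₑ ^ 2 := by
      intro t ht
      have ht' : 0 < t := ht
      rw [lintegral_mul_const' _ _ (by finiteness)]
      congr 1
      have h1 : ∀ x : ℝ, ENNReal.ofReal (t⁻¹ * Real.exp (-(2 * x / t))) =
          ENNReal.ofReal t⁻¹ * ENNReal.ofReal (Real.exp (-(2 / t * x))) := by
        intro x
        rw [← ENNReal.ofReal_mul (by positivity)]
        congr 4
        ring
      simp_rw [h1]
      rw [lintegral_const_mul' _ _ ENNReal.ofReal_ne_top, lintegral_Ioi_exp (by positivity),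
        ← ENNReal.ofReal_mul (by positivity)]
      congr 1
      field_simp
    rw [setLIntegral_congr_fun measurableSet_Ioi this,
      lintegral_const_mul' _ _ ENNReal.ofReal_ne_top, ← mul_assoc,
      ← ENNReal.ofReal_mul (by positivity)]
    congr 2
    ring
  · have h1 : AEMeasurable (fun p : ℝ × ℝ => ENNReal.ofReal (p.2⁻¹ * Real.exp (-(2 * p.1 / p.2))))
        ((volume.restrict (Set.Ioi 0)).prod (volume.restrict (Set.Ioi 0))) :=
      (by fun_prop : Measurable fun p : ℝ × ℝ =>
        ENNReal.ofReal (p.2⁻¹ * Real.exp (-(2 * p.1 / p.2)))).aemeasurable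
    have h2 : AEMeasurable (fun p : ℝ × ℝ => ‖g p.2‖ₑ ^ 2)
        ((volume.restrict (Set.Ioi 0)).prod (volume.restrict (Set.Ioi 0))) :=
      ((hg.aestronglyMeasurable.aemeasurable.enorm).pow_const 2).comp_snd
    exact h1.mul h2

/-- The Jacobian determinant of a holomorphic function with derivative `c`. -/
theorem det_smul_one_complex (c : ℂ) : (c • (1 : ℂ →L[ℝ] ℂ)).det = ‖c‖ ^ 2 := by
  have h : ((c • (1 : ℂ →L[ℝ] ℂ) : ℂ →L[ℝ] ℂ) : ℂ →ₗ[ℝ] ℂ) = Algebra.lmul ℝ ℂ c := by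
    ext
    simp
  rw [ContinuousLinearMap.det, h, ← Algebra.norm_apply, Algebra.norm_complex_apply,
    Complex.normSq_eq_norm_sq]

/-- The right-angled sector `|arg s| < π/4`. -/
def sector : Set ℂ := {s | |s.im| < s.re}

theorem isOpen_sector : IsOpen sector :=
  isOpen_lt (continuous_abs.comp Complex.continuous_im) Complex.continuous_re

theorem re_sq_pos_of_mem_sector {s : ℂ} (hs : s ∈ sector) : 0 < (s ^ 2 / 4).re := by
  have h : |s.im| < s.re := hs
  have h2 := sq_lt_sq' (by linarith [abs_nonneg s.im]) h
  rw [sq_abs] at h2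
  have : (s ^ 2 / 4).re = (s.re ^ 2 - s.im ^ 2) / 4 := by
    rw [show (4 : ℂ) = ((4 : ℝ) : ℂ) by norm_num, Complex.div_ofReal_re, pow_two, Complex.mul_re]
    ring
  rw [this]
  linarith

/-- The squaring map `s ↦ s²/4`, with Jacobian `|s|²/4`, carries the bound from the half-plane to the
sector of half the opening. -/
theorem lintegral_sector_le {g : ℝ → ℂ} (hg : IntegrableOn g (Set.Ioi 0))
    (hg2 : ∫⁻ t in Set.Ioi (0 : ℝ), ‖g t‖ₑ ^ 2 ≠ ⊤) :
    ∫⁻ s in sector, ‖s * invLaplace g (s ^ 2 / 4)‖ₑ ^ 2 ≤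
      ENNReal.ofReal (4 * π) * ∫⁻ t in Set.Ioi (0 : ℝ), ‖g t‖ₑ ^ 2 := by
  have hinj : Set.InjOn (fun s : ℂ => s ^ 2 / 4) sector := by
    intro a ha b hb hab
    have hab' : a ^ 2 / 4 = b ^ 2 / 4 := hab
    have h1 : (a - b) * (a + b) = 0 := by linear_combination 4 * hab'
    rcases mul_eq_zero.1 h1 with h | h
    · exact sub_eq_zero.1 h
    · have ha' : |a.im| < a.re := ha
      have hb' : |b.im| < b.re := hb
      have := congrArg Complex.re h
      simp only [Complex.add_re, Complex.zero_re] at this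
      linarith [abs_nonneg a.im, abs_nonneg b.im]
  have hd : ∀ s ∈ sector, HasFDerivWithinAt (fun s : ℂ => s ^ 2 / 4)
      ((s / 2) • (1 : ℂ →L[ℝ] ℂ)) sector s := by
    intro s _
    have h1 : HasDerivAt (fun s : ℂ => s ^ 2 / 4) (s / 2) s := by
      refine ((hasDerivAt_pow 2 s).div_const 4).congr_deriv ?_
      norm_num
      ring
    exact h1.complexToReal_fderiv.hasFDerivWithinAt
  have key := lintegral_image_eq_lintegral_abs_det_fderiv_mul volume isOpen_sector.measurableSet
    hd hinj (fun w => ‖invLaplace g w‖ₑ ^ 2)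
  calc ∫⁻ s in sector, ‖s * invLaplace g (s ^ 2 / 4)‖ₑ ^ 2
      = ENNReal.ofReal 4 * ∫⁻ w in (fun s : ℂ => s ^ 2 / 4) '' sector, ‖invLaplace g w‖ₑ ^ 2 := by
        rw [key, ← lintegral_const_mul' _ _ ENNReal.ofReal_ne_top]
        refine lintegral_congr fun s => ?_
        rw [← mul_assoc, ← ENNReal.ofReal_mul (by norm_num), enorm_mul, mul_pow,
          det_smul_one_complex, abs_of_nonneg (by positivity), ← ofReal_norm,
          ← ENNReal.ofReal_pow (norm_nonneg _)]
        congr 2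
        rw [norm_div, div_pow, Complex.norm_ofNat]
        ring
    _ ≤ ENNReal.ofReal 4 * ∫⁻ w in {w : ℂ | 0 < w.re}, ‖invLaplace g w‖ₑ ^ 2 := by
        gcongr
        rintro _ ⟨s, hs, rfl⟩
        exact re_sq_pos_of_mem_sector hs
    _ = _ := by
        rw [lintegral_halfPlane_invLaplace hg hg2, ← mul_assoc, ← ENNReal.ofReal_mul (by norm_num)]

/-! ### The boundary kernel of the heat equation -/

/-- The boundary kernel `a / (2 √π t^{3/2}) · e^{-a²/(4t)}` of the heat equation on the half-line. It
is `0` for `t ≤ 0`, since `√t = 0` there. -/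
def gaussTerm (t : ℝ) (a : ℂ) : ℂ :=
  a * (((2 * √π * (t * √t))⁻¹ : ℝ) : ℂ) * Complex.exp (-(a ^ 2 / 4 / t))

/-- The response `K(t,s) = (2/π) ∑ n sin(ns) e^{-n²t}` of the heat equation on `(0,π)` to a unit
impulse at the endpoint `0`, written with the `z`-derivative of the Jacobi theta function. It is `0`
for `t ≤ 0`, where that derivative has the value `0`. -/
def dirichletKernel (t : ℝ) (s : ℂ) : ℂ :=
  -(1 / (2 * π ^ 2)) * jacobiTheta₂' (s / (2 * π)) (Complex.I * t / π)

theorem im_I_mul_div_pi (t : ℝ) : (Complex.I * t / π).im = t / π := by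
  rw [Complex.div_ofReal_im]; simp

theorem dirichletKernel_of_nonpos {t : ℝ} (ht : t ≤ 0) (s : ℂ) : dirichletKernel t s = 0 := by
  rw [dirichletKernel, jacobiTheta₂'_undef, mul_zero]
  rw [im_I_mul_div_pi]
  exact div_nonpos_of_nonpos_of_nonneg ht Real.pi_pos.le

theorem im_I_mul_div_pi_pos {t : ℝ} (ht : 0 < t) : 0 < (Complex.I * t / π).im := by
  rw [im_I_mul_div_pi]; exact div_pos ht Real.pi_pos

theorem differentiable_dirichletKernel (t : ℝ) : Differentiable ℂ (dirichletKernel t) := by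
  rcases le_or_gt t 0 with ht | ht
  · have : dirichletKernel t = fun _ => 0 := funext fun s => dirichletKernel_of_nonpos ht s
    rw [this]
    exact differentiable_const _
  · have h1 : Differentiable ℂ (fun z => jacobiTheta₂ z (Complex.I * t / π)) :=
      fun z => differentiableAt_jacobiTheta₂_fst z (im_I_mul_div_pi_pos ht)
    have h2 : deriv (fun z => jacobiTheta₂ z (Complex.I * t / π)) =
        fun z => jacobiTheta₂' z (Complex.I * t / π) :=
      funext fun z => (hasDerivAt_jacobiTheta₂_fst z (im_I_mul_div_pi_pos ht)).deriv
    have h3 : Differentiable ℂ (fun z => jacobiTheta₂' z (Complex.I * t / π)) := by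
      rw [← h2]
      exact h1.deriv
    unfold dirichletKernel
    exact (h3.comp (differentiable_id.div_const _)).const_mul _

theorem continuousOn_dirichletKernel :
    ContinuousOn (fun p : ℝ × ℂ => dirichletKernel p.1 p.2) (Set.Ioi 0 ×ˢ Set.univ) := by
  rintro ⟨t, s⟩ ⟨ht, -⟩
  refine ContinuousAt.continuousWithinAt ?_
  have h := continuousAt_jacobiTheta₂' (s / (2 * π)) (im_I_mul_div_pi_pos ht)
  refine ContinuousAt.mul continuousAt_const ?_
  refine ContinuousAt.comp (f := fun p : ℝ × ℂ => (p.2 / (2 * π), Complex.I * p.1 / π))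
    (x := (t, s)) h ?_
  fun_prop

theorem measurable_dirichletKernel :
    Measurable (fun p : ℝ × ℂ => dirichletKernel p.1 p.2) := by
  have hm : MeasurableSet (Set.Ioi (0 : ℝ) ×ˢ (Set.univ : Set ℂ)) :=
    measurableSet_Ioi.prod MeasurableSet.univ
  have : (fun p : ℝ × ℂ => dirichletKernel p.1 p.2) =
      (Set.Ioi (0 : ℝ) ×ˢ (Set.univ : Set ℂ)).indicator
        (fun p : ℝ × ℂ => dirichletKernel p.1 p.2) := by
    ext p
    by_cases hp : p ∈ Set.Ioi (0 : ℝ) ×ˢ (Set.univ : Set ℂ)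
    · rw [Set.indicator_of_mem hp]
    · rw [Set.indicator_of_notMem hp]
      refine dirichletKernel_of_nonpos ?_ _
      by_contra h
      exact hp ⟨not_le.1 h, trivial⟩
  rw [this]
  classical
  rw [← Set.piecewise_eq_indicator]
  exact continuousOn_dirichletKernel.measurable_piecewise continuousOn_const hm

/-- The kernel as a sum over image points: this is the functional equation of the theta function. -/
theorem hasSum_gaussTerm {t : ℝ} (ht : 0 < t) (s : ℂ) :
    HasSum (fun n : ℤ => gaussTerm t (s - 2 * π * n)) (dirichletKernel t s) := by
  set τ : ℂ := Complex.I * t / π with hτ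
  set z : ℂ := s / (2 * π) with hz
  have hπ : (π : ℂ) ≠ 0 := by exact_mod_cast Real.pi_ne_zero
  have htc : (t : ℂ) ≠ 0 := by exact_mod_cast ht.ne'
  have hτ0 : τ ≠ 0 := by simp [hτ, hπ, htc]
  have him : 0 < (-1 / τ).im := by
    have : -1 / τ = Complex.I * (π ^ 2 / t : ℝ) / π := by
      rw [hτ]; push_cast; field_simp; simp
    rw [this]
    exact im_I_mul_div_pi_pos (by positivity)
  have h1 := (hasSum_jacobiTheta₂'_term (z / τ) him).sub
    ((hasSum_jacobiTheta₂_term (z / τ) him).mul_left (2 * π * Complex.I * z))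
  have h2 := h1.mul_left (-(1 / (2 * (π : ℂ) ^ 2)) *
    (1 / (-Complex.I * τ) ^ (1 / 2 : ℂ) * Complex.exp (-π * Complex.I * z ^ 2 / τ) / τ))
  rw [dirichletKernel, jacobiTheta₂'_functional_equation, ← mul_assoc]
  convert! h2 using 1
  ext n
  simp only [jacobiTheta₂'_term, jacobiTheta₂_term, gaussTerm]
  have hroot : (-Complex.I * τ) ^ (1 / 2 : ℂ) = ((√t / √π : ℝ) : ℂ) := by
    have : -Complex.I * τ = ((t / π : ℝ) : ℂ) := by
      rw [hτ]; push_cast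
      linear_combination (-(t / π : ℂ)) * Complex.I_mul_I
    rw [this, ← Real.sqrt_div' _ Real.pi_pos.le, Real.sqrt_eq_rpow,
      Complex.ofReal_cpow (by positivity)]
    push_cast
    rfl
  have hexp : Complex.exp (-((s - 2 * π * n) ^ 2 / 4 / t)) =
      Complex.exp (-π * Complex.I * z ^ 2 / τ) *
      Complex.exp (2 * π * Complex.I * n * (z / τ) + π * Complex.I * n ^ 2 * (-1 / τ)) := by
    rw [← Complex.exp_add]
    congr 1
    rw [hz, hτ]
    field_simp
    ring
  rw [hexp, hroot]
  have hsπ : (√π : ℂ) ≠ 0 := by exact_mod_cast (Real.sqrt_pos.2 Real.pi_pos).ne'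
  have hst : (√t : ℂ) ≠ 0 := by exact_mod_cast (Real.sqrt_pos.2 ht).ne'
  have hsq : (√π : ℂ) ^ 2 = π := by exact_mod_cast Real.sq_sqrt Real.pi_pos.le
  have hcoef : (s - 2 * π * n) * (((2 * √π * (t * √t))⁻¹ : ℝ) : ℂ) =
      -(1 / (2 * (π : ℂ) ^ 2)) * (1 / ((√t / √π : ℝ) : ℂ) / τ) *
        (2 * π * Complex.I * n - 2 * π * Complex.I * z) := by
    rw [hz, hτ]
    push_cast
    field_simp
    rw [hsq]
    ring
  rw [hcoef]
  ring

/-- The kernel as a sine series. -/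
theorem hasSum_sine_dirichletKernel {t : ℝ} (ht : 0 < t) (s : ℂ) :
    HasSum (fun n : ℕ => (2 / π : ℂ) * (n * Complex.sin (n * s) * Complex.exp (-(n ^ 2 * t))))
      (dirichletKernel t s) := by
  have h := (hasSum_jacobiTheta₂'_term (s / (2 * π)) (im_I_mul_div_pi_pos ht)).mul_left
    (-(1 / (2 * (π : ℂ) ^ 2)))
  have h2 := h.nat_add_neg
  have hπ : (π : ℂ) ≠ 0 := by exact_mod_cast Real.pi_ne_zero
  rw [dirichletKernel]
  have h0 : jacobiTheta₂'_term 0 (s / (2 * π)) (Complex.I * t / π) = 0 := by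
    simp [jacobiTheta₂'_term]
  rw [h0, mul_zero, add_zero] at h2
  convert! h2 using 1
  ext n
  simp only [jacobiTheta₂'_term, jacobiTheta₂_term]
  have e1 : Complex.exp (2 * π * Complex.I * (n : ℤ) * (s / (2 * π)) +
      π * Complex.I * (n : ℤ) ^ 2 * (Complex.I * t / π)) =
      Complex.exp (n * s * Complex.I) * Complex.exp (-(n ^ 2 * t)) := by
    rw [← Complex.exp_add]
    congr 1
    push_cast
    field_simp
    linear_combination (n ^ 2 * t : ℂ) * Complex.I_sq
  have e2 : Complex.exp (2 * π * Complex.I * ((-(n : ℤ) : ℤ) : ℂ) * (s / (2 * π)) +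
      π * Complex.I * ((-(n : ℤ) : ℤ) : ℂ) ^ 2 * (Complex.I * t / π)) =
      Complex.exp (-(n * s) * Complex.I) * Complex.exp (-(n ^ 2 * t)) := by
    rw [← Complex.exp_add]
    congr 1
    push_cast
    field_simp
    linear_combination (n ^ 2 * t : ℂ) * Complex.I_sq
  rw [e1, e2, Complex.sin]
  push_cast
  field_simp
  ring

/-! ### Bounds for the kernel on the square -/

/-- The open square with diagonal `(0,π)`, that is, the rhombus with `Θ = π/4`. -/
def square : Set ℂ := {s | |s.im| < s.re ∧ |s.im| < π - s.re}

theorem isOpen_square : IsOpen square :=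
  (isOpen_lt (continuous_abs.comp Complex.continuous_im) Complex.continuous_re).inter
    (isOpen_lt (continuous_abs.comp Complex.continuous_im)
      (continuous_const.sub Complex.continuous_re))

theorem rhombus_subset_square {Θ : ℝ} (h0 : 0 < Real.tan Θ) (h1 : Real.tan Θ ≤ 1) :
    rhombus Θ ⊆ square := by
  rintro s ⟨hs1, hs2⟩
  have h3 : 0 < s.re := by
    by_contra h
    nlinarith [abs_nonneg s.im]
  have h4 : 0 < π - s.re := by
    by_contra h
    nlinarith [abs_nonneg s.im]
  exact ⟨by nlinarith, by nlinarith⟩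

theorem square_subset_sector : square ⊆ sector := fun _ hs => hs.1

theorem sub_mem_square {s : ℂ} (hs : s ∈ square) : (π : ℂ) - s ∈ square := by
  obtain ⟨h1, h2⟩ := hs
  constructor <;> simp <;> assumption

theorem ofReal_mem_square {x : ℝ} (hx : x ∈ Set.Ioo 0 π) : (x : ℂ) ∈ square := by
  constructor
  · simpa using hx.1
  · simpa using hx.2

theorem norm_lt_of_mem_square {s : ℂ} (hs : s ∈ square) : ‖s‖ < 2 * π := by
  obtain ⟨h1, h2⟩ := hs
  have := Complex.norm_le_abs_re_add_abs_im s
  have h3 : |s.re| = s.re := abs_of_nonneg (by linarith [abs_nonneg s.im])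
  linarith [abs_nonneg s.im]

theorem re_sq_div_four (a : ℂ) : (a ^ 2 / 4).re = (a.re ^ 2 - a.im ^ 2) / 4 := by
  rw [show (4 : ℂ) = ((4 : ℝ) : ℂ) by norm_num, Complex.div_ofReal_re, pow_two, Complex.mul_re]
  ring

theorem norm_gaussTerm {t : ℝ} (ht : 0 < t) (a : ℂ) : ‖gaussTerm t a‖ =
    ‖a‖ * (2 * √π)⁻¹ * ((t * √t)⁻¹ * Real.exp (-((a ^ 2 / 4).re / t))) := by
  rw [gaussTerm, norm_mul, norm_mul, Complex.norm_real, Complex.norm_exp,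
    Real.norm_of_nonneg (by positivity), Complex.neg_re, Complex.div_ofReal_re, mul_inv]
  ring

theorem gaussTerm_of_nonpos {t : ℝ} (ht : t ≤ 0) (a : ℂ) : gaussTerm t a = 0 := by
  simp [gaussTerm, Real.sqrt_eq_zero_of_nonpos ht]

/-- A bound for the kernel of the half-line that is uniform in time. -/
theorem norm_gaussTerm_le (t : ℝ) {a : ℂ} {x : ℝ} (hx : 0 < x) (hax : x ≤ (a ^ 2 / 4).re) :
    ‖gaussTerm t a‖ ≤ ‖a‖ * (2 * √π)⁻¹ * (x * √x)⁻¹ := by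
  rcases le_or_gt t 0 with ht | ht
  · rw [gaussTerm_of_nonpos ht, norm_zero]
    positivity
  rw [norm_gaussTerm ht]
  refine mul_le_mul_of_nonneg_left ?_ (by positivity)
  refine le_trans ?_ (inv_mul_sqrt_mul_exp_le hx ht)
  gcongr

/-- The image points `s - 2πn`, `n ≠ 0`, keep away from the lines `arg = ±π/4` in a quantitative
way, uniformly for `s` in the square. -/
theorem le_re_sq_sub_of_mem_square {s : ℂ} (hs : s ∈ square) {n : ℤ} (hn : n ≠ 0) :
    (π * |(n : ℝ)| / 2) ^ 2 ≤ ((s - 2 * π * n) ^ 2 / 4).re := by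
  obtain ⟨h1, h2⟩ := hs
  have hre : (s - 2 * π * n).re = s.re - 2 * π * n := by simp
  have him : (s - 2 * π * n).im = s.im := by simp
  rw [re_sq_div_four, hre, him, div_pow, mul_pow, sq_abs, ← sq_abs s.im]
  have hπ := Real.pi_pos
  have hy := abs_nonneg s.im
  rcases lt_or_gt_of_ne hn with h | h
  · have h' : (n : ℝ) ≤ -1 := by exact_mod_cast Int.le_sub_one_of_lt h
    have e1 : |s.im| ^ 2 ≤ s.re ^ 2 := by gcongr
    nlinarith [mul_nonneg (mul_nonneg hπ.le (by linarith : (0:ℝ) ≤ -n)) (by linarith : 0 ≤ s.re),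
      mul_nonneg (sq_nonneg π) (sq_nonneg (n : ℝ))]
  · have h' : (1 : ℝ) ≤ n := by exact_mod_cast h
    have e1 : |s.im| ^ 2 ≤ (π - s.re) ^ 2 := by gcongr
    have e2 : (π * (2 * n - 1)) * (π * (2 * n - 1)) ≤
        (π * (2 * n - 1)) * (2 * π * n + π - 2 * s.re) := by
      apply mul_le_mul_of_nonneg_left
      · nlinarith
      · apply mul_nonneg hπ.le; linarith
    have e3 : π ^ 2 * (n : ℝ) ^ 2 ≤ (π * (2 * n - 1)) * (π * (2 * n - 1)) := by
      have : (n : ℝ) ^ 2 ≤ (2 * n - 1) ^ 2 := by gcongr; linarith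
      nlinarith [sq_nonneg π]
    nlinarith

theorem norm_gaussTerm_image_le (t : ℝ) {s : ℂ} (hs : s ∈ square) {n : ℤ} (hn : n ≠ 0) :
    ‖gaussTerm t (s - 2 * π * n)‖ ≤ 2 * (1 / (n : ℝ) ^ 2) := by
  have hn1 : (1 : ℝ) ≤ |(n : ℝ)| := by exact_mod_cast Int.one_le_abs hn
  have hπ3 := Real.pi_gt_three
  have hx : 0 < π * |(n : ℝ)| / 2 := by positivity
  refine (norm_gaussTerm_le t (by positivity) (le_re_sq_sub_of_mem_square hs hn)).trans ?_
  have h1 : ‖s - 2 * π * n‖ ≤ 4 * π * |(n : ℝ)| := by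
    refine (norm_sub_le _ _).trans ?_
    have e : ‖(2 * π * n : ℂ)‖ = 2 * π * |(n : ℝ)| := by
      rw [norm_mul, norm_mul, Complex.norm_real, Complex.norm_intCast, Real.norm_of_nonneg
        Real.pi_pos.le]
      simp
    rw [e]
    nlinarith [norm_lt_of_mem_square hs]
  rw [Real.sqrt_sq hx.le]
  have hsp : 1 ≤ √π := Real.one_le_sqrt.2 (by linarith)
  calc ‖s - 2 * π * n‖ * (2 * √π)⁻¹ * ((π * |(n : ℝ)| / 2) ^ 2 * (π * |(n : ℝ)| / 2))⁻¹
      ≤ (4 * π * |(n : ℝ)|) * (2 * 1)⁻¹ * ((π * |(n : ℝ)| / 2) ^ 2 * (π * |(n : ℝ)| / 2))⁻¹ := by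
        gcongr
    _ = 16 / π ^ 2 * (1 / |(n : ℝ)| ^ 2) := by field_simp; norm_num
    _ ≤ 2 * (1 / (n : ℝ) ^ 2) := by
        rw [sq_abs]
        gcongr
        rw [div_le_iff₀ (by positivity)]
        nlinarith

/-- A bound for the terms `n ≠ 0` of the sum over the images; the term `n = 0` of this series is
`0`, since `1 / 0 = 0`. -/
def remainderBound : ℝ := ∑' n : ℤ, 2 * (1 / (n : ℝ) ^ 2)

/-- On the square the kernel of the rod differs from that of the half-line by a bounded function. -/
theorem norm_dirichletKernel_sub_gaussTerm_le (t : ℝ) {s : ℂ} (hs : s ∈ square) :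
    ‖dirichletKernel t s - gaussTerm t s‖ ≤ remainderBound := by
  have hsum : Summable fun n : ℤ => 2 * (1 / (n : ℝ) ^ 2) :=
    (Real.summable_one_div_int_pow.2 (by norm_num)).mul_left 2
  have hnn : ∀ n : ℤ, 0 ≤ 2 * (1 / (n : ℝ) ^ 2) := fun n => by positivity
  rcases le_or_gt t 0 with ht | ht
  · rw [dirichletKernel_of_nonpos ht, gaussTerm_of_nonpos ht, sub_zero, norm_zero]
    exact tsum_nonneg hnn
  have h1 := (hasSum_gaussTerm ht s).sub (hasSum_ite_eq (0 : ℤ) (gaussTerm t s))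
  rw [← h1.tsum_eq]
  refine tsum_of_norm_bounded hsum.hasSum fun n => ?_
  by_cases hn : n = 0
  · simp [hn]
  · simpa [hn] using norm_gaussTerm_image_le t hs hn

theorem re_sq_pos_of_mem_square {s : ℂ} (hs : s ∈ square) : 0 < (s ^ 2 / 4).re :=
  re_sq_pos_of_mem_sector (square_subset_sector hs)

theorem norm_dirichletKernel_le (t : ℝ) {s : ℂ} (hs : s ∈ square) :
    ‖dirichletKernel t s‖ ≤
      ‖s‖ * (2 * √π)⁻¹ * ((s ^ 2 / 4).re * √(s ^ 2 / 4).re)⁻¹ + remainderBound := by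
  have h1 := norm_gaussTerm_le t (re_sq_pos_of_mem_square hs) le_rfl
  have h2 := norm_dirichletKernel_sub_gaussTerm_le t hs
  have h3 := norm_le_norm_add_norm_sub' (dirichletKernel t s) (gaussTerm t s)
  linarith

/-- On the square the kernel is locally bounded, uniformly in time. -/
theorem exists_bound_dirichletKernel {s : ℂ} (hs : s ∈ square) :
    ∃ r > 0, ∃ M : ℝ, ∀ z ∈ Metric.ball s r, ∀ t, ‖dirichletKernel t z‖ ≤ M := by
  set B : ℂ → ℝ := fun s =>
    ‖s‖ * (2 * √π)⁻¹ * ((s ^ 2 / 4).re * √(s ^ 2 / 4).re)⁻¹ + remainderBound with hB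
  have hpos := re_sq_pos_of_mem_square hs
  have hc : ContinuousAt B s := by
    have hcre : ContinuousAt (fun s : ℂ => (s ^ 2 / 4).re) s :=
      (Complex.continuous_re.comp (by fun_prop)).continuousAt
    have hc2 : ContinuousAt (fun s : ℂ => ((s ^ 2 / 4).re * √(s ^ 2 / 4).re)⁻¹) s :=
      (hcre.mul hcre.sqrt).inv₀ (mul_pos hpos (Real.sqrt_pos.2 hpos)).ne'
    exact ((continuousAt_id.norm.mul continuousAt_const).mul hc2).add continuousAt_const
  have h1 : ∀ᶠ z in nhds s, B z < B s + 1 := hc.eventually_lt_const (by linarith)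
  obtain ⟨r, hr, hsub⟩ := Metric.eventually_nhds_iff_ball.1
    (h1.and (isOpen_square.mem_nhds hs))
  exact ⟨r, hr, B s + 1, fun z hz t =>
    (norm_dirichletKernel_le t (hsub z hz).2).trans (hsub z hz).1.le⟩

/-! ### The response to data at one endpoint -/

section

/-- The value at time `τ` of the holomorphic extension of the solution with boundary value `g` at
the endpoint `0` and boundary value `0` at `π`. -/
def heatInt (τ : ℝ) (g : ℝ → ℂ) (s : ℂ) : ℂ :=
  ∫ σ in Set.Icc 0 τ, dirichletKernel (τ - σ) s * g σ

theorem measurable_dirichletKernel_left (τ : ℝ) (s : ℂ) :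
    Measurable fun σ : ℝ => dirichletKernel (τ - σ) s :=
  Measurable.comp (g := fun p : ℝ × ℂ => dirichletKernel p.1 p.2) (f := fun σ : ℝ => (τ - σ, s))
    measurable_dirichletKernel (by fun_prop)

theorem measurable_gaussTerm (s : ℂ) : Measurable fun t : ℝ => gaussTerm t s := by
  unfold gaussTerm
  fun_prop

variable {τ : ℝ} {g : ℝ → ℂ}

theorem integrableOn_heatInt (hg : IntegrableOn g (Set.Icc 0 τ)) {s : ℂ} (hs : s ∈ square) :
    IntegrableOn (fun σ => dirichletKernel (τ - σ) s * g σ) (Set.Icc 0 τ) := by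
  obtain ⟨r, hr, M, hM⟩ := exists_bound_dirichletKernel hs
  exact hg.bdd_mul (measurable_dirichletKernel_left τ s).aestronglyMeasurable
    (Filter.Eventually.of_forall fun σ => hM s (Metric.mem_ball_self hr) _)

theorem differentiableOn_heatInt (hg : IntegrableOn g (Set.Icc 0 τ)) :
    DifferentiableOn ℂ (heatInt τ g) square := by
  refine differentiableOn_integral isOpen_square
    (fun s hs => (integrableOn_heatInt hg hs).aestronglyMeasurable) ?_ ?_
  · exact Filter.Eventually.of_forall fun σ =>
      ((differentiable_dirichletKernel _).mul_const _).differentiableOn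
  · intro s hs
    obtain ⟨r, hr, M, hM⟩ := exists_bound_dirichletKernel hs
    refine ⟨r, hr, fun σ => M * ‖g σ‖, hg.norm.const_mul M, ?_⟩
    refine Filter.Eventually.of_forall fun σ z hz => ?_
    rw [norm_mul]
    exact mul_le_mul_of_nonneg_right (hM z hz _) (norm_nonneg _)

/-- The boundary data with time reversed, extended by zero. -/
def reversed (τ : ℝ) (g : ℝ → ℂ) (t : ℝ) : ℂ := (Set.Icc 0 τ).indicator g (τ - t)

theorem integrable_reversed (hg : IntegrableOn g (Set.Icc 0 τ)) : Integrable (reversed τ g) :=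
  ((integrable_indicator_iff measurableSet_Icc).2 hg).comp_sub_left τ

theorem lintegral_reversed_le :
    ∫⁻ t in Set.Ioi (0 : ℝ), ‖reversed τ g t‖ₑ ^ 2 ≤ ∫⁻ t in Set.Icc 0 τ, ‖g t‖ₑ ^ 2 := by
  calc ∫⁻ t in Set.Ioi (0 : ℝ), ‖reversed τ g t‖ₑ ^ 2
      ≤ ∫⁻ t, ‖reversed τ g t‖ₑ ^ 2 := setLIntegral_le_lintegral _ _
    _ = ∫⁻ t, ‖(Set.Icc 0 τ).indicator g t‖ₑ ^ 2 :=
        lintegral_sub_left_eq_self (fun t => ‖(Set.Icc 0 τ).indicator g t‖ₑ ^ 2) τ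
    _ = ∫⁻ t in Set.Icc 0 τ, ‖g t‖ₑ ^ 2 := by
        rw [← lintegral_indicator measurableSet_Icc]
        refine lintegral_congr fun t => ?_
        by_cases h : t ∈ Set.Icc 0 τ <;> simp [h]

/-- The contribution of the half-line kernel to `heatInt`, in the variable `w = s²/4`. -/
theorem setIntegral_gaussTerm_eq (s : ℂ) :
    ∫ σ in Set.Icc 0 τ, gaussTerm (τ - σ) s * g σ =
      (((2 * √π)⁻¹ : ℝ) : ℂ) * (s * invLaplace (reversed τ g) (s ^ 2 / 4)) := by
  have h1 : ∫ σ in Set.Icc 0 τ, gaussTerm (τ - σ) s * g σ =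
      ∫ t, gaussTerm t s * reversed τ g t := by
    rw [← integral_indicator measurableSet_Icc,
      ← integral_sub_left_eq_self (fun t => gaussTerm t s * reversed τ g t) volume τ]
    refine integral_congr_ae (Filter.Eventually.of_forall fun σ => ?_)
    by_cases h : σ ∈ Set.Icc 0 τ <;> simp [reversed, h]
  have h2 : ∫ t, gaussTerm t s * reversed τ g t =
      ∫ t in Set.Ioi (0 : ℝ), gaussTerm t s * reversed τ g t := by
    refine (setIntegral_eq_integral_of_forall_compl_eq_zero fun t ht => ?_).symm
    rw [gaussTerm_of_nonpos (by simpa using ht), zero_mul]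
  rw [h1, h2, invLaplace, ← integral_const_mul, ← integral_const_mul]
  refine integral_congr_ae (Filter.Eventually.of_forall fun t => ?_)
  simp only [gaussTerm]
  rw [mul_inv]
  push_cast
  ring

/-- The Cauchy–Schwarz inequality against the constant function `1`. -/
theorem sq_lintegral_enorm_le (μ : Measure ℝ) (hg : AEMeasurable g μ) :
    (∫⁻ t, ‖g t‖ₑ ∂μ) ^ 2 ≤ μ Set.univ * ∫⁻ t, ‖g t‖ₑ ^ 2 ∂μ := by
  have h := ENNReal.lintegral_mul_le_Lp_mul_Lq μ Real.HolderConjugate.two_two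
    hg.enorm (aemeasurable_const (b := (1 : ENNReal)))
  simp only [Pi.mul_apply, mul_one, ENNReal.rpow_ofNat, one_pow, lintegral_one] at h
  calc (∫⁻ t, ‖g t‖ₑ ∂μ) ^ 2 ≤
      ((∫⁻ t, ‖g t‖ₑ ^ 2 ∂μ) ^ (1 / 2 : ℝ) * μ Set.univ ^ (1 / 2 : ℝ)) ^ 2 := by gcongr
    _ = _ := by
      rw [mul_pow, ← ENNReal.rpow_mul_natCast, ← ENNReal.rpow_mul_natCast]
      norm_num
      rw [mul_comm]

theorem enorm_sq_add_le (a b : ℂ) : ‖a + b‖ₑ ^ 2 ≤ 2 * ‖a‖ₑ ^ 2 + 2 * ‖b‖ₑ ^ 2 := by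
  have h1 : ‖a + b‖ ^ 2 ≤ 2 * ‖a‖ ^ 2 + 2 * ‖b‖ ^ 2 := by
    have := norm_add_le a b
    nlinarith [sq_nonneg (‖a‖ - ‖b‖), norm_nonneg (a + b), norm_nonneg a, norm_nonneg b]
  rw [← ofReal_norm, ← ofReal_norm, ← ofReal_norm, ← ENNReal.ofReal_pow (norm_nonneg _),
    ← ENNReal.ofReal_pow (norm_nonneg _), ← ENNReal.ofReal_pow (norm_nonneg _)]
  rw [show (2 : ENNReal) = ENNReal.ofReal 2 by simp, ← ENNReal.ofReal_mul (by norm_num),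
    ← ENNReal.ofReal_mul (by norm_num), ← ENNReal.ofReal_add (by positivity) (by positivity)]
  exact ENNReal.ofReal_le_ofReal h1

theorem volume_square_ne_top : volume square ≠ ⊤ := by
  refine ((Metric.isBounded_ball (x := (0 : ℂ)) (r := 2 * π)).subset fun s hs => ?_).measure_lt_top.ne
  simpa using norm_lt_of_mem_square hs

/-- The constant in the `L²` bound for `heatInt`. -/
def heatIntBound (τ : ℝ) : ENNReal :=
  2 + 2 * (ENNReal.ofReal remainderBound ^ 2 * ENNReal.ofReal τ * volume square)

theorem heatIntBound_ne_top (τ : ℝ) : heatIntBound τ ≠ ⊤ := by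
  have := volume_square_ne_top
  unfold heatIntBound
  finiteness

/-- The input map is bounded into the unweighted Bergman space of the square. The main term is,
after the substitutions `w = s²/4` and `v = 1/t`, a Laplace transform, which Plancherel's theorem
shows to be bounded although its kernel is not absolutely bounded up to the sides at `0`. -/
theorem lintegral_heatInt_le (hg : MemLp g 2 (volume.restrict (Set.Icc 0 τ))) :
    ∫⁻ s in square, ‖heatInt τ g s‖ₑ ^ 2 ≤ heatIntBound τ * ∫⁻ t in Set.Icc 0 τ, ‖g t‖ₑ ^ 2 := by
  have hg1 : IntegrableOn g (Set.Icc 0 τ) := hg.integrable (by norm_num)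
  set N := ∫⁻ t in Set.Icc 0 τ, ‖g t‖ₑ ^ 2 with hN
  have hNtop : N ≠ ⊤ := by
    have := (eLpNorm_lt_top_iff_lintegral_rpow_enorm_lt_top (by norm_num) (by norm_num)).1 hg.2
    simp only [ENNReal.toReal_ofNat, ENNReal.rpow_ofNat] at this
    exact this.ne
  have hr1 : IntegrableOn (reversed τ g) (Set.Ioi 0) := (integrable_reversed hg1).integrableOn
  have hr2 : ∫⁻ t in Set.Ioi (0 : ℝ), ‖reversed τ g t‖ₑ ^ 2 ≠ ⊤ :=
    (lintegral_reversed_le.trans_lt hNtop.lt_top).ne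
  set m : ℂ → ℂ := fun s => s * invLaplace (reversed τ g) (s ^ 2 / 4) with hm
  have hpt : ∀ s ∈ square, ‖heatInt τ g s‖ₑ ^ 2 ≤
      2 * (ENNReal.ofReal ((2 * √π)⁻¹) ^ 2 * ‖m s‖ₑ ^ 2) +
      2 * (ENNReal.ofReal remainderBound ^ 2 * ENNReal.ofReal τ * N) := by
    intro s hs
    have hi := integrableOn_heatInt hg1 hs
    have hgi : IntegrableOn (fun σ => gaussTerm (τ - σ) s * g σ) (Set.Icc 0 τ) :=
      hg1.bdd_mul ((measurable_gaussTerm s).comp (by fun_prop : Measurable fun σ : ℝ =>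
        τ - σ)).aestronglyMeasurable (Filter.Eventually.of_forall fun σ =>
          norm_gaussTerm_le (τ - σ) (re_sq_pos_of_mem_square hs) le_rfl)
    have hsplit : heatInt τ g s = (((2 * √π)⁻¹ : ℝ) : ℂ) * m s +
        ∫ σ in Set.Icc 0 τ, (dirichletKernel (τ - σ) s - gaussTerm (τ - σ) s) * g σ := by
      rw [hm, ← setIntegral_gaussTerm_eq, ← integral_add hgi]
      · refine integral_congr_ae (Filter.Eventually.of_forall fun σ => ?_)
        ring
      · simp_rw [sub_mul]
        exact hi.sub hgi
    rw [hsplit]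
    refine (enorm_sq_add_le _ _).trans ?_
    gcongr
    · rw [enorm_mul, mul_pow, ← ofReal_norm (((2 * √π)⁻¹ : ℝ) : ℂ), Complex.norm_real,
        Real.norm_of_nonneg (by positivity)]
    · have h1 : ‖∫ σ in Set.Icc 0 τ, (dirichletKernel (τ - σ) s - gaussTerm (τ - σ) s) * g σ‖ₑ ≤
          ENNReal.ofReal remainderBound * ∫⁻ σ in Set.Icc 0 τ, ‖g σ‖ₑ := by
        refine (enorm_integral_le_lintegral_enorm _).trans ?_
        rw [← lintegral_const_mul' _ _ ENNReal.ofReal_ne_top]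
        refine lintegral_mono fun σ => ?_
        rw [enorm_mul]
        gcongr
        rw [← ofReal_norm]
        exact ENNReal.ofReal_le_ofReal (norm_dirichletKernel_sub_gaussTerm_le _ hs)
      calc _ ≤ (ENNReal.ofReal remainderBound * ∫⁻ σ in Set.Icc 0 τ, ‖g σ‖ₑ) ^ 2 := by gcongr
        _ ≤ ENNReal.ofReal remainderBound ^ 2 * (ENNReal.ofReal τ * N) := by
          rw [mul_pow]
          gcongr
          refine (sq_lintegral_enorm_le _ hg1.aestronglyMeasurable.aemeasurable).trans ?_
          simp [Real.volume_Icc, hN]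
        _ = _ := by rw [mul_assoc]
  calc ∫⁻ s in square, ‖heatInt τ g s‖ₑ ^ 2
      ≤ ∫⁻ s in square, (2 * (ENNReal.ofReal ((2 * √π)⁻¹) ^ 2 * ‖m s‖ₑ ^ 2) +
        2 * (ENNReal.ofReal remainderBound ^ 2 * ENNReal.ofReal τ * N)) :=
        setLIntegral_mono' isOpen_square.measurableSet hpt
    _ = 2 * (ENNReal.ofReal ((2 * √π)⁻¹) ^ 2 * ∫⁻ s in square, ‖m s‖ₑ ^ 2) +
        2 * (ENNReal.ofReal remainderBound ^ 2 * ENNReal.ofReal τ * N) * volume square := by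
        rw [lintegral_add_right _ measurable_const, lintegral_const_mul' _ _ (by finiteness),
          lintegral_const_mul' _ _ (by finiteness)]
        simp
    _ ≤ 2 * N + 2 * (ENNReal.ofReal remainderBound ^ 2 * ENNReal.ofReal τ * N) * volume square := by
        gcongr
        calc ENNReal.ofReal ((2 * √π)⁻¹) ^ 2 * ∫⁻ s in square, ‖m s‖ₑ ^ 2
            ≤ ENNReal.ofReal ((2 * √π)⁻¹) ^ 2 * (ENNReal.ofReal (4 * π) * N) := by
              gcongr
              exact (lintegral_mono_set square_subset_sector).trans
                ((lintegral_sector_le hr1 hr2).trans (by gcongr; exact lintegral_reversed_le))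
          _ = N := by
              rw [← mul_assoc, ← ENNReal.ofReal_pow (by positivity),
                ← ENNReal.ofReal_mul (by positivity)]
              have : (2 * √π)⁻¹ ^ 2 * (4 * π) = 1 := by
                have h2 := Real.sq_sqrt Real.pi_pos.le
                have h3 := Real.pi_pos
                rw [inv_pow, mul_pow, h2]
                field_simp
                norm_num
              rw [this, ENNReal.ofReal_one, one_mul]
    _ = heatIntBound τ * N := by rw [heatIntBound]; ring

end

/-! ### The input map -/

section

variable {τ δ Θ : ℝ}

theorem memLp_input (u : Input τ) (i : Fin 2) :
    MemLp (fun σ => u σ i) 2 (volume.restrict (Set.Icc 0 τ)) :=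
  (Lp.memLp u).mono
    ((EuclideanSpace.proj (𝕜 := ℂ) i).continuous.comp_aestronglyMeasurable
      (Lp.aestronglyMeasurable u))
    (Filter.Eventually.of_forall fun σ => PiLp.norm_apply_le (u σ) i)

theorem integrableOn_input (u : Input τ) (i : Fin 2) :
    IntegrableOn (fun σ => u σ i) (Set.Icc 0 τ) :=
  (memLp_input u i).integrable (by norm_num)

theorem lintegral_input_le (u : Input τ) (i : Fin 2) :
    ∫⁻ σ in Set.Icc 0 τ, ‖u σ i‖ₑ ^ 2 ≤ ‖u‖ₑ ^ 2 := by
  rw [Lp.enorm_sq_eq_lintegral]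
  refine lintegral_mono fun σ => ?_
  gcongr
  exact enorm_le_iff_norm_le.2 (PiLp.norm_apply_le (u σ) i)

/-- The holomorphic extension to the square of the state `z(τ,·)` reached with the input `u`. -/
def inputFun (τ : ℝ) (u : Input τ) (s : ℂ) : ℂ :=
  heatInt τ (fun σ => u σ 0) s + heatInt τ (fun σ => u σ 1) (π - s)

theorem differentiableOn_inputFun (u : Input τ) : DifferentiableOn ℂ (inputFun τ u) square :=
  (differentiableOn_heatInt (integrableOn_input u 0)).add
    ((differentiableOn_heatInt (integrableOn_input u 1)).comp
      ((differentiableOn_const _).sub differentiableOn_id) fun _ hs => sub_mem_square hs)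

theorem heatInt_congr {g h : ℝ → ℂ} (H : g =ᵐ[volume.restrict (Set.Icc 0 τ)] h) (s : ℂ) :
    heatInt τ g s = heatInt τ h s := by
  refine integral_congr_ae ?_
  filter_upwards [H] with σ hσ
  rw [hσ]

theorem heatInt_add {g h : ℝ → ℂ} (hg : IntegrableOn g (Set.Icc 0 τ))
    (hh : IntegrableOn h (Set.Icc 0 τ)) {s : ℂ} (hs : s ∈ square) :
    heatInt τ (fun σ => g σ + h σ) s = heatInt τ g s + heatInt τ h s := by
  simp only [heatInt, mul_add]
  exact integral_add (integrableOn_heatInt hg hs) (integrableOn_heatInt hh hs)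

theorem heatInt_const_mul (c : ℂ) (g : ℝ → ℂ) (s : ℂ) :
    heatInt τ (fun σ => c * g σ) s = c * heatInt τ g s := by
  simp only [heatInt]
  rw [← integral_const_mul]
  congr 1
  ext σ
  ring

theorem inputFun_add (u v : Input τ) {s : ℂ} (hs : s ∈ square) :
    inputFun τ (u + v) s = inputFun τ u s + inputFun τ v s := by
  have h : ∀ i : Fin 2, (fun σ => (u + v : Input τ) σ i) =ᵐ[volume.restrict (Set.Icc 0 τ)]
      fun σ => u σ i + v σ i := by
    intro i
    filter_upwards [Lp.coeFn_add u v] with σ hσ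
    rw [hσ]
    rfl
  rw [inputFun, heatInt_congr (h 0), heatInt_congr (h 1),
    heatInt_add (integrableOn_input u 0) (integrableOn_input v 0) hs,
    heatInt_add (integrableOn_input u 1) (integrableOn_input v 1) (sub_mem_square hs),
    inputFun, inputFun]
  ring

theorem inputFun_smul (c : ℂ) (u : Input τ) (s : ℂ) :
    inputFun τ (c • u) s = c * inputFun τ u s := by
  have h : ∀ i : Fin 2, (fun σ => (c • u : Input τ) σ i) =ᵐ[volume.restrict (Set.Icc 0 τ)]
      fun σ => c * u σ i := by
    intro i
    filter_upwards [Lp.coeFn_smul c u] with σ hσ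
    rw [hσ]
    rfl
  rw [inputFun, heatInt_congr (h 0), heatInt_congr (h 1), heatInt_const_mul, heatInt_const_mul,
    inputFun]
  ring

theorem lintegral_square_sub (f : ℂ → ENNReal) :
    ∫⁻ s in square, f (π - s) = ∫⁻ s in square, f s := by
  have hpre : (fun s : ℂ => (π : ℂ) - s) ⁻¹' square = square := by
    ext s
    refine ⟨fun h => ?_, fun h => sub_mem_square h⟩
    simpa using sub_mem_square h
  have := (Measure.measurePreserving_sub_left (volume : Measure ℂ) (π : ℂ)).setLIntegral_comp_preimage_emb
    (MeasurableEquiv.subLeft (π : ℂ)).measurableEmbedding f square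
  rw [hpre] at this
  exact this

theorem lintegral_inputFun_le (u : Input τ) :
    ∫⁻ s in square, ‖inputFun τ u s‖ₑ ^ 2 ≤ 4 * heatIntBound τ * ‖u‖ₑ ^ 2 := by
  have hm := isOpen_square.measurableSet
  calc ∫⁻ s in square, ‖inputFun τ u s‖ₑ ^ 2
      ≤ ∫⁻ s in square, (2 * ‖heatInt τ (fun σ => u σ 0) s‖ₑ ^ 2 +
          2 * ‖heatInt τ (fun σ => u σ 1) (π - s)‖ₑ ^ 2) :=
        lintegral_mono fun s => enorm_sq_add_le _ _
    _ = 2 * (∫⁻ s in square, ‖heatInt τ (fun σ => u σ 0) s‖ₑ ^ 2) +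
          2 * ∫⁻ s in square, ‖heatInt τ (fun σ => u σ 1) s‖ₑ ^ 2 := by
        rw [lintegral_add_left', lintegral_const_mul' _ _ (by finiteness),
          lintegral_const_mul' _ _ (by finiteness),
          lintegral_square_sub fun s => ‖heatInt τ (fun σ => u σ 1) s‖ₑ ^ 2]
        exact ((((differentiableOn_heatInt
          (integrableOn_input u 0)).continuousOn.aemeasurable hm).enorm).pow_const 2).const_mul 2
    _ ≤ 2 * (heatIntBound τ * ‖u‖ₑ ^ 2) + 2 * (heatIntBound τ * ‖u‖ₑ ^ 2) := by
        gcongr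
        · exact (lintegral_heatInt_le (memLp_input u 0)).trans
            (by gcongr; exact lintegral_input_le u 0)
        · exact (lintegral_heatInt_le (memLp_input u 1)).trans
            (by gcongr; exact lintegral_input_le u 1)
    _ = _ := by ring

theorem isOpen_rhombus : IsOpen (rhombus Θ) := by
  have h : Continuous fun s : ℂ => |s.im| := continuous_abs.comp Complex.continuous_im
  exact (isOpen_lt h (continuous_const.mul Complex.continuous_re)).inter
    (isOpen_lt h (continuous_const.mul (continuous_const.sub Complex.continuous_re)))

theorem measurableSet_rhombus : MeasurableSet (rhombus Θ) := isOpen_rhombus.measurableSet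

theorem weight_le (hδ : 0 ≤ δ) {s : ℂ} (hs : s ∈ square) :
    weight δ s ≤ (2 * π) ^ δ * (2 * π) ^ δ := by
  unfold weight
  have h1 := norm_lt_of_mem_square hs
  have h2 := norm_lt_of_mem_square (sub_mem_square hs)
  gcongr

theorem bergmanMeasure_le (hδ : 0 ≤ δ) (hΘ : rhombus Θ ⊆ square) : bergmanMeasure δ Θ ≤
    ENNReal.ofReal ((2 * π) ^ δ * (2 * π) ^ δ) • volume.restrict (rhombus Θ) := by
  rw [bergmanMeasure, ← withDensity_const]
  refine withDensity_mono ?_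
  filter_upwards [ae_restrict_mem measurableSet_rhombus] with s hs
  exact ENNReal.ofReal_le_ofReal (weight_le hδ (hΘ hs))

/-- A bound for the square of the norm of the input map. -/
def inputBound (τ δ : ℝ) : ENNReal :=
  ENNReal.ofReal ((2 * π) ^ δ * (2 * π) ^ δ) * (4 * heatIntBound τ)

theorem inputBound_ne_top (τ δ : ℝ) : inputBound τ δ ≠ ⊤ := by
  have := heatIntBound_ne_top τ
  unfold inputBound
  finiteness

theorem lintegral_bergman_inputFun_le (hδ : 0 ≤ δ) (hΘ : rhombus Θ ⊆ square) (u : Input τ) :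
    ∫⁻ s, ‖inputFun τ u s‖ₑ ^ 2 ∂(bergmanMeasure δ Θ) ≤ inputBound τ δ * ‖u‖ₑ ^ 2 := by
  refine (lintegral_mono' (bergmanMeasure_le hδ hΘ) le_rfl).trans ?_
  rw [lintegral_smul_measure, inputBound, smul_eq_mul, mul_assoc]
  gcongr
  exact (lintegral_mono_set hΘ).trans (lintegral_inputFun_le u)

theorem bergmanMeasure_ac : bergmanMeasure δ Θ ≪ volume.restrict (rhombus Θ) :=
  withDensity_absolutelyContinuous _ _

theorem memLp_inputFun (hδ : 0 ≤ δ) (hΘ : rhombus Θ ⊆ square) (u : Input τ) :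
    MemLp (inputFun τ u) 2 (bergmanMeasure δ Θ) := by
  refine ⟨?_, ?_⟩
  · exact (((differentiableOn_inputFun u).mono hΘ).continuousOn.aestronglyMeasurable
      measurableSet_rhombus).mono_ac bergmanMeasure_ac
  · rw [eLpNorm_lt_top_iff_lintegral_rpow_enorm_lt_top (by norm_num) (by norm_num)]
    simp only [ENNReal.toReal_ofNat, ENNReal.rpow_ofNat]
    refine (lintegral_bergman_inputFun_le hδ hΘ u).trans_lt ?_
    exact ENNReal.mul_lt_top (inputBound_ne_top τ δ).lt_top (by finiteness)

theorem ae_bergmanMeasure_mem_square (hΘ : rhombus Θ ⊆ square) :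
    ∀ᵐ s ∂(bergmanMeasure δ Θ), s ∈ square :=
  bergmanMeasure_ac ((ae_restrict_mem measurableSet_rhombus).mono fun _ hs => hΘ hs)

/-- The Dirichlet input map, for a rhombus contained in the square. -/
def inputMap (τ : ℝ) {δ Θ : ℝ} (hδ : 0 ≤ δ) (hΘ : rhombus Θ ⊆ square) :
    Input τ →L[ℂ] bergman δ Θ :=
  LinearMap.mkContinuous
    { toFun := fun u => ⟨(memLp_inputFun hδ hΘ u).toLp _, inputFun τ u,
        (differentiableOn_inputFun u).mono hΘ, MemLp.coeFn_toLp _⟩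
      map_add' := fun u v => Subtype.ext <| by
        refine (MemLp.toLp_congr (memLp_inputFun hδ hΘ (u + v))
          ((memLp_inputFun hδ hΘ u).add (memLp_inputFun hδ hΘ v)) ?_).trans
          (MemLp.toLp_add (memLp_inputFun hδ hΘ u) (memLp_inputFun hδ hΘ v))
        filter_upwards [ae_bergmanMeasure_mem_square hΘ] with s hs using inputFun_add u v hs
      map_smul' := fun c u => Subtype.ext <| by
        exact (MemLp.toLp_congr (memLp_inputFun hδ hΘ (c • u))
          ((memLp_inputFun hδ hΘ u).const_smul c)
          (Filter.Eventually.of_forall fun s => inputFun_smul c u s)).trans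
          (MemLp.toLp_const_smul c (memLp_inputFun hδ hΘ u)) }
    (√(inputBound τ δ).toReal) fun u => by
      change ‖(memLp_inputFun hδ hΘ u).toLp _‖ ≤ _
      refine le_of_sq_le_sq ?_ (by positivity)
      rw [mul_pow, Real.sq_sqrt ENNReal.toReal_nonneg, ← toReal_enorm, ← toReal_enorm,
        ← ENNReal.toReal_pow, ← ENNReal.toReal_pow, ← ENNReal.toReal_mul, Lp.enorm_toLp,
        eLpNorm_two_sq]
      refine ENNReal.toReal_mono ?_ (lintegral_bergman_inputFun_le hδ hΘ u)
      exact ENNReal.mul_ne_top (inputBound_ne_top τ δ) (by finiteness)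

theorem isHolomorphicRep_inputMap (hδ : 0 ≤ δ) (hΘ : rhombus Θ ⊆ square) (u : Input τ) :
    IsHolomorphicRep (inputMap τ hδ hΘ u : Lp ℂ 2 (bergmanMeasure δ Θ)) (inputFun τ u) :=
  ⟨(differentiableOn_inputFun u).mono hΘ, MemLp.coeFn_toLp (memLp_inputFun hδ hΘ u)⟩

end

/-! ### The Hilbert–Schmidt norm and the kernel -/

section

variable {τ δ Θ : ℝ}

theorem Orthonormal.countable_index {ι H : Type*} [NormedAddCommGroup H] [InnerProductSpace ℂ H]
    [TopologicalSpace.SeparableSpace H] {v : ι → H} (hv : Orthonormal ℂ v) : Countable ι := by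
  have hd : ∀ i j, i ≠ j → 1 ≤ ‖v i - v j‖ := by
    intro i j hij
    have h := norm_sub_sq (𝕜 := ℂ) (v i) (v j)
    rw [hv.1 i, hv.1 j, hv.2 hij] at h
    simp only [map_zero, mul_zero, sub_zero, one_pow] at h
    nlinarith [norm_nonneg (v i - v j)]
  rw [← Set.countable_univ_iff]
  refine Set.PairwiseDisjoint.countable_of_isOpen (s := fun i => Metric.ball (v i) (1 / 2)) ?_
    (fun i _ => Metric.isOpen_ball) (fun i _ => ⟨v i, Metric.mem_ball_self (by norm_num)⟩)
  intro i _ j _ hij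
  refine Metric.ball_disjoint_ball ?_
  rw [dist_eq_norm]
  linarith [hd i j hij]

/-- Parseval's identity in `ℝ≥0∞`. -/
theorem HilbertBasis.tsum_enorm_inner_sq {ι H : Type*} [NormedAddCommGroup H]
    [InnerProductSpace ℂ H] (b : HilbertBasis ι ℂ H) (x : H) :
    ∑' i, ‖inner ℂ x (b i)‖ₑ ^ 2 = ‖x‖ₑ ^ 2 := by
  have h := Complex.hasSum_re (b.hasSum_inner_mul_inner x x)
  have e : ∀ i, (inner ℂ x (b i) * inner ℂ (b i) x).re = ‖inner ℂ x (b i)‖ ^ 2 := by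
    intro i
    rw [← inner_conj_symm (b i) x, Complex.mul_conj, Complex.ofReal_re, Complex.normSq_eq_norm_sq]
  simp_rw [e] at h
  have e2 : (inner ℂ x x).re = ‖x‖ ^ 2 := (norm_sq_eq_re_inner (𝕜 := ℂ) x).symm
  rw [e2] at h
  simp_rw [← ofReal_norm, ← ENNReal.ofReal_pow (norm_nonneg _)]
  rw [← ENNReal.ofReal_tsum_of_nonneg (fun i => by positivity) h.summable, h.tsum_eq]

/-- The conjugate of the kernel of `u ↦ inputFun τ u s`. -/
def kernelVec (τ : ℝ) (s : ℂ) (σ : ℝ) : EuclideanSpace ℂ (Fin 2) :=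
  !₂[starRingEnd ℂ (dirichletKernel (τ - σ) s), starRingEnd ℂ (dirichletKernel (τ - σ) (π - s))]

theorem measurable_kernelVec (τ : ℝ) (s : ℂ) : Measurable (kernelVec τ s) := by
  refine (PiLp.continuous_toLp 2 _).measurable.comp (measurable_pi_lambda _ fun i => ?_)
  fin_cases i
  · exact Complex.continuous_conj.measurable.comp (measurable_dirichletKernel_left τ s)
  · exact Complex.continuous_conj.measurable.comp (measurable_dirichletKernel_left τ (π - s))

theorem memLp_kernelVec {s : ℂ} (hs : s ∈ square) :
    MemLp (kernelVec τ s) 2 (volume.restrict (Set.Icc 0 τ)) := by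
  obtain ⟨r, hr, M, hM⟩ := exists_bound_dirichletKernel hs
  obtain ⟨r', hr', M', hM'⟩ := exists_bound_dirichletKernel (sub_mem_square hs)
  refine MemLp.of_bound (measurable_kernelVec τ s).aestronglyMeasurable (√(M ^ 2 + M' ^ 2))
    (Filter.Eventually.of_forall fun σ => ?_)
  rw [EuclideanSpace.norm_eq, Fin.sum_univ_two]
  have h1 := hM s (Metric.mem_ball_self hr) (τ - σ)
  have h2 := hM' _ (Metric.mem_ball_self hr') (τ - σ)
  refine Real.sqrt_le_sqrt ?_
  simp only [kernelVec, PiLp.toLp_apply, Matrix.cons_val_zero, Matrix.cons_val_one,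
    RCLike.norm_conj]
  gcongr

theorem inner_kernelVec {s : ℂ} (hs : s ∈ square) (u : Input τ) :
    inner ℂ ((memLp_kernelVec (τ := τ) hs).toLp _) u = inputFun τ u s := by
  rw [L2.inner_def, inputFun, heatInt, heatInt,
    ← integral_add (integrableOn_heatInt (integrableOn_input u 0) hs)
      (integrableOn_heatInt (integrableOn_input u 1) (sub_mem_square hs))]
  refine integral_congr_ae ?_
  filter_upwards [(memLp_kernelVec (τ := τ) hs).coeFn_toLp] with σ hσ
  rw [hσ, PiLp.inner_apply, Fin.sum_univ_two]
  simp only [RCLike.inner_apply, kernelVec, PiLp.toLp_apply, Matrix.cons_val_zero,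
    Matrix.cons_val_one, Complex.conj_conj]
  ring

theorem lintegral_dirichletKernel_le {s : ℂ} (hs : s ∈ square) :
    ∫⁻ σ in Set.Icc 0 τ, ‖dirichletKernel (τ - σ) s‖ₑ ^ 2 ≤
      ‖(memLp_kernelVec (τ := τ) hs).toLp _‖ₑ ^ 2 := by
  rw [Lp.enorm_toLp, eLpNorm_two_sq]
  refine lintegral_mono fun σ => ?_
  gcongr
  refine enorm_le_iff_norm_le.2 ?_
  have := PiLp.norm_apply_le (kernelVec τ s σ) 0
  simpa [kernelVec, PiLp.toLp_apply, Matrix.cons_val_zero, RCLike.norm_conj] using this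

/-- The Hilbert–Schmidt norm is the `L²` norm of the kernel. -/
theorem lintegral_kernel_lt_top_of_isHilbertSchmidt (hΘ : rhombus Θ ⊆ square)
    {Φ : Input τ →L[ℂ] bergman δ Θ}
    (hΦ : ∀ u, IsHolomorphicRep (Φ u : Lp ℂ 2 (bergmanMeasure δ Θ)) (inputFun τ u))
    (hHS : IsHilbertSchmidt Φ) :
    ∫⁻ s, (∫⁻ σ in Set.Icc 0 τ, ‖dirichletKernel (τ - σ) s‖ₑ ^ 2) ∂(bergmanMeasure δ Θ) < ⊤ := by
  obtain ⟨ι, b, hb⟩ := hHS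
  have : Fact ((2 : ENNReal) ≠ ⊤) := ⟨by norm_num⟩
  have : SecondCountableTopology (Input τ) := Lp.SecondCountableTopology
  have : Countable ι := Orthonormal.countable_index b.orthonormal
  have hn : ∀ i, ‖Φ (b i)‖ₑ ^ 2 = ∫⁻ s, ‖inputFun τ (b i) s‖ₑ ^ 2 ∂(bergmanMeasure δ Θ) := by
    intro i
    have h1 : ‖Φ (b i)‖ₑ = ‖(Φ (b i) : Lp ℂ 2 (bergmanMeasure δ Θ))‖ₑ := rfl
    rw [h1, Lp.enorm_sq_eq_lintegral]
    refine lintegral_congr_ae ?_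
    filter_upwards [(hΦ (b i)).2] with s hs
    rw [hs]
  calc ∫⁻ s, (∫⁻ σ in Set.Icc 0 τ, ‖dirichletKernel (τ - σ) s‖ₑ ^ 2) ∂(bergmanMeasure δ Θ)
      ≤ ∫⁻ s, ∑' i, ‖inputFun τ (b i) s‖ₑ ^ 2 ∂(bergmanMeasure δ Θ) := by
        refine lintegral_mono_ae ?_
        filter_upwards [ae_bergmanMeasure_mem_square hΘ] with s hs
        refine (lintegral_dirichletKernel_le hs).trans ?_
        rw [← HilbertBasis.tsum_enorm_inner_sq b]
        simp_rw [inner_kernelVec hs]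
        exact le_rfl
    _ = ∑' i, ‖Φ (b i)‖ₑ ^ 2 := by
        rw [lintegral_tsum]
        · simp_rw [hn]
        · intro i
          exact (((((differentiableOn_inputFun (b i)).mono hΘ).continuousOn.aestronglyMeasurable
            measurableSet_rhombus).mono_ac bergmanMeasure_ac).aemeasurable.enorm).pow_const 2
    _ = ENNReal.ofReal (∑' i, ‖Φ (b i)‖ ^ 2) := by
        rw [ENNReal.ofReal_tsum_of_nonneg (fun i => by positivity) hb]
        simp_rw [← ofReal_norm, ← ENNReal.ofReal_pow (norm_nonneg _)]
    _ < ⊤ := ENNReal.ofReal_lt_top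

theorem re_sq_div_four_le {s : ℂ} (hs : s ∈ square) : (s ^ 2 / 4).re < π ^ 2 := by
  have h1 := Complex.re_le_norm (s ^ 2 / 4)
  rw [norm_div, norm_pow, Complex.norm_ofNat] at h1
  have h2 := norm_lt_of_mem_square hs
  nlinarith [norm_nonneg s]

/-- A lower bound for the `L²` norm in time of the kernel on the half-line, from times comparable
with `Re s²`. -/
theorem exists_le_lintegral_gaussTerm (hτ : 0 < τ) : ∃ c > 0, ∀ s ∈ square,
    ENNReal.ofReal (c * (‖s‖ ^ 2 / (s ^ 2 / 4).re ^ 2)) ≤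
      ∫⁻ σ in Set.Icc 0 τ, ‖gaussTerm (τ - σ) s‖ₑ ^ 2 := by
  have hπ := Real.pi_pos
  -- the times `τ - σ` between `κ q / 2` and `κ q`, where `q = Re s² / 4 < π²`; then `κ q ≤ τ`
  set κ := τ / π ^ 2 with hκ
  have hκ0 : 0 < κ := by positivity
  refine ⟨((2 * √π)⁻¹) ^ 2 * (κ ^ 3)⁻¹ * Real.exp (-(4 / κ)) * (κ / 2), by positivity,
    fun s hs => ?_⟩
  set q := (s ^ 2 / 4).re with hq
  have hq0 : 0 < q := re_sq_pos_of_mem_square hs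
  have hqτ : κ * q ≤ τ := by
    rw [hκ, div_mul_eq_mul_div, div_le_iff₀ (by positivity)]
    exact mul_le_mul_of_nonneg_left (re_sq_div_four_le hs).le hτ.le
  set A := (‖s‖ * (2 * √π)⁻¹) ^ 2 * (((κ * q) ^ 3)⁻¹ * Real.exp (-(4 / κ))) with hA
  have hsub : Set.Icc (τ - κ * q) (τ - κ * q / 2) ⊆ Set.Icc 0 τ := by
    refine Set.Icc_subset_Icc (by linarith) ?_
    have : 0 < κ * q := by positivity
    linarith
  calc ENNReal.ofReal (((2 * √π)⁻¹) ^ 2 * (κ ^ 3)⁻¹ * Real.exp (-(4 / κ)) * (κ / 2) *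
        (‖s‖ ^ 2 / q ^ 2))
      = ∫⁻ σ in Set.Icc (τ - κ * q) (τ - κ * q / 2), ENNReal.ofReal A := by
        rw [setLIntegral_const, Real.volume_Icc, ← ENNReal.ofReal_mul (by positivity)]
        congr 1
        rw [hA]
        field_simp
        ring
    _ ≤ ∫⁻ σ in Set.Icc (τ - κ * q) (τ - κ * q / 2), ‖gaussTerm (τ - σ) s‖ₑ ^ 2 := by
        refine setLIntegral_mono' measurableSet_Icc fun σ hσ => ?_
        have hκq : 0 < κ * q := by positivity
        have ht1 : κ * q / 2 ≤ τ - σ := by linarith [hσ.2]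
        have ht2 : τ - σ ≤ κ * q := by linarith [hσ.1]
        have ht0 : 0 < τ - σ := by linarith
        rw [← ofReal_norm, ← ENNReal.ofReal_pow (norm_nonneg _), norm_gaussTerm ht0]
        refine ENNReal.ofReal_le_ofReal ?_
        rw [hA, mul_pow _ (((τ - σ) * √(τ - σ))⁻¹ * _)]
        refine mul_le_mul_of_nonneg_left ?_ (by positivity)
        have e : (((τ - σ) * √(τ - σ))⁻¹ * Real.exp (-(q / (τ - σ)))) ^ 2 =
            ((τ - σ) ^ 3)⁻¹ * Real.exp (-(2 * (q / (τ - σ)))) := by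
          rw [mul_pow _ (Real.exp _), ← Real.exp_nat_mul, inv_pow, mul_pow _ (√_),
            Real.sq_sqrt ht0.le, ← pow_succ]
          congr 2
          push_cast
          ring
        rw [e]
        gcongr
        rw [mul_div_assoc', div_le_div_iff₀ ht0 hκ0]
        nlinarith
    _ ≤ _ := lintegral_mono_set hsub

theorem lintegral_bergmanMeasure {f : ℂ → ENNReal} (hf : Measurable f) :
    ∫⁻ s, f s ∂(bergmanMeasure δ Θ) =
      ∫⁻ s in rhombus Θ, ENNReal.ofReal (weight δ s) * f s := by
  have hw : Measurable fun s => ENNReal.ofReal (weight δ s) := by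
    unfold weight
    fun_prop
  rw [bergmanMeasure, lintegral_withDensity_eq_lintegral_mul _ hw hf]
  rfl

theorem lintegral_gaussTerm_le {s : ℂ} (hs : s ∈ square) :
    ∫⁻ σ in Set.Icc 0 τ, ‖gaussTerm (τ - σ) s‖ₑ ^ 2 ≤
      2 * (∫⁻ σ in Set.Icc 0 τ, ‖dirichletKernel (τ - σ) s‖ₑ ^ 2) +
        2 * (ENNReal.ofReal remainderBound ^ 2 * ENNReal.ofReal τ) := by
  have h : ∀ σ, ‖gaussTerm (τ - σ) s‖ₑ ^ 2 ≤
      2 * ‖dirichletKernel (τ - σ) s‖ₑ ^ 2 + 2 * ENNReal.ofReal remainderBound ^ 2 := by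
    intro σ
    have := enorm_sq_add_le (dirichletKernel (τ - σ) s)
      (gaussTerm (τ - σ) s - dirichletKernel (τ - σ) s)
    rw [add_sub_cancel] at this
    refine this.trans ?_
    gcongr
    rw [← ofReal_norm, norm_sub_rev]
    exact ENNReal.ofReal_le_ofReal (norm_dirichletKernel_sub_gaussTerm_le _ hs)
  refine (lintegral_mono h).trans (le_of_eq ?_)
  rw [lintegral_add_right _ measurable_const, lintegral_const_mul' _ _ ENNReal.ofNat_ne_top,
    setLIntegral_const, Real.volume_Icc, sub_zero, mul_assoc]

/-- If the input map is Hilbert–Schmidt, then `|s|² / (Re s²)²` is integrable. -/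
theorem lintegral_lt_top_of_isHilbertSchmidt (hτ : 0 < τ) (hδ : 0 ≤ δ) (hΘ : rhombus Θ ⊆ square)
    {Φ : Input τ →L[ℂ] bergman δ Θ}
    (hΦ : ∀ u, IsHolomorphicRep (Φ u : Lp ℂ 2 (bergmanMeasure δ Θ)) (inputFun τ u))
    (hHS : IsHilbertSchmidt Φ) :
    ∫⁻ s in rhombus Θ, ENNReal.ofReal (weight δ s) *
      ENNReal.ofReal (‖s‖ ^ 2 / (s ^ 2 / 4).re ^ 2) < ⊤ := by
  obtain ⟨c, hc, hcs⟩ := exists_le_lintegral_gaussTerm hτ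
  have hm : Measurable fun s : ℂ => ENNReal.ofReal (‖s‖ ^ 2 / (s ^ 2 / 4).re ^ 2) :=
    ENNReal.measurable_ofReal.comp ((measurable_norm.pow_const 2).div
      ((Complex.measurable_re.comp ((measurable_id.pow_const 2).div_const 4)).pow_const 2))
  rw [← lintegral_bergmanMeasure hm]
  have hfin : bergmanMeasure δ Θ Set.univ < ⊤ := by
    refine (bergmanMeasure_le hδ hΘ Set.univ).trans_lt ?_
    rw [Measure.smul_apply, Measure.restrict_apply_univ, smul_eq_mul]
    exact ENNReal.mul_lt_top ENNReal.ofReal_lt_top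
      ((measure_mono hΘ).trans_lt volume_square_ne_top.lt_top)
  have hc' : ENNReal.ofReal c ≠ 0 := by simpa using hc
  have key : ENNReal.ofReal c * ∫⁻ s, ENNReal.ofReal (‖s‖ ^ 2 / (s ^ 2 / 4).re ^ 2)
      ∂(bergmanMeasure δ Θ) < ⊤ := by
    have hHS' := lintegral_kernel_lt_top_of_isHilbertSchmidt hΘ hΦ hHS
    have hle : ∀ᵐ s ∂(bergmanMeasure δ Θ),
        ENNReal.ofReal c * ENNReal.ofReal (‖s‖ ^ 2 / (s ^ 2 / 4).re ^ 2) ≤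
          2 * (∫⁻ σ in Set.Icc 0 τ, ‖dirichletKernel (τ - σ) s‖ₑ ^ 2) +
            2 * (ENNReal.ofReal remainderBound ^ 2 * ENNReal.ofReal τ) := by
      filter_upwards [ae_bergmanMeasure_mem_square hΘ] with s hs
      rw [← ENNReal.ofReal_mul hc.le]
      exact (hcs s hs).trans (lintegral_gaussTerm_le hs)
    rw [← lintegral_const_mul' _ _ ENNReal.ofReal_ne_top]
    refine (lintegral_mono_ae hle).trans_lt ?_
    rw [lintegral_add_right _ measurable_const, lintegral_const_mul' _ _ ENNReal.ofNat_ne_top,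
      lintegral_const]
    refine ENNReal.add_lt_top.2 ⟨ENNReal.mul_lt_top ENNReal.ofNat_lt_top hHS',
      ENNReal.mul_lt_top ?_ hfin⟩
    finiteness
  by_contra h
  rw [not_lt_top_iff.1 h, ENNReal.mul_top hc'] at key
  exact lt_irrefl _ key

end

/-! ### Divergence at the vertex and at the sides -/

section

variable {τ δ Θ : ℝ}

theorem lintegral_Ioo_inv_eq_top {a : ℝ} (ha : 0 < a) :
    ∫⁻ x in Set.Ioo 0 a, ENNReal.ofReal x⁻¹ = ⊤ := by
  by_contra h
  have h1 : IntegrableOn (fun x : ℝ => x ^ (-1 : ℝ)) (Set.Ioo 0 a) := by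
    refine ⟨(by fun_prop : Measurable fun x : ℝ => x ^ (-1 : ℝ)).aestronglyMeasurable, ?_⟩
    rw [hasFiniteIntegral_iff_ofReal]
    · refine lt_of_eq_of_lt (lintegral_congr fun x => ?_) (lt_top_iff_ne_top.2 h)
      rw [Real.rpow_neg_one]
    · filter_upwards [ae_restrict_mem measurableSet_Ioo] with x hx
      exact Real.rpow_nonneg hx.1.le _
  rw [intervalIntegral.integrableOn_Ioo_rpow_iff ha] at h1
  norm_num at h1

theorem lintegral_Ioo_inv_sq_eq_top {a : ℝ} (ha : 0 < a) :
    ∫⁻ x in Set.Ioo 0 a, ENNReal.ofReal (x ^ 2)⁻¹ = ⊤ := by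
  by_contra h
  have h1 : IntegrableOn (fun x : ℝ => x ^ (-2 : ℝ)) (Set.Ioo 0 a) := by
    refine ⟨(by fun_prop : Measurable fun x : ℝ => x ^ (-2 : ℝ)).aestronglyMeasurable, ?_⟩
    rw [hasFiniteIntegral_iff_ofReal]
    · refine lt_of_eq_of_lt (setLIntegral_congr_fun measurableSet_Ioo fun x hx => ?_)
        (lt_top_iff_ne_top.2 h)
      rw [Real.rpow_neg hx.1.le]
      norm_num
    · filter_upwards [ae_restrict_mem measurableSet_Ioo] with x hx
      exact Real.rpow_nonneg hx.1.le _
  rw [intervalIntegral.integrableOn_Ioo_rpow_iff ha] at h1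
  norm_num at h1

/-- A lower bound by an iterated integral for the integral over a rhombus. -/
theorem lintegral_rhombus_ge {f : ℂ → ENNReal} (hf : Measurable f) {I : Set ℝ}
    (hI : MeasurableSet I) {J : ℝ → Set ℝ} (hJ : ∀ x, MeasurableSet (J x))
    (hsub : ∀ x ∈ I, ∀ y ∈ J x, (x + y * Complex.I : ℂ) ∈ rhombus Θ) :
    ∫⁻ x in I, ∫⁻ y in J x, f (x + y * Complex.I) ≤ ∫⁻ s in rhombus Θ, f s := by
  rw [← lintegral_indicator measurableSet_rhombus,
    lintegral_complex_eq (hf.indicator measurableSet_rhombus).aemeasurable,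
    ← lintegral_indicator hI]
  refine lintegral_mono fun x => ?_
  by_cases hx : x ∈ I
  · rw [Set.indicator_of_mem hx, ← lintegral_indicator (hJ x)]
    refine lintegral_mono fun y => ?_
    by_cases hy : y ∈ J x
    · rw [Set.indicator_of_mem hy, Set.indicator_of_mem (hsub x hx y hy)]
    · rw [Set.indicator_of_notMem hy]
      exact zero_le
  · rw [Set.indicator_of_notMem hx]
    exact zero_le

theorem measurable_kernel_density : Measurable fun s : ℂ => ENNReal.ofReal (weight δ s) *
    ENNReal.ofReal (‖s‖ ^ 2 / (s ^ 2 / 4).re ^ 2) := by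
  have hw : Measurable fun s => ENNReal.ofReal (weight δ s) := by
    unfold weight
    fun_prop
  exact hw.mul (ENNReal.measurable_ofReal.comp ((measurable_norm.pow_const 2).div
    ((Complex.measurable_re.comp ((measurable_id.pow_const 2).div_const 4)).pow_const 2)))

theorem norm_sq_add_mul_I (x y : ℝ) : ‖(x + y * Complex.I : ℂ)‖ ^ 2 = x ^ 2 + y ^ 2 := by
  rw [← Complex.normSq_eq_norm_sq, Complex.normSq_add_mul_I]

theorem re_sq_add_mul_I (x y : ℝ) : ((x + y * Complex.I : ℂ) ^ 2 / 4).re = (x ^ 2 - y ^ 2) / 4 := by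
  rw [re_sq_div_four]; simp

/-- Without a weight, `|s|² / (Re s²)² ≥ |s|⁻²` is not integrable at the vertex `0`. -/
theorem lintegral_vertex_eq_top (h0 : 0 < Real.tan Θ) (h1 : Real.tan Θ ≤ 1) :
    ∫⁻ s in rhombus Θ, ENNReal.ofReal (weight 0 s) *
      ENNReal.ofReal (‖s‖ ^ 2 / (s ^ 2 / 4).re ^ 2) = ⊤ := by
  set m := Real.tan Θ with hm
  have hπ := Real.pi_gt_three
  refine top_unique ?_
  refine le_trans ?_ (lintegral_rhombus_ge measurable_kernel_density
    (measurableSet_Ioo (a := (0 : ℝ)) (b := 1))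
    (fun x => measurableSet_Ioo (a := 0) (b := m * x)) ?_)
  · have hle : ∀ x ∈ Set.Ioo (0 : ℝ) 1, ENNReal.ofReal (8 * m) * ENNReal.ofReal x⁻¹ ≤
        ∫⁻ y in Set.Ioo 0 (m * x), ENNReal.ofReal (weight 0 (x + y * Complex.I)) *
          ENNReal.ofReal (‖(x + y * Complex.I : ℂ)‖ ^ 2 /
            ((x + y * Complex.I : ℂ) ^ 2 / 4).re ^ 2) := by
      intro x hx
      have hx0 := hx.1
      have hconst : ENNReal.ofReal (8 * m) * ENNReal.ofReal x⁻¹ =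
          ∫⁻ _ in Set.Ioo 0 (m * x), ENNReal.ofReal (8 / x ^ 2) := by
        rw [setLIntegral_const, Real.volume_Ioo, ← ENNReal.ofReal_mul (by positivity),
          ← ENNReal.ofReal_mul (by positivity)]
        congr 1
        field_simp
        ring
      rw [hconst]
      refine setLIntegral_mono' measurableSet_Ioo fun y hy => ?_
      have hyx : y < x := hy.2.trans_le (by nlinarith)
      have hy2 : y ^ 2 < x ^ 2 := by nlinarith [hy.1]
      have hw : weight 0 (x + y * Complex.I) = 1 := by simp [weight]
      rw [hw, ENNReal.ofReal_one, one_mul, norm_sq_add_mul_I, re_sq_add_mul_I]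
      refine ENNReal.ofReal_le_ofReal ?_
      have hpos : 0 < x ^ 2 - y ^ 2 := by linarith
      rw [div_le_div_iff₀ (by positivity) (by positivity)]
      nlinarith [sq_nonneg y, mul_nonneg (sq_nonneg y) (sq_nonneg x), sq_nonneg (y ^ 2), hpos,
        mul_nonneg (sq_nonneg y) hpos.le]
    calc (⊤ : ENNReal) = ENNReal.ofReal (8 * m) * ∫⁻ x in Set.Ioo (0 : ℝ) 1, ENNReal.ofReal x⁻¹ := by
          rw [lintegral_Ioo_inv_eq_top one_pos, ENNReal.mul_top]
          simpa using h0
      _ = ∫⁻ x in Set.Ioo (0 : ℝ) 1, ENNReal.ofReal (8 * m) * ENNReal.ofReal x⁻¹ :=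
          (lintegral_const_mul' _ _ ENNReal.ofReal_ne_top).symm
      _ ≤ _ := setLIntegral_mono' measurableSet_Ioo hle
  · rintro x ⟨hx0, hx1⟩ y ⟨hy0, hy1⟩
    constructor
    · simpa [abs_of_pos hy0] using hy1
    · simp only [Complex.add_im, Complex.ofReal_im, Complex.mul_im, Complex.ofReal_re,
        Complex.I_im, mul_one, Complex.I_re, mul_zero, add_zero, zero_add, Complex.add_re,
        Complex.mul_re, sub_self, abs_of_pos hy0]
      nlinarith

/-- On the square, `|s|² / (Re s²)²` is not integrable at the sides that meet at `0`. -/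
theorem lintegral_side_eq_top (hδ : 0 ≤ δ) :
    ∫⁻ s in rhombus (π / 4), ENNReal.ofReal (weight δ s) *
      ENNReal.ofReal (‖s‖ ^ 2 / (s ^ 2 / 4).re ^ 2) = ⊤ := by
  have hπ := Real.pi_gt_three
  refine top_unique ?_
  refine le_trans ?_ (lintegral_rhombus_ge measurable_kernel_density
    (measurableSet_Ioo (a := (1 / 2 : ℝ)) (b := 1))
    (fun x => measurableSet_Ioo (a := 0) (b := x)) ?_)
  · have hle : ∀ x ∈ Set.Ioo (1 / 2 : ℝ) 1, (⊤ : ENNReal) ≤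
        ∫⁻ y in Set.Ioo 0 x, ENNReal.ofReal (weight δ (x + y * Complex.I)) *
          ENNReal.ofReal (‖(x + y * Complex.I : ℂ)‖ ^ 2 /
            ((x + y * Complex.I : ℂ) ^ 2 / 4).re ^ 2) := by
      intro x hx
      have hx0 : 0 < x := by linarith [hx.1]
      have hc : ENNReal.ofReal ((1 / 2) ^ δ) ≠ 0 := by
        have : (0 : ℝ) < (1 / 2) ^ δ := by positivity
        simpa using this
      calc (⊤ : ENNReal) = ENNReal.ofReal ((1 / 2) ^ δ) *
              ∫⁻ y in Set.Ioo 0 x, ENNReal.ofReal ((x - y) ^ 2)⁻¹ := by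
            have : ∫⁻ y in Set.Ioo 0 x, ENNReal.ofReal ((x - y) ^ 2)⁻¹ = ⊤ := by
              rw [← lintegral_Ioo_inv_sq_eq_top hx0, ← lintegral_indicator measurableSet_Ioo,
                ← lintegral_indicator measurableSet_Ioo, ← lintegral_sub_left_eq_self _ x]
              refine lintegral_congr fun y => ?_
              by_cases hy : y ∈ Set.Ioo 0 x
              · rw [Set.indicator_of_mem hy, Set.indicator_of_mem]
                · simp
                · exact ⟨by linarith [hy.2], by linarith [hy.1]⟩
              · rw [Set.indicator_of_notMem hy, Set.indicator_of_notMem]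
                rintro ⟨h1, h2⟩
                exact hy ⟨by linarith, by linarith⟩
            rw [this, ENNReal.mul_top hc]
        _ = ∫⁻ y in Set.Ioo 0 x, ENNReal.ofReal ((1 / 2) ^ δ) * ENNReal.ofReal ((x - y) ^ 2)⁻¹ :=
            (lintegral_const_mul' _ _ ENNReal.ofReal_ne_top).symm
        _ ≤ _ := by
            refine setLIntegral_mono' measurableSet_Ioo fun y hy => ?_
            have hxy : 0 < x - y := by linarith [hy.2]
            gcongr
            · unfold weight
              have e1 : (1 / 2 : ℝ) ≤ ‖(x + y * Complex.I : ℂ)‖ := by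
                have := Complex.re_le_norm (x + y * Complex.I : ℂ)
                simp at this
                linarith [hx.1]
              have e2 : (1 : ℝ) ≤ ‖(π : ℂ) - (x + y * Complex.I : ℂ)‖ := by
                have := Complex.re_le_norm ((π : ℂ) - (x + y * Complex.I : ℂ))
                simp at this
                linarith [hx.2]
              calc (1 / 2 : ℝ) ^ δ = (1 / 2 : ℝ) ^ δ * 1 := (mul_one _).symm
                _ ≤ _ := by
                  refine mul_le_mul (by gcongr) (Real.one_le_rpow e2 hδ) zero_le_one
                    (by positivity)
            · rw [norm_sq_add_mul_I, re_sq_add_mul_I, show x ^ 2 - y ^ 2 = (x - y) * (x + y) by ring,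
                div_pow, mul_pow, inv_eq_one_div, div_le_div_iff₀ (by positivity)
                  (by have := hy.1; positivity)]
              have e3 : (x + y) ^ 2 ≤ 16 * (x ^ 2 + y ^ 2) := by nlinarith [sq_nonneg (x - y)]
              nlinarith [sq_nonneg (x - y), mul_le_mul_of_nonneg_left e3 (sq_nonneg (x - y))]
    refine le_trans ?_ (setLIntegral_mono' measurableSet_Ioo hle)
    rw [setLIntegral_const, ENNReal.top_mul]
    rw [Real.volume_Ioo]
    norm_num
  · rintro x ⟨hx0, hx1⟩ y ⟨hy0, hy1⟩
    rw [rhombus, Real.tan_pi_div_four]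
    constructor
    · simpa [abs_of_pos hy0] using hy1
    · simp only [Complex.add_im, Complex.ofReal_im, Complex.mul_im, Complex.ofReal_re,
        Complex.I_im, mul_one, Complex.I_re, mul_zero, add_zero, zero_add, Complex.add_re,
        Complex.mul_re, sub_self, abs_of_pos hy0, one_mul]
      linarith

end

/-! ### Integration by parts against a primitive -/

/-- Integration by parts against the primitive of a merely integrable function. -/
theorem integral_mul_eq_sub_integral_primitive {a b : ℝ} (hab : a ≤ b) {g k k' : ℝ → ℂ}
    (hg : IntervalIntegrable g volume a b) (hk : ∀ x, HasDerivAt k (k' x) x)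
    (hk' : Continuous k') :
    ∫ x in a..b, k x * g x = k b * (∫ x in a..b, g x) - ∫ x in a..b, k' x * ∫ y in a..x, g y := by
  have hkc : Continuous k := continuous_iff_continuousAt.2 fun x => (hk x).continuousAt
  set μ := volume.restrict (Set.Ioc a b) with hμ
  have hgi : Integrable g μ := (intervalIntegrable_iff_integrableOn_Ioc_of_le hab).1 hg
  have hki : Integrable k' μ :=
    (intervalIntegrable_iff_integrableOn_Ioc_of_le hab).1 (hk'.intervalIntegrable a b)
  -- Fubini's theorem on the triangle `a < y ≤ x ≤ b`
  set S : Set (ℝ × ℝ) := {p | p.2 ≤ p.1} with hS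
  have hSm : MeasurableSet S := measurableSet_le measurable_snd measurable_fst
  have hint : Integrable (S.indicator fun p : ℝ × ℝ => k' p.1 * g p.2) (μ.prod μ) :=
    (hki.mul_prod hgi).indicator hSm
  have hswap := integral_integral_swap (f := fun x y => S.indicator
    (fun p : ℝ × ℝ => k' p.1 * g p.2) (x, y)) hint
  have h1 : ∫ x, ∫ y, S.indicator (fun p : ℝ × ℝ => k' p.1 * g p.2) (x, y) ∂μ ∂μ =
      ∫ x in a..b, k' x * ∫ y in a..x, g y := by
    rw [intervalIntegral.integral_of_le hab]
    refine setIntegral_congr_fun measurableSet_Ioc fun x hx => ?_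
    have : (fun y => S.indicator (fun p : ℝ × ℝ => k' p.1 * g p.2) (x, y)) =
        (Set.Iic x).indicator fun y => k' x * g y := by
      ext y
      by_cases hy : y ≤ x
      · rw [Set.indicator_of_mem (show (x, y) ∈ S from hy),
          Set.indicator_of_mem (show y ∈ Set.Iic x from hy)]
      · rw [Set.indicator_of_notMem (show (x, y) ∉ S from hy),
          Set.indicator_of_notMem (show y ∉ Set.Iic x from hy)]
    rw [this, integral_indicator measurableSet_Iic, hμ, Measure.restrict_restrict measurableSet_Iic,
      integral_const_mul, intervalIntegral.integral_of_le hx.1.le]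
    congr 3
    ext y
    simp only [Set.mem_inter_iff, Set.mem_Iic, Set.mem_Ioc]
    exact ⟨fun h => ⟨h.2.1, h.1⟩, fun h => ⟨h.2, h.1, h.2.trans hx.2⟩⟩
  have h2 : ∫ y, ∫ x, S.indicator (fun p : ℝ × ℝ => k' p.1 * g p.2) (x, y) ∂μ ∂μ =
      ∫ y in a..b, (k b - k y) * g y := by
    rw [intervalIntegral.integral_of_le hab]
    refine setIntegral_congr_fun measurableSet_Ioc fun y hy => ?_
    have : (fun x => S.indicator (fun p : ℝ × ℝ => k' p.1 * g p.2) (x, y)) =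
        (Set.Ici y).indicator fun x => k' x * g y := by
      ext x
      by_cases hx : y ≤ x
      · rw [Set.indicator_of_mem (show (x, y) ∈ S from hx),
          Set.indicator_of_mem (show x ∈ Set.Ici y from hx)]
      · rw [Set.indicator_of_notMem (show (x, y) ∉ S from hx),
          Set.indicator_of_notMem (show x ∉ Set.Ici y from hx)]
    rw [this, integral_indicator measurableSet_Ici, hμ, Measure.restrict_restrict measurableSet_Ici,
      integral_mul_const]
    congr 1
    have hset : Set.Ici y ∩ Set.Ioc a b = Set.Icc y b := by
      ext x
      simp only [Set.mem_inter_iff, Set.mem_Ici, Set.mem_Ioc, Set.mem_Icc]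
      exact ⟨fun h => ⟨h.1, h.2.2⟩, fun h => ⟨h.1, hy.1.trans_le h.1, h.2⟩⟩
    rw [hset, integral_Icc_eq_integral_Ioc, ← intervalIntegral.integral_of_le hy.2,
      intervalIntegral.integral_eq_sub_of_hasDerivAt (fun x _ => hk x)
        (hk'.intervalIntegrable _ _)]
  rw [h1, h2] at hswap
  have h3 : ∫ y in a..b, (k b - k y) * g y = k b * (∫ y in a..b, g y) - ∫ y in a..b, k y * g y := by
    simp_rw [sub_mul]
    rw [intervalIntegral.integral_sub (hg.const_mul _) (hg.continuousOn_mul hkc.continuousOn),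
      intervalIntegral.integral_const_mul]
  rw [hswap, h3]
  ring

/-! ### Sine coefficients -/

/-- The sine coefficients `(2/π) ∫₀^π f(x) sin(nx) dx`; they are indexed from `0`, where they
vanish. -/
def sineCoeff (f : ℝ → ℂ) (n : ℕ) : ℂ :=
  (2 / π : ℂ) * ∫ x in (0 : ℝ)..π, f x * (Real.sin (n * x) : ℝ)

theorem sineCoeff_zero (f : ℝ → ℂ) : sineCoeff f 0 = 0 := by
  simp [sineCoeff]

theorem hasDerivAt_sin_mul (n : ℕ) (x : ℝ) :
    HasDerivAt (fun x : ℝ => ((Real.sin (n * x) : ℝ) : ℂ)) ((n * Real.cos (n * x) : ℝ) : ℂ) x := by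
  have h := (Real.hasDerivAt_sin (n * x)).comp x ((hasDerivAt_id x).const_mul (n : ℝ))
  refine HasDerivAt.ofReal_comp ?_
  refine h.congr_deriv ?_
  simp only [mul_one]
  ring

theorem hasDerivAt_cos_mul (n : ℕ) (x : ℝ) :
    HasDerivAt (fun x : ℝ => ((Real.cos (n * x) : ℝ) : ℂ)) ((-(n * Real.sin (n * x)) : ℝ) : ℂ) x := by
  have h := (Real.hasDerivAt_cos (n * x)).comp x ((hasDerivAt_id x).const_mul (n : ℝ))
  refine HasDerivAt.ofReal_comp ?_
  refine h.congr_deriv ?_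
  simp only [mul_one]
  ring

theorem integral_deriv_mul_sin {f f' : ℝ → ℂ} (hf : ∀ x, HasDerivAt f (f' x) x)
    (hf' : Continuous f') (n : ℕ) :
    ∫ x in (0 : ℝ)..π, f' x * (Real.sin (n * x) : ℝ) =
      -(n * ∫ x in (0 : ℝ)..π, f x * (Real.cos (n * x) : ℝ)) := by
  have h := intervalIntegral.integral_deriv_mul_eq_sub (a := 0) (b := π) (u := f)
    (u' := f') (v := fun x => ((Real.sin (n * x) : ℝ) : ℂ))
    (v' := fun x => ((n * Real.cos (n * x) : ℝ) : ℂ))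
    (fun x _ => hf x) (fun x _ => hasDerivAt_sin_mul n x) (hf'.intervalIntegrable _ _)
    ((by fun_prop : Continuous fun x : ℝ => ((n * Real.cos (n * x) : ℝ) : ℂ)).intervalIntegrable _ _)
  have hfc : Continuous f := continuous_iff_continuousAt.2 fun x => (hf x).continuousAt
  rw [intervalIntegral.integral_add
    ((by fun_prop : Continuous fun x : ℝ => f' x * ((Real.sin (n * x) : ℝ) : ℂ)).intervalIntegrable _ _)
    ((by fun_prop : Continuous fun x : ℝ => f x *
      ((n * Real.cos (n * x) : ℝ) : ℂ)).intervalIntegrable _ _)] at h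
  simp only [Real.sin_nat_mul_pi, mul_zero, Real.sin_zero, Complex.ofReal_zero, sub_zero] at h
  rw [eq_neg_of_add_eq_zero_left h, ← intervalIntegral.integral_const_mul]
  congr 1
  refine intervalIntegral.integral_congr fun x _ => ?_
  push_cast
  ring

theorem integral_deriv_mul_cos {f f' : ℝ → ℂ} (hf : ∀ x, HasDerivAt f (f' x) x)
    (hf' : Continuous f') (h0 : f 0 = 0) (hπ : f π = 0) (n : ℕ) :
    ∫ x in (0 : ℝ)..π, f' x * (Real.cos (n * x) : ℝ) =
      n * ∫ x in (0 : ℝ)..π, f x * (Real.sin (n * x) : ℝ) := by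
  have h := intervalIntegral.integral_deriv_mul_eq_sub (a := 0) (b := π) (u := f)
    (u' := f') (v := fun x => ((Real.cos (n * x) : ℝ) : ℂ))
    (v' := fun x => ((-(n * Real.sin (n * x)) : ℝ) : ℂ))
    (fun x _ => hf x) (fun x _ => hasDerivAt_cos_mul n x) (hf'.intervalIntegrable _ _)
    ((by fun_prop : Continuous fun x : ℝ =>
      ((-(n * Real.sin (n * x)) : ℝ) : ℂ)).intervalIntegrable _ _)
  have hfc : Continuous f := continuous_iff_continuousAt.2 fun x => (hf x).continuousAt
  rw [intervalIntegral.integral_add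
    ((by fun_prop : Continuous fun x : ℝ => f' x * ((Real.cos (n * x) : ℝ) : ℂ)).intervalIntegrable _ _)
    ((by fun_prop : Continuous fun x : ℝ => f x *
      ((-(n * Real.sin (n * x)) : ℝ) : ℂ)).intervalIntegrable _ _), h0, hπ] at h
  simp only [zero_mul, sub_zero] at h
  rw [eq_neg_of_add_eq_zero_left h, ← intervalIntegral.integral_const_mul,
    ← intervalIntegral.integral_neg]
  refine intervalIntegral.integral_congr fun x _ => ?_
  push_cast
  ring

theorem sineCoeff_deriv_deriv {f f' f'' : ℝ → ℂ} (hf : ∀ x, HasDerivAt f (f' x) x)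
    (hf' : ∀ x, HasDerivAt f' (f'' x) x) (hf'' : Continuous f'') (h0 : f 0 = 0) (hπ : f π = 0)
    (n : ℕ) : sineCoeff f'' n = -(n ^ 2 * sineCoeff f n) := by
  have hc : Continuous f' := continuous_iff_continuousAt.2 fun x => (hf' x).continuousAt
  rw [sineCoeff, integral_deriv_mul_sin hf' hf'', integral_deriv_mul_cos hf hc h0 hπ, sineCoeff]
  ring

theorem exists_norm_sineCoeff_le {f : ℝ → ℂ} (hf : Continuous f) :
    ∃ C, ∀ n, ‖sineCoeff f n‖ ≤ C := by
  obtain ⟨C, hC⟩ := isCompact_Icc.exists_bound_of_continuousOn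
    (s := Set.Icc (0 : ℝ) π) hf.continuousOn
  refine ⟨‖(2 / π : ℂ)‖ * (C * |π - 0|), fun n => ?_⟩
  rw [sineCoeff, norm_mul]
  gcongr
  refine intervalIntegral.norm_integral_le_of_norm_le_const fun x hx => ?_
  rw [Set.uIoc_of_le Real.pi_pos.le] at hx
  have h1 := hC x ⟨hx.1.le, hx.2⟩
  rw [norm_mul, Complex.norm_real, Real.norm_eq_abs]
  calc ‖f x‖ * |Real.sin (n * x)| ≤ ‖f x‖ * 1 := by
        gcongr
        exact Real.abs_sin_le_one _
    _ ≤ C := by rw [mul_one]; exact h1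

namespace HeatTest

variable (φ : HeatTest)

theorem smooth_deriv : ContDiff ℝ ∞ (deriv φ.ψ) := (contDiff_infty_iff_deriv.1 φ.smooth).2

theorem smooth_deriv2 : ContDiff ℝ ∞ (deriv (deriv φ.ψ)) :=
  (contDiff_infty_iff_deriv.1 φ.smooth_deriv).2

theorem hasDerivAt (x : ℝ) : HasDerivAt φ.ψ (deriv φ.ψ x) x :=
  ((contDiff_infty_iff_deriv.1 φ.smooth).1 x).hasDerivAt

theorem hasDerivAt_deriv (x : ℝ) : HasDerivAt (deriv φ.ψ) (deriv (deriv φ.ψ) x) x :=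
  ((contDiff_infty_iff_deriv.1 φ.smooth_deriv).1 x).hasDerivAt

theorem sineCoeff_laplacian (n : ℕ) :
    sineCoeff (deriv (deriv φ.ψ)) n = -(n ^ 2 * sineCoeff φ.ψ n) :=
  sineCoeff_deriv_deriv φ.hasDerivAt φ.hasDerivAt_deriv φ.smooth_deriv2.continuous
    φ.zero_left φ.zero_right n

/-- The sine coefficients of a test function are `O(n⁻⁴)`: integrate by parts four times, where `ψ`
and `ψ''` contribute no boundary terms. -/
theorem exists_norm_sineCoeff_le : ∃ C, ∀ n : ℕ, n ^ 4 * ‖sineCoeff φ.ψ n‖ ≤ C := by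
  have h3 := (contDiff_infty_iff_deriv.1 φ.smooth_deriv2)
  have h4 := (contDiff_infty_iff_deriv.1 h3.2)
  obtain ⟨C, hC⟩ := DirichletHeat.exists_norm_sineCoeff_le h4.2.continuous
  refine ⟨C, fun n => ?_⟩
  have h5 := sineCoeff_deriv_deriv (fun x => (h3.1 x).hasDerivAt) (fun x => (h4.1 x).hasDerivAt)
    h4.2.continuous φ.zero_left' φ.zero_right' n
  rw [φ.sineCoeff_laplacian] at h5
  have h6 := hC n
  rw [h5, mul_neg, neg_neg, ← mul_assoc, ← pow_add, norm_mul, norm_pow, Complex.norm_natCast] at h6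
  exact h6

theorem summable_sineCoeff : Summable fun n : ℕ => (n : ℝ) ^ 2 * ‖sineCoeff φ.ψ n‖ := by
  obtain ⟨C, hC⟩ := φ.exists_norm_sineCoeff_le
  refine Summable.of_nonneg_of_le (fun n => by positivity) (fun n => ?_)
    ((Real.summable_one_div_nat_pow.2 (by norm_num : 1 < 2)).mul_left C)
  rcases Nat.eq_zero_or_pos n with rfl | hn
  · simp
  · have hn' : (0 : ℝ) < n := by exact_mod_cast hn
    rw [mul_one_div, le_div_iff₀ (by positivity)]
    refine le_trans (le_of_eq ?_) (hC n)
    ring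

theorem summable_sineCoeff_one : Summable fun n : ℕ => (n : ℝ) * ‖sineCoeff φ.ψ n‖ := by
  refine Summable.of_nonneg_of_le (fun n => by positivity) (fun n => ?_) φ.summable_sineCoeff
  gcongr
  exact_mod_cast Nat.le_self_pow (by norm_num) n

end HeatTest

/-! ### Expansion of test functions in sines -/

/-- The Fourier coefficients of an even function are cosine coefficients. -/
theorem fourierCoeff_even {h : ℝ → ℂ} (hh : Continuous h) [Fact (0 < 2 * π)] (n : ℤ)
    (H : AddCircle (2 * π) → ℂ) (hH : ∀ x ∈ Set.Icc (-π) π, H x = h |x|) :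
    fourierCoeff H n = (1 / π : ℂ) * ∫ x in (0 : ℝ)..π, h x * (Real.cos (n * x) : ℝ) := by
  have hπ := Real.pi_pos
  have hπc : (π : ℂ) ≠ 0 := by exact_mod_cast hπ.ne'
  set e : ℝ → ℂ := fun x => Complex.exp (-(n * x * Complex.I)) with he
  have hec : Continuous e := by fun_prop
  have hfour : ∀ x : ℝ, (fourier (-n) (x : AddCircle (2 * π)) : ℂ) = e x := by
    intro x
    rw [fourier_coe_apply, he]
    congr 1
    push_cast
    field_simp
  have hi : ∀ a b, IntervalIntegrable (fun x => e x * h |x|) volume a b := fun a b =>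
    (hec.mul (hh.comp continuous_abs)).intervalIntegrable a b
  have hi2 : ∀ a b, IntervalIntegrable (fun x => e x * h x) volume a b := fun a b =>
    (hec.mul hh).intervalIntegrable a b
  have hi3 : ∀ a b, IntervalIntegrable (fun x => e (-x) * h x) volume a b := fun a b =>
    ((hec.comp continuous_neg).mul hh).intervalIntegrable a b
  rw [fourierCoeff_eq_intervalIntegral _ _ (-π), show -π + 2 * π = π by ring]
  have h1 : ∫ x in (-π)..π, (fourier (-n) (x : AddCircle (2 * π)) : ℂ) • H x =
      ∫ x in (-π)..π, e x * h |x| := by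
    refine intervalIntegral.integral_congr fun x hx => ?_
    rw [Set.uIcc_of_le (by linarith)] at hx
    simp only [smul_eq_mul]
    rw [hfour, hH x hx]
  have h2 : ∫ x in (-π)..0, e x * h |x| = ∫ x in (0 : ℝ)..π, e (-x) * h x := by
    have := intervalIntegral.integral_comp_neg (a := 0) (b := π) fun x => e x * h |x|
    rw [neg_zero] at this
    rw [← this]
    refine intervalIntegral.integral_congr fun x hx => ?_
    rw [Set.uIcc_of_le hπ.le] at hx
    simp only [abs_neg, abs_of_nonneg hx.1]
  have h3 : ∫ x in (0 : ℝ)..π, e x * h |x| = ∫ x in (0 : ℝ)..π, e x * h x := by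
    refine intervalIntegral.integral_congr fun x hx => ?_
    rw [Set.uIcc_of_le hπ.le] at hx
    simp only [abs_of_nonneg hx.1]
  rw [h1, ← intervalIntegral.integral_add_adjacent_intervals (hi (-π) 0) (hi 0 π), h2, h3,
    ← intervalIntegral.integral_add (hi3 0 π) (hi2 0 π), Complex.real_smul]
  have h4 : ∀ x : ℝ, e (-x) * h x + e x * h x = 2 * (h x * (Real.cos (n * x) : ℝ)) := by
    intro x
    rw [he, Complex.ofReal_cos, Complex.cos]
    push_cast
    rw [show -(n * -(x : ℂ) * Complex.I) = n * x * Complex.I by ring,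
      show -(n * (x : ℂ) * Complex.I) = -(n * x) * Complex.I by ring]
    ring
  simp_rw [h4]
  rw [intervalIntegral.integral_const_mul, ← mul_assoc]
  congr 1
  push_cast
  field_simp

namespace HeatTest

variable (φ : HeatTest)

theorem integral_deriv_mul_cos (n : ℕ) :
    (1 / π : ℂ) * ∫ x in (0 : ℝ)..π, deriv φ.ψ x * (Real.cos (n * x) : ℝ) =
      n * sineCoeff φ.ψ n / 2 := by
  have hπc : (π : ℂ) ≠ 0 := by exact_mod_cast Real.pi_ne_zero
  rw [DirichletHeat.integral_deriv_mul_cos φ.hasDerivAt φ.smooth_deriv.continuous φ.zero_left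
    φ.zero_right, sineCoeff]
  field_simp

/-- The Fourier series of the even extension of `ψ'`. -/
theorem hasSum_deriv {x : ℝ} (hx : x ∈ Set.Icc 0 π) :
    HasSum (fun n : ℕ => n * sineCoeff φ.ψ n * (Real.cos (n * x) : ℝ)) (deriv φ.ψ x) := by
  have hπ := Real.pi_pos
  have : Fact (0 < 2 * π) := ⟨by positivity⟩
  have hc := φ.smooth_deriv.continuous
  set h : ℝ → ℂ := fun x => deriv φ.ψ |x| with hh
  have hhc : Continuous h := hc.comp continuous_abs
  have hper : h (-π) = h (-π + 2 * π) := by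
    rw [show -π + 2 * π = π by ring]
    simp [hh]
  let H : C(AddCircle (2 * π), ℂ) :=
    ⟨AddCircle.liftIco (2 * π) (-π) h, AddCircle.liftIco_continuous hper hhc.continuousOn⟩
  have hH : ∀ y ∈ Set.Icc (-π) π, H y = h y := by
    intro y hy
    rcases hy.2.lt_or_eq with h1 | h1
    · have hI : y ∈ Set.Ico (-π) (-π + 2 * π) := ⟨hy.1, by linarith⟩
      exact AddCircle.liftIco_coe_apply (f := h) hI
    · have h2 : ((y : ℝ) : AddCircle (2 * π)) = ((-π : ℝ) : AddCircle (2 * π)) := by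
        rw [h1, ← AddCircle.coe_add_period (2 * π) (-π), show -π + 2 * π = π by ring]
      have hI : -π ∈ Set.Ico (-π) (-π + 2 * π) := ⟨le_rfl, by linarith⟩
      have h3 : H ((-π : ℝ) : AddCircle (2 * π)) = h (-π) := AddCircle.liftIco_coe_apply (f := h) hI
      rw [h2, h3, h1]
      simp [hh]
  have hcoeff : ∀ n : ℕ, fourierCoeff H n = n * sineCoeff φ.ψ n / 2 := by
    intro n
    rw [fourierCoeff_even hc n H hH, ← φ.integral_deriv_mul_cos]
    push_cast
    rfl
  have hcoeff' : ∀ n : ℕ, fourierCoeff H (-(n : ℤ)) = n * sineCoeff φ.ψ n / 2 := by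
    intro n
    rw [fourierCoeff_even hc _ H hH, ← φ.integral_deriv_mul_cos]
    congr 1
    refine intervalIntegral.integral_congr fun y _ => ?_
    push_cast
    rw [neg_mul, Complex.cos_neg]
  have hs : Summable (fun n : ℕ => n * sineCoeff φ.ψ n / 2) := by
    refine Summable.of_norm ?_
    simp_rw [norm_div, norm_mul, Complex.norm_natCast]
    exact φ.summable_sineCoeff_one.div_const _
  have hsum : Summable (fourierCoeff H) :=
    Summable.of_nat_of_neg (by simpa only [hcoeff] using hs) (by simpa only [hcoeff'] using hs)
  have key := (has_pointwise_sum_fourier_series_of_summable hsum (x : AddCircle (2 * π))).nat_add_neg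
  have h0 : fourierCoeff H 0 = 0 := by
    have := hcoeff 0
    simpa using this
  rw [h0, zero_smul, add_zero, hH x ⟨by linarith [hx.1], hx.2⟩, hh] at key
  simp only [abs_of_nonneg hx.1] at key
  convert! key using 1
  ext n
  rw [hcoeff, hcoeff', fourier_coe_apply, fourier_coe_apply, smul_eq_mul, smul_eq_mul,
    Complex.ofReal_cos, Complex.cos]
  have hπc : (π : ℂ) ≠ 0 := by exact_mod_cast Real.pi_ne_zero
  have e1 : (2 * π * Complex.I * ((n : ℤ) : ℂ) * x / ((2 * π : ℝ) : ℂ)) = n * x * Complex.I := by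
    push_cast
    field_simp
  have e2 : (2 * π * Complex.I * ((-(n : ℤ) : ℤ) : ℂ) * x / ((2 * π : ℝ) : ℂ)) =
      -(n * x) * Complex.I := by
    push_cast
    field_simp
  rw [e1, e2]
  push_cast
  ring

end HeatTest

/-! ### Sine series in `L²(0,π)` and in `W_0^{1,2}(0,π)` -/

theorem Lp.coeFn_sum_smul {ι : Type*} {μ : Measure ℝ} (s : Finset ι) (c : ι → ℂ)
    (f : ι → Lp ℂ 2 μ) : (∑ i ∈ s, c i • f i : Lp ℂ 2 μ) =ᵐ[μ] fun x => ∑ i ∈ s, c i * f i x := by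
  classical
  induction s using Finset.induction_on with
  | empty =>
    simp only [Finset.sum_empty]
    exact Lp.coeFn_zero ℂ 2 μ
  | insert i s hi ih =>
    rw [Finset.sum_insert hi]
    filter_upwards [Lp.coeFn_add (c i • f i) (∑ i ∈ s, c i • f i), ih,
      Lp.coeFn_smul (c i) (f i)] with x h1 h2 h3
    rw [h1, Pi.add_apply, h2, h3, Finset.sum_insert hi, Pi.smul_apply, smul_eq_mul]

/-- A series of continuous functions that converges normally on `(0,π)` converges in `L²(0,π)`. -/
theorem hasSum_toLp {f : ℝ → ℂ} (hf : Continuous f) {c : ℕ → ℂ} {F : ℕ → ℝ → ℂ}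
    (hF : ∀ n, Continuous (F n)) {M : ℕ → ℝ} (hM : Summable M)
    (hFM : ∀ n, ∀ x ∈ Set.Ioo 0 π, ‖c n * F n x‖ ≤ M n)
    (h : ∀ x ∈ Set.Ioo 0 π, HasSum (fun n => c n * F n x) (f x)) :
    HasSum (fun n => c n • ((memLp_rod (hF n)).toLp (F n) : L2Rod)) ((memLp_rod hf).toLp f) := by
  rw [HasSum, SummationFilter.unconditional_filter, tendsto_iff_norm_sub_tendsto_zero]
  have hM0 : ∀ n, 0 ≤ M n := fun n =>
    (norm_nonneg _).trans (hFM n (π / 2) ⟨by positivity, by linarith [Real.pi_pos]⟩)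
  have h0 := (tendsto_tsum_compl_atTop_zero M).const_mul
    ((measureUnivNNReal rodMeasure : ℝ) ^ ((2 : ENNReal).toReal)⁻¹)
  rw [mul_zero] at h0
  refine squeeze_zero (fun _ => norm_nonneg _) (fun s => ?_) h0
  refine Lp.norm_le_of_ae_bound (tsum_nonneg fun n => hM0 n) ?_
  filter_upwards [Lp.coeFn_sum_smul s c fun n => (memLp_rod (hF n)).toLp (F n),
    (memLp_rod hf).coeFn_toLp, ae_all_iff.2 fun n => (memLp_rod (hF n)).coeFn_toLp,
    Lp.coeFn_sub (∑ n ∈ s, c n • ((memLp_rod (hF n)).toLp (F n) : L2Rod)) ((memLp_rod hf).toLp f),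
    ae_restrict_mem measurableSet_Ioo] with x h1 h2 h3 h4 hx
  rw [h4, Pi.sub_apply, h1, h2]
  simp_rw [h3]
  have h5 := (h x hx).summable.sum_add_tsum_compl (s := s)
  rw [(h x hx).tsum_eq] at h5
  rw [← h5, sub_add_cancel_left, norm_neg]
  exact tsum_of_norm_bounded (hM.subtype _).hasSum fun n => hFM n x hx

/-- Convergence in `W_0^{1,2}(0,π)` is convergence in `L²(0,π)` of the functions and of their
derivatives. -/
theorem W01.hasSum_of_fst_snd {f : ℕ → W01} {a : W01}
    (h1 : HasSum (fun n => (f n : WithLp 2 (L2Rod × L2Rod)).fst) (a : WithLp 2 (L2Rod × L2Rod)).fst)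
    (h2 : HasSum (fun n => (f n : WithLp 2 (L2Rod × L2Rod)).snd)
      (a : WithLp 2 (L2Rod × L2Rod)).snd) : HasSum f a := by
  have h3 := (WithLp.prodContinuousLinearEquiv 2 ℂ L2Rod L2Rod).symm.toContinuousLinearMap.hasSum
    (h1.prodMk h2)
  exact (Topology.IsInducing.hasSum_iff (g := W01.subtype) Topology.IsInducing.subtypeVal f a).1 h3

theorem deriv_sin_mul (n : ℕ) : deriv (fun x : ℝ => ((Real.sin (n * x) : ℝ) : ℂ)) =
    fun x => n * ((Real.cos (n * x) : ℝ) : ℂ) :=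
  funext fun x => by simpa using (hasDerivAt_sin_mul n x).deriv

theorem deriv_deriv_sin_mul (n : ℕ) : deriv (deriv fun x : ℝ => ((Real.sin (n * x) : ℝ) : ℂ)) =
    fun x => -(n : ℂ) ^ 2 * ((Real.sin (n * x) : ℝ) : ℂ) := by
  rw [deriv_sin_mul]
  funext x
  refine ((hasDerivAt_cos_mul n x).const_mul (n : ℂ)).deriv.trans ?_
  push_cast
  ring

/-- The test function `sin(nx)`. -/
def sinTest (n : ℕ) : HeatTest where
  ψ x := ((Real.sin (n * x) : ℝ) : ℂ)
  smooth := Complex.ofRealCLM.contDiff.comp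
    (Real.contDiff_sin.comp (contDiff_const.mul contDiff_id))
  zero_left := by simp
  zero_right := by simp [-Complex.ofReal_sin]
  zero_left' := by simp [deriv_deriv_sin_mul, -Complex.ofReal_sin]
  zero_right' := by simp [deriv_deriv_sin_mul, -Complex.ofReal_sin]

theorem W01.ext_fst_snd {a b : W01}
    (h1 : (a : WithLp 2 (L2Rod × L2Rod)).fst = (b : WithLp 2 (L2Rod × L2Rod)).fst)
    (h2 : (a : WithLp 2 (L2Rod × L2Rod)).snd = (b : WithLp 2 (L2Rod × L2Rod)).snd) : a = b :=
  Subtype.ext (WithLp.ofLp_injective 2 (Prod.ext h1 h2))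

theorem toLp_const_mul (c : ℂ) {f : ℝ → ℂ} (hf : Continuous f) {g : ℝ → ℂ} (hg : Continuous g)
    (h : g = fun x => c * f x) :
    ((memLp_rod hg).toLp g : L2Rod) = c • (memLp_rod hf).toLp f := by
  subst h
  exact MemLp.toLp_const_smul c (memLp_rod hf)

theorem laplacian_sinTest (n : ℕ) :
    (sinTest n).laplacian = (-(n : ℂ) ^ 2) • (sinTest n).toW01 := by
  refine W01.ext_fst_snd ?_ ?_
  · exact toLp_const_mul (-(n : ℂ) ^ 2) (sinTest n).smooth.continuous
      (sinTest n).smooth_deriv2.continuous (deriv_deriv_sin_mul n)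
  · refine toLp_const_mul (-(n : ℂ) ^ 2) (sinTest n).smooth_deriv.continuous
      (contDiff_infty_iff_deriv.1 (sinTest n).smooth_deriv2).2.continuous ?_
    change deriv (deriv (deriv fun x : ℝ => ((Real.sin (n * x) : ℝ) : ℂ))) = _
    rw [deriv_deriv_sin_mul]
    funext x
    exact ((sinTest n).hasDerivAt x).const_mul _ |>.deriv

theorem deriv_sinTest_zero (n : ℕ) : deriv (sinTest n).ψ 0 = n := by
  change deriv (fun x : ℝ => ((Real.sin (n * x) : ℝ) : ℂ)) 0 = n
  simp [deriv_sin_mul, -Complex.ofReal_sin]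

theorem deriv_sinTest_pi (n : ℕ) : deriv (sinTest n).ψ π = n * (-1) ^ n := by
  change deriv (fun x : ℝ => ((Real.sin (n * x) : ℝ) : ℂ)) π = _
  simp only [deriv_sin_mul, Real.cos_nat_mul_pi]
  push_cast
  rfl

namespace HeatTest

variable (φ : HeatTest)

theorem hasSum_sine {x : ℝ} (hx : x ∈ Set.Icc 0 π) :
    HasSum (fun n : ℕ => sineCoeff φ.ψ n * (Real.sin (n * x) : ℝ)) (φ.ψ x) := by
  have h := intervalIntegral.hasSum_integral_of_dominated_convergence (a := 0) (b := x)
    (μ := volume) (F := fun (n : ℕ) (y : ℝ) => n * sineCoeff φ.ψ n * (Real.cos (n * y) : ℝ))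
    (f := deriv φ.ψ) (fun n _ => n * ‖sineCoeff φ.ψ n‖)
    (fun n => (by fun_prop : Continuous fun y : ℝ =>
      n * sineCoeff φ.ψ n * (Real.cos (n * y) : ℝ)).aestronglyMeasurable)
    (fun n => Filter.Eventually.of_forall fun y _ => ?_)
    (Filter.Eventually.of_forall fun y _ => φ.summable_sineCoeff_one)
    intervalIntegrable_const (Filter.Eventually.of_forall fun y hy => ?_)
  · rw [intervalIntegral.integral_eq_sub_of_hasDerivAt (fun y _ => φ.hasDerivAt y)
      (φ.smooth_deriv.continuous.intervalIntegrable _ _), φ.zero_left, sub_zero] at h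
    convert! h using 1
    ext n
    rw [intervalIntegral.integral_eq_sub_of_hasDerivAt
      (f := fun y : ℝ => sineCoeff φ.ψ n * ((Real.sin (n * y) : ℝ) : ℂ)) (fun y _ =>
      ((hasDerivAt_sin_mul n y).const_mul (sineCoeff φ.ψ n)).congr_deriv ?_)
      ((by fun_prop : Continuous fun y : ℝ =>
        n * sineCoeff φ.ψ n * (Real.cos (n * y) : ℝ)).intervalIntegrable _ _)]
    · simp
    · push_cast
      ring
  · rw [norm_mul, norm_mul, Complex.norm_natCast, Complex.norm_real]
    exact mul_le_of_le_one_right (by positivity) (Real.abs_cos_le_one _)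
  · rw [Set.uIoc_of_le hx.1] at hy
    exact φ.hasSum_deriv ⟨hy.1.le, hy.2.trans hx.2⟩

/-- The sine series of a test function converges in `W_0^{1,2}(0,π)`. -/
theorem hasSum_toW01 :
    HasSum (fun n : ℕ => sineCoeff φ.ψ n • (sinTest n).toW01) φ.toW01 := by
  refine W01.hasSum_of_fst_snd ?_ ?_
  · refine hasSum_toLp φ.smooth.continuous (fun n => (sinTest n).smooth.continuous)
      (M := fun n => ‖sineCoeff φ.ψ n‖) ?_ (fun n x _ => ?_)
      fun x hx => φ.hasSum_sine ⟨hx.1.le, hx.2.le⟩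
    · refine φ.summable_sineCoeff_one.of_nonneg_of_le (fun _ => norm_nonneg _) fun n => ?_
      rcases n.eq_zero_or_pos with rfl | hn
      · simp [sineCoeff_zero]
      · exact le_mul_of_one_le_left (norm_nonneg _) (by exact_mod_cast hn)
    · rw [norm_mul]
      refine mul_le_of_le_one_right (norm_nonneg _) ?_
      change ‖((Real.sin (n * x) : ℝ) : ℂ)‖ ≤ 1
      rw [Complex.norm_real]
      exact Real.abs_sin_le_one _
  · have hd : ∀ (n : ℕ) (x : ℝ), deriv (sinTest n).ψ x = n * ((Real.cos (n * x) : ℝ) : ℂ) :=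
      fun n => congrFun (deriv_sin_mul n)
    refine hasSum_toLp φ.smooth_deriv.continuous (fun n => (sinTest n).smooth_deriv.continuous)
      (M := fun n => n * ‖sineCoeff φ.ψ n‖) φ.summable_sineCoeff_one (fun n x _ => ?_)
      fun x hx => ?_
    · rw [hd, norm_mul, norm_mul, Complex.norm_natCast, Complex.norm_real, mul_left_comm,
        ← mul_assoc]
      exact mul_le_of_le_one_right (by positivity) (Real.abs_cos_le_one _)
    · simpa only [hd, mul_left_comm, mul_assoc] using φ.hasSum_deriv ⟨hx.1.le, hx.2.le⟩

end HeatTest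

/-! ### Variation of constants for the modes -/

section

theorem hasDerivAt_cexp_mul (c : ℂ) (x : ℝ) :
    HasDerivAt (fun x : ℝ => Complex.exp (c * x)) (c * Complex.exp (c * x)) x := by
  have h := ((Complex.ofRealCLM.hasDerivAt (x := x)).const_mul c).cexp
  simpa [mul_comm] using h

/-- Variation of constants for an integrable right hand side: uniqueness. -/
theorem eq_exp_mul_integral {c : ℂ} {y g : ℝ → ℂ} {t : ℝ} (ht : 0 ≤ t)
    (hg : IntervalIntegrable g volume 0 t) (hy : ContinuousOn y (Set.Icc 0 t))
    (h : ∀ x ∈ Set.Icc 0 t, y x = ∫ s in (0 : ℝ)..x, (-c * y s + g s)) :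
    y t = Complex.exp (-(c * t)) * ∫ s in (0 : ℝ)..t, Complex.exp (c * s) * g s := by
  have hyi : IntervalIntegrable y volume 0 t :=
    ContinuousOn.intervalIntegrable (by rwa [Set.uIcc_of_le ht])
  have hec : Continuous fun x : ℝ => Complex.exp (c * x) := by fun_prop
  have h1 := integral_mul_eq_sub_integral_primitive ht ((hyi.const_mul (-c)).add hg)
    (hasDerivAt_cexp_mul c) (by fun_prop)
  rw [← h t ⟨ht, le_rfl⟩] at h1
  have h2 : ∫ x in (0 : ℝ)..t, c * Complex.exp (c * x) * ∫ s in (0 : ℝ)..x, (-c * y s + g s) =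
      ∫ x in (0 : ℝ)..t, c * Complex.exp (c * x) * y x := by
    refine intervalIntegral.integral_congr fun x hx => ?_
    rw [Set.uIcc_of_le ht] at hx
    rw [← h x hx]
  have h3 : ∫ x in (0 : ℝ)..t, Complex.exp (c * x) * (-c * y x + g x) =
      -(∫ x in (0 : ℝ)..t, c * Complex.exp (c * x) * y x) +
        ∫ x in (0 : ℝ)..t, Complex.exp (c * x) * g x := by
    rw [← intervalIntegral.integral_neg, ← intervalIntegral.integral_add]
    · refine intervalIntegral.integral_congr fun x _ => ?_
      ring
    · exact (hyi.continuousOn_mul (by fun_prop : Continuous fun x : ℝ =>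
        c * Complex.exp (c * x)).continuousOn).neg
    · exact hg.continuousOn_mul hec.continuousOn
  rw [h2, h3] at h1
  have h4 : ∫ x in (0 : ℝ)..t, Complex.exp (c * x) * g x = Complex.exp (c * t) * y t := by
    linear_combination h1
  rw [h4, ← mul_assoc, ← Complex.exp_add, neg_add_cancel, Complex.exp_zero, one_mul]

theorem continuousOn_exp_mul_integral {c : ℂ} {g : ℝ → ℂ} {t : ℝ} (ht : 0 ≤ t)
    (hg : IntervalIntegrable g volume 0 t) :
    ContinuousOn (fun x : ℝ => Complex.exp (-(c * x)) *
      ∫ s in (0 : ℝ)..x, Complex.exp (c * s) * g s) (Set.Icc 0 t) := by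
  refine (by fun_prop : Continuous fun x : ℝ => Complex.exp (-(c * x))).continuousOn.mul ?_
  rw [← Set.uIcc_of_le ht]
  refine intervalIntegral.continuousOn_primitive_interval ?_
  rw [← intervalIntegrable_iff']
  exact hg.continuousOn_mul (by fun_prop : Continuous fun x : ℝ => Complex.exp (c * x)).continuousOn

/-- Variation of constants for an integrable right hand side: existence. -/
theorem exp_mul_integral_eq {c : ℂ} {g : ℝ → ℂ} {t : ℝ} (ht : 0 ≤ t)
    (hg : IntervalIntegrable g volume 0 t) :
    Complex.exp (-(c * t)) * ∫ s in (0 : ℝ)..t, Complex.exp (c * s) * g s =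
      ∫ x in (0 : ℝ)..t, (-c * (Complex.exp (-(c * x)) *
        ∫ s in (0 : ℝ)..x, Complex.exp (c * s) * g s) + g x) := by
  have hG := hg.continuousOn_mul
    (by fun_prop : Continuous fun x : ℝ => Complex.exp (c * x)).continuousOn
  have h1 := integral_mul_eq_sub_integral_primitive ht hG
    (hasDerivAt_cexp_mul (-c)) (by fun_prop)
  have h2 : ∫ x in (0 : ℝ)..t, Complex.exp (-c * x) * (Complex.exp (c * x) * g x) =
      ∫ x in (0 : ℝ)..t, g x := by
    refine intervalIntegral.integral_congr fun x _ => ?_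
    rw [← mul_assoc, ← Complex.exp_add, neg_mul, neg_add_cancel, Complex.exp_zero, one_mul]
  have hi : IntervalIntegrable (fun x : ℝ => Complex.exp (-(c * x)) *
      ∫ s in (0 : ℝ)..x, Complex.exp (c * s) * g s) volume 0 t :=
    ContinuousOn.intervalIntegrable
      (by rw [Set.uIcc_of_le ht]; exact continuousOn_exp_mul_integral ht hg)
  rw [intervalIntegral.integral_add (hi.const_mul _) hg, ← h2, h1]
  simp only [neg_mul, mul_assoc, intervalIntegral.integral_neg]
  ring

/-- The pairing `n ∫₀ᵗ e^{-n²(t-s)} g(s) ds` with `sin(nx)` of the solution at time `t` with boundary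
value `g` at `0` and boundary value `0` at `π`. -/
def mode (n : ℕ) (g : ℝ → ℂ) (t : ℝ) : ℂ :=
  n * (Complex.exp (-((n : ℂ) ^ 2 * t)) * ∫ s in (0 : ℝ)..t, Complex.exp ((n : ℂ) ^ 2 * s) * g s)

variable {τ : ℝ} {g : ℝ → ℂ}

theorem intervalIntegrable_of_integrableOn_Icc (hg : IntegrableOn g (Set.Icc 0 τ)) {t : ℝ}
    (ht : t ∈ Set.Icc 0 τ) : IntervalIntegrable g volume 0 t := by
  rw [intervalIntegrable_iff, Set.uIoc_of_le ht.1]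
  exact hg.mono_set fun x hx => ⟨hx.1.le, hx.2.trans ht.2⟩

theorem continuousOn_mode (hτ : 0 ≤ τ) (hg : IntegrableOn g (Set.Icc 0 τ)) (n : ℕ) :
    ContinuousOn (mode n g) (Set.Icc 0 τ) :=
  (continuousOn_exp_mul_integral hτ
    (intervalIntegrable_of_integrableOn_Icc hg ⟨hτ, le_rfl⟩)).const_mul _

theorem mode_eq_integral (hg : IntegrableOn g (Set.Icc 0 τ)) (n : ℕ) {t : ℝ}
    (ht : t ∈ Set.Icc 0 τ) :
    mode n g t = ∫ x in (0 : ℝ)..t, (-(n : ℂ) ^ 2 * mode n g x + n * g x) := by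
  simp only [mode]
  rw [exp_mul_integral_eq ht.1 (intervalIntegrable_of_integrableOn_Icc hg ht),
    ← intervalIntegral.integral_const_mul]
  refine intervalIntegral.integral_congr fun x _ => ?_
  ring

theorem eq_mode (hg : IntegrableOn g (Set.Icc 0 τ)) (n : ℕ) {y : ℝ → ℂ}
    (hy : ContinuousOn y (Set.Icc 0 τ))
    (h : ∀ x ∈ Set.Icc 0 τ, y x = ∫ s in (0 : ℝ)..x, (-(n : ℂ) ^ 2 * y s + n * g s)) {t : ℝ}
    (ht : t ∈ Set.Icc 0 τ) : y t = mode n g t := by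
  rw [eq_exp_mul_integral ht.1
    ((intervalIntegrable_of_integrableOn_Icc hg ht).const_mul (n : ℂ))
    (hy.mono (Set.Icc_subset_Icc_right ht.2))
    fun x hx => h x ⟨hx.1, hx.2.trans ht.2⟩, mode, mul_left_comm]
  congr 1
  rw [← intervalIntegral.integral_const_mul]
  refine intervalIntegral.integral_congr fun s _ => ?_
  ring

theorem mode_eq_integral_mul (n : ℕ) (t : ℝ) : mode n g t =
    ∫ s in (0 : ℝ)..t, ((n * Real.exp (-(n ^ 2 * (t - s))) : ℝ) : ℂ) * g s := by
  rw [mode, ← intervalIntegral.integral_const_mul, ← intervalIntegral.integral_const_mul]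
  refine intervalIntegral.integral_congr fun s _ => ?_
  rw [← mul_assoc (Complex.exp _), ← Complex.exp_add]
  push_cast
  rw [mul_assoc]
  congr 3
  ring

/-- The modes are bounded uniformly in `n`, since `∫₀ᵗ (n e^{-n²(t-s)})² ds ≤ 1/2`. -/
theorem norm_mode_le (hg : MemLp g 2 (volume.restrict (Set.Icc 0 τ))) (n : ℕ) {t : ℝ}
    (ht : t ∈ Set.Icc 0 τ) :
    ‖mode n g t‖ ≤ 1 / 4 + (∫ s in Set.Icc 0 τ, ‖g s‖ ^ 2) / 2 := by
  have hg2 : IntegrableOn (fun s => ‖g s‖ ^ 2) (Set.Icc 0 τ) := hg.integrable_norm_pow (by norm_num)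
  have hgi : IntervalIntegrable (fun s => ‖g s‖ ^ 2) volume 0 t := by
    rw [intervalIntegrable_iff, Set.uIoc_of_le ht.1]
    exact hg2.mono_set fun x hx => ⟨hx.1.le, hx.2.trans ht.2⟩
  have hF : ∀ s : ℝ, HasDerivAt (fun s : ℝ => Real.exp (-(2 * n ^ 2 * (t - s))) / 2)
      ((n * Real.exp (-(n ^ 2 * (t - s)))) ^ 2) s := by
    intro s
    have h1 : HasDerivAt (fun s : ℝ => -(2 * (n : ℝ) ^ 2 * (t - s))) (2 * (n : ℝ) ^ 2) s := by
      exact (((hasDerivAt_id s).const_sub t).const_mul (2 * (n : ℝ) ^ 2)).neg.congr_deriv (by ring)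
    refine (h1.exp.div_const 2).congr_deriv ?_
    rw [mul_pow, ← Real.exp_nat_mul]
    push_cast
    rw [show (2 : ℝ) * -((n : ℝ) ^ 2 * (t - s)) = -(2 * n ^ 2 * (t - s)) by ring]
    ring
  have hkc : Continuous fun s : ℝ => (n * Real.exp (-(n ^ 2 * (t - s)))) ^ 2 := by fun_prop
  have hk : ∫ s in (0 : ℝ)..t, (n * Real.exp (-(n ^ 2 * (t - s)))) ^ 2 ≤ 1 / 2 := by
    rw [intervalIntegral.integral_eq_sub_of_hasDerivAt (fun s _ => hF s)
      (hkc.intervalIntegrable _ _), sub_self, mul_zero, neg_zero, Real.exp_zero]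
    have := Real.exp_nonneg (-(2 * (n : ℝ) ^ 2 * (t - 0)))
    linarith
  rw [mode_eq_integral_mul]
  calc _ ≤ ∫ s in (0 : ℝ)..t, ((n * Real.exp (-(n ^ 2 * (t - s)))) ^ 2 / 2 + ‖g s‖ ^ 2 / 2) := by
        refine intervalIntegral.norm_integral_le_of_norm_le ht.1
          (Filter.Eventually.of_forall fun s _ => ?_)
          (((hkc.intervalIntegrable _ _).div_const 2).add (hgi.div_const 2))
        rw [norm_mul, Complex.norm_real, Real.norm_of_nonneg (by positivity)]
        nlinarith [sq_nonneg (n * Real.exp (-(n ^ 2 * (t - s))) - ‖g s‖)]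
    _ ≤ _ := by
        rw [intervalIntegral.integral_add ((hkc.intervalIntegrable _ _).div_const 2)
          (hgi.div_const 2), intervalIntegral.integral_div, intervalIntegral.integral_div]
        have h5 : ∫ s in (0 : ℝ)..t, ‖g s‖ ^ 2 ≤ ∫ s in Set.Icc 0 τ, ‖g s‖ ^ 2 := by
          rw [intervalIntegral.integral_of_le ht.1]
          exact setIntegral_mono_set hg2 (Filter.Eventually.of_forall fun s => by positivity)
            (Filter.Eventually.of_forall fun s hs => ⟨hs.1.le, hs.2.trans ht.2⟩)
        linarith

/-- The boundary data seen by the `n`-th mode, `u₀(σ) - (-1)ⁿ u_π(σ)`; the sign comes from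
`cos(nπ) = (-1)ⁿ`. -/
def modeInput (u : Input τ) (n : ℕ) (σ : ℝ) : ℂ := u σ 0 - (-1) ^ n * u σ 1

theorem memLp_modeInput (u : Input τ) (n : ℕ) :
    MemLp (modeInput u n) 2 (volume.restrict (Set.Icc 0 τ)) :=
  (memLp_input u 0).sub ((memLp_input u 1).const_mul _)

theorem integrableOn_modeInput (u : Input τ) (n : ℕ) :
    IntegrableOn (modeInput u n) (Set.Icc 0 τ) :=
  (memLp_modeInput u n).integrable (by norm_num)

theorem exists_norm_mode_modeInput_le (u : Input τ) :
    ∃ M, ∀ n, ∀ t ∈ Set.Icc 0 τ, ‖mode n (modeInput u n) t‖ ≤ M := by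
  refine ⟨max (1 / 4 + (∫ s in Set.Icc 0 τ, ‖modeInput u 0 s‖ ^ 2) / 2)
    (1 / 4 + (∫ s in Set.Icc 0 τ, ‖modeInput u 1 s‖ ^ 2) / 2), fun n t ht => ?_⟩
  refine (norm_mode_le (memLp_modeInput u n) n ht).trans ?_
  rcases n.even_or_odd with hn | hn
  · refine le_max_of_le_left (le_of_eq ?_)
    simp [modeInput, hn.neg_one_pow]
  · refine le_max_of_le_right (le_of_eq ?_)
    simp [modeInput, hn.neg_one_pow]

/-- The test function `sin(nx)` is an eigenfunction of the Laplacian, so the weak equation reduces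
to an ordinary differential equation for `⟨z(t), sin(n·)⟩`. -/
theorem IsHeatSolution.apply_sinTest {u : Input τ} {z : ℝ → Wneg} (h : IsHeatSolution τ u z)
    (n : ℕ) {t : ℝ} (ht : t ∈ Set.Icc 0 τ) :
    z t (sinTest n).toW01 = mode n (modeInput u n) t := by
  refine eq_mode (y := fun t => z t (sinTest n).toW01) (integrableOn_modeInput u n) n
    (h.1.clm_apply continuousOn_const) (fun x hx => ?_) ht
  refine (h.2 (sinTest n) x hx).trans (intervalIntegral.integral_congr fun s _ => ?_)
  simp only
  rw [laplacian_sinTest, deriv_sinTest_zero, deriv_sinTest_pi, map_smul, smul_eq_mul, modeInput]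
  ring

/-- A solution is the sum of its modes when it is applied to a test function. -/
theorem IsHeatSolution.hasSum {u : Input τ} {z : ℝ → Wneg} (h : IsHeatSolution τ u z)
    (φ : HeatTest) {t : ℝ} (ht : t ∈ Set.Icc 0 τ) :
    HasSum (fun n => sineCoeff φ.ψ n * mode n (modeInput u n) t) (z t φ.toW01) := by
  have h1 := (z t).hasSum φ.hasSum_toW01
  simpa only [map_smul, smul_eq_mul, h.apply_sinTest _ ht] using h1

end

section

/-! ### Orthonormal series with varying coefficients -/

theorem summable_smul_of_orthonormal {E : Type*} [NormedAddCommGroup E] [InnerProductSpace ℂ E]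
    [CompleteSpace E] {e : ℕ → E} (he : Orthonormal ℂ e) {c : ℕ → ℂ}
    (hc : Summable fun n => ‖c n‖ ^ 2) : Summable fun n => c n • e n :=
  (he.orthogonalFamily.summable_iff_norm_sq_summable c).2 hc

theorem norm_sq_tsum_smul_of_orthonormal {E : Type*} [NormedAddCommGroup E]
    [InnerProductSpace ℂ E] [CompleteSpace E] {e : ℕ → E} (he : Orthonormal ℂ e) {c : ℕ → ℂ}
    (hc : Summable fun n => ‖c n‖ ^ 2) : ‖∑' n, c n • e n‖ ^ 2 = ∑' n, ‖c n‖ ^ 2 := by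
  have h := ((summable_smul_of_orthonormal he hc).hasSum.norm).pow 2
  refine tendsto_nhds_unique h ?_
  refine hc.hasSum.congr fun s => ?_
  have := he.orthogonalFamily.norm_sum c s
  simpa using this.symm

theorem continuousOn_tsum_smul_of_orthonormal {E : Type*} [NormedAddCommGroup E]
    [InnerProductSpace ℂ E] [CompleteSpace E] {e : ℕ → E} (he : Orthonormal ℂ e)
    {c : ℕ → ℝ → ℂ} {S : Set ℝ} (hcont : ∀ n, ContinuousOn (c n) S) {B : ℕ → ℝ} (hB : Summable B)
    (hcB : ∀ n, ∀ t ∈ S, ‖c n t‖ ^ 2 ≤ B n) : ContinuousOn (fun t => ∑' n, c n t • e n) S := by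
  have hsum : ∀ t ∈ S, Summable fun n => ‖c n t‖ ^ 2 := fun t ht =>
    hB.of_nonneg_of_le (fun n => by positivity) fun n => hcB n t ht
  intro t ht
  rw [ContinuousWithinAt, tendsto_iff_norm_sub_tendsto_zero]
  have hle : ∀ n, ∀ x ∈ S, ‖c n x - c n t‖ ^ 2 ≤ 4 * B n := by
    intro n x hx
    have h1 := norm_sub_le (c n x) (c n t)
    nlinarith [hcB n x hx, hcB n t ht, sq_nonneg (‖c n x‖ - ‖c n t‖), norm_nonneg (c n x - c n t),
      norm_nonneg (c n x), norm_nonneg (c n t)]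
  have h0 : ContinuousOn (fun x => ∑' n, ‖c n x - c n t‖ ^ 2) S :=
    continuousOn_tsum (fun n => (((hcont n).sub continuousOn_const).norm).pow 2) (hB.mul_left 4)
      fun n x hx => by rw [Real.norm_of_nonneg (by positivity)]; exact hle n x hx
  have h1 := (h0 t ht).tendsto.sqrt
  simp only [sub_self, norm_zero, ne_eq, OfNat.ofNat_ne_zero, not_false_eq_true, zero_pow,
    tsum_zero, Real.sqrt_zero] at h1
  refine h1.congr' ?_
  filter_upwards [self_mem_nhdsWithin] with x hx
  rw [← (summable_smul_of_orthonormal he (hsum x hx)).tsum_sub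
    (summable_smul_of_orthonormal he (hsum t ht))]
  simp_rw [← sub_smul]
  rw [← norm_sq_tsum_smul_of_orthonormal he, Real.sqrt_sq (norm_nonneg _)]
  exact (hB.mul_left 4).of_nonneg_of_le (fun n => by positivity) fun n => hle n x hx

/-! ### The cosine system in `L²(0,π)` -/

theorem integral_cos_mul_cos {n m : ℕ} (hn : n ≠ 0) :
    ∫ x in (0 : ℝ)..π, ((Real.cos (n * x) : ℝ) : ℂ) * (Real.cos (m * x) : ℝ) =
      if n = m then (π / 2 : ℂ) else 0 := by
  have hc : ∀ k : ℕ, Continuous fun x : ℝ => ((Real.cos (k * x) : ℝ) : ℂ) := fun k => by fun_prop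
  have hs : ∀ k : ℕ, Continuous fun x : ℝ => ((Real.sin (k * x) : ℝ) : ℂ) := fun k => by fun_prop
  -- integration by parts relates `∫ cos cos` and `∫ sin sin`; exchanging `n` and `m` gives a second
  -- relation, and `cos² + sin² = 1` a third
  have key : ∀ k l : ℕ, (k : ℂ) * ∫ x in (0 : ℝ)..π, ((Real.cos (k * x) : ℝ) : ℂ) *
      (Real.cos (l * x) : ℝ) = l * ∫ x in (0 : ℝ)..π, ((Real.sin (k * x) : ℝ) : ℂ) *
      (Real.sin (l * x) : ℝ) := by
    intro k l
    have h := integral_deriv_mul_cos (hasDerivAt_sin_mul k) (by fun_prop) (by simp)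
      (by simp [-Complex.ofReal_sin]) l
    rw [← h, ← intervalIntegral.integral_const_mul]
    refine intervalIntegral.integral_congr fun x _ => ?_
    push_cast
    ring
  have h1 := key n m
  have h2 := key m n
  simp_rw [mul_comm ((Real.cos (m * _) : ℝ) : ℂ), mul_comm ((Real.sin (m * _) : ℝ) : ℂ)] at h2
  have hn' : (n : ℂ) ≠ 0 := by exact_mod_cast hn
  split_ifs with h
  · subst h
    have h3 := mul_left_cancel₀ hn' h1
    have h4 : (∫ x in (0 : ℝ)..π, ((Real.cos (n * x) : ℝ) : ℂ) * (Real.cos (n * x) : ℝ)) +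
        ∫ x in (0 : ℝ)..π, ((Real.sin (n * x) : ℝ) : ℂ) * (Real.sin (n * x) : ℝ) = π := by
      have hi1 : IntervalIntegrable (fun x : ℝ => ((Real.cos (n * x) : ℝ) : ℂ) *
          (Real.cos (n * x) : ℝ)) volume 0 π := ((hc n).mul (hc n)).intervalIntegrable _ _
      have hi2 : IntervalIntegrable (fun x : ℝ => ((Real.sin (n * x) : ℝ) : ℂ) *
          (Real.sin (n * x) : ℝ)) volume 0 π := ((hs n).mul (hs n)).intervalIntegrable _ _
      rw [← intervalIntegral.integral_add hi1 hi2]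
      have : ∀ x : ℝ, ((Real.cos (n * x) : ℝ) : ℂ) * (Real.cos (n * x) : ℝ) +
          ((Real.sin (n * x) : ℝ) : ℂ) * (Real.sin (n * x) : ℝ) = 1 := by
        intro x
        have := Real.cos_sq_add_sin_sq (n * x)
        rw [← sq, ← sq]
        exact_mod_cast this
      simp_rw [this]
      simp
    rw [← h3] at h4
    linear_combination h4 / 2
  · have h3 : ((n : ℂ) ^ 2 - m ^ 2) * ∫ x in (0 : ℝ)..π, ((Real.cos (n * x) : ℝ) : ℂ) *
        (Real.cos (m * x) : ℝ) = 0 := by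
      linear_combination (n : ℂ) * h1 - (m : ℂ) * h2
    rcases mul_eq_zero.1 h3 with h4 | h4
    · exfalso
      rw [sub_eq_zero] at h4
      have h5 : n ^ 2 = m ^ 2 := by exact_mod_cast h4
      exact h (Nat.pow_left_injective (by norm_num) h5)
    · exact h4

theorem continuous_cos_mul (n : ℕ) : Continuous fun x : ℝ => ((Real.cos (n * x) : ℝ) : ℂ) := by
  fun_prop

/-- The orthonormal system `√(2/π) cos((n+1)x)` in `L²(0,π)`. -/
def cosL2 (n : ℕ) : L2Rod :=
  ((√(2 / π) : ℝ) : ℂ) • (memLp_rod (continuous_cos_mul (n + 1))).toLp _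

theorem inner_cosL2 (n : ℕ) {f : ℝ → ℂ} (hf : Continuous f) :
    inner ℂ (cosL2 n) ((memLp_rod hf).toLp f : L2Rod) =
      ((√(2 / π) : ℝ) : ℂ) * ∫ x in (0 : ℝ)..π, f x * (Real.cos ((n + 1 : ℕ) * x) : ℝ) := by
  rw [cosL2, inner_smul_left, Complex.conj_ofReal, L2.inner_def,
    intervalIntegral.integral_of_le Real.pi_pos.le, ← restrict_Ioo_eq_restrict_Ioc]
  congr 1
  refine integral_congr_ae ?_
  filter_upwards [MemLp.coeFn_toLp (memLp_rod (continuous_cos_mul (n + 1))),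
    MemLp.coeFn_toLp (memLp_rod hf)] with x h1 h2
  rw [h1, h2, RCLike.inner_apply, Complex.conj_ofReal]

theorem sqrt_two_div_pi_mul_self : ((√(2 / π) : ℝ) : ℂ) * ((√(2 / π) : ℝ) : ℂ) = 2 / π := by
  rw [← Complex.ofReal_mul, Real.mul_self_sqrt (by positivity)]
  push_cast
  rfl

theorem orthonormal_cosL2 : Orthonormal ℂ cosL2 := by
  have hπc : (π : ℂ) ≠ 0 := by exact_mod_cast Real.pi_ne_zero
  rw [orthonormal_iff_ite]
  intro i j
  rw [show cosL2 j = ((√(2 / π) : ℝ) : ℂ) • (memLp_rod (continuous_cos_mul (j + 1))).toLp _ from rfl,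
    inner_smul_right, inner_cosL2 _ (continuous_cos_mul (j + 1)), integral_cos_mul_cos (by positivity), ← mul_assoc,
    sqrt_two_div_pi_mul_self]
  by_cases h : i = j
  · rw [if_pos (by omega), if_pos h]
    field_simp
  · rw [if_neg (by omega), if_neg h, mul_zero]

theorem inner_cosL2_deriv (n : ℕ) {f : ℝ → ℂ} (hf : ContDiff ℝ 1 f) (h0 : f 0 = 0)
    (hπ : f π = 0) :
    inner ℂ (cosL2 n) (W01.ofC1 f hf h0 hπ : WithLp 2 (L2Rod × L2Rod)).snd =
      ((√(2 / π) : ℝ) : ℂ) * ((n + 1 : ℕ) * (π / 2) * sineCoeff f (n + 1)) := by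
  have hπc : (π : ℂ) ≠ 0 := by exact_mod_cast Real.pi_ne_zero
  refine (inner_cosL2 n (hf.continuous_deriv le_rfl)).trans ?_
  rw [integral_deriv_mul_cos
    (fun x => ((hf.differentiable (by norm_num)).differentiableAt).hasDerivAt)
    (hf.continuous_deriv le_rfl) h0 hπ, sineCoeff]
  field_simp

/-! ### Existence of the solution -/

variable {τ : ℝ}

/-- The coefficients, with respect to `cosL2`, of the function `H(t) ∈ L²(0,π)` that represents
the state `z(t)` as the functional `p ↦ ⟨H(t), p'⟩`. They are conjugated because the inner product is
conjugate linear in its first argument. -/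
def stateCoeff (u : Input τ) (n : ℕ) (t : ℝ) : ℂ :=
  ((√(2 / π) / (n + 1) : ℝ) : ℂ) * (starRingEnd ℂ) (mode (n + 1) (modeInput u (n + 1)) t)

/-- The function `H(t) ∈ L²(0,π)` such that `⟨z(t), p⟩ = ⟨H(t), p'⟩`. -/
def stateL2 (u : Input τ) (t : ℝ) : L2Rod := ∑' n, stateCoeff u n t • cosL2 n

theorem exists_norm_stateCoeff_sq_le (u : Input τ) :
    ∃ B : ℕ → ℝ, Summable B ∧ ∀ n, ∀ t ∈ Set.Icc 0 τ, ‖stateCoeff u n t‖ ^ 2 ≤ B n := by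
  obtain ⟨M, hM⟩ := exists_norm_mode_modeInput_le u
  refine ⟨fun n => 2 / π * M ^ 2 * (1 / ((n + 1 : ℕ) : ℝ) ^ 2), ?_, fun n t ht => ?_⟩
  · exact ((summable_nat_add_iff 1).2
      (Real.summable_one_div_nat_pow.2 (by norm_num : 1 < 2))).mul_left _
  · have h1 := hM (n + 1) t ht
    rw [stateCoeff, norm_mul, Complex.norm_real, RCLike.norm_conj, mul_pow, Real.norm_eq_abs,
      sq_abs, div_pow, Real.sq_sqrt (by positivity)]
    push_cast
    rw [mul_assoc, mul_comm (M ^ 2), ← mul_assoc, ← div_eq_mul_one_div]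
    gcongr

theorem continuousOn_stateL2 (hτ : 0 ≤ τ) (u : Input τ) :
    ContinuousOn (stateL2 u) (Set.Icc 0 τ) := by
  obtain ⟨B, hB, h⟩ := exists_norm_stateCoeff_sq_le u
  refine continuousOn_tsum_smul_of_orthonormal orthonormal_cosL2 (fun n => ?_) hB h
  exact continuousOn_const.mul (Complex.continuous_conj.comp_continuousOn
    (continuousOn_mode hτ (integrableOn_modeInput u _) _))

/-- The derivative, as an operator from `W_0^{1,2}(0,π)` to `L²(0,π)`. -/
def W01.derivCLM : W01 →L[ℂ] L2Rod :=
  ((ContinuousLinearMap.snd ℂ L2Rod L2Rod).comp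
    (WithLp.prodContinuousLinearEquiv 2 ℂ L2Rod L2Rod).toContinuousLinearMap).comp W01.subtypeL

/-- The solution of the heat equation with input `u`. -/
def heatSolution (u : Input τ) (t : ℝ) : Wneg := (innerSL ℂ (stateL2 u t)).comp W01.derivCLM

theorem continuousOn_heatSolution (hτ : 0 ≤ τ) (u : Input τ) :
    ContinuousOn (heatSolution u) (Set.Icc 0 τ) :=
  ((innerSL ℂ).continuous.comp_continuousOn (continuousOn_stateL2 hτ u)).clm_comp
    continuousOn_const

/-- The state is the sum of its modes, on all `C¹` functions that vanish at the ends; for `ψ''`, with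
`ψ` a test function, it gives the term `⟨z(s), ψ''⟩` of the weak equation. -/
theorem hasSum_heatSolution (u : Input τ) {t : ℝ} (ht : t ∈ Set.Icc 0 τ) {f : ℝ → ℂ}
    (hf : ContDiff ℝ 1 f) (h0 : f 0 = 0) (hπ : f π = 0) :
    HasSum (fun n => sineCoeff f n * mode n (modeInput u n) t)
      (heatSolution u t (W01.ofC1 f hf h0 hπ)) := by
  obtain ⟨B, hB, hcB⟩ := exists_norm_stateCoeff_sq_le u
  have h1 := (summable_smul_of_orthonormal orthonormal_cosL2 (c := fun n => stateCoeff u n t)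
    (hB.of_nonneg_of_le (fun n => by positivity) fun n => hcB n t ht)).hasSum
  have h2 := (innerSLFlip ℂ (W01.ofC1 f hf h0 hπ : WithLp 2 (L2Rod × L2Rod)).snd).hasSum h1
  rw [← hasSum_nat_add_iff' 1]
  simp only [Finset.range_one, Finset.sum_singleton, sineCoeff_zero, zero_mul, sub_zero]
  convert! h2 using 1
  ext n
  have hπc : (π : ℂ) ≠ 0 := by exact_mod_cast Real.pi_ne_zero
  have hn : ((n : ℂ) + 1) ≠ 0 := by exact_mod_cast n.succ_ne_zero
  rw [innerSLFlip_apply_apply, inner_smul_left, inner_cosL2_deriv, stateCoeff, map_mul,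
    Complex.conj_conj, Complex.conj_ofReal]
  push_cast
  have h3 := sqrt_two_div_pi_mul_self
  field_simp
  field_simp at h3
  linear_combination (-sineCoeff f (n + 1) * mode (n + 1) (modeInput u (n + 1)) t) * h3

/-- The weak equation is the sum over `n` of the equations for the modes, with weights the sine
coefficients of the test function. -/
theorem isHeatSolution_heatSolution (hτ : 0 ≤ τ) (u : Input τ) :
    IsHeatSolution τ u (heatSolution u) := by
  refine ⟨continuousOn_heatSolution hτ u, fun φ t ht => ?_⟩
  obtain ⟨M, hM⟩ := exists_norm_mode_modeInput_le u
  have hu : ∀ i, IntervalIntegrable (fun s => u s i) volume 0 t := fun i =>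
    intervalIntegrable_of_integrableOn_Icc (integrableOn_input u i) ht
  have hcm : ∀ n, ContinuousOn (mode n (modeInput u n)) (Set.uIcc 0 t) := fun n =>
    (continuousOn_mode hτ (integrableOn_modeInput u n) n).mono
      (by rw [Set.uIcc_of_le ht.1]; exact Set.Icc_subset_Icc_right ht.2)
  have hint : ∀ n : ℕ, IntervalIntegrable (fun s => sineCoeff φ.ψ n *
      (-(n : ℂ) ^ 2 * mode n (modeInput u n) s + n * modeInput u n s)) volume 0 t := fun n =>
    (((hcm n).intervalIntegrable.const_mul _).add
      ((intervalIntegrable_of_integrableOn_Icc (integrableOn_modeInput u n) ht).const_mul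
        _)).const_mul _
  have h1 := intervalIntegral.hasSum_integral_of_dominated_convergence (a := 0) (b := t)
    (μ := volume) (F := fun (n : ℕ) (s : ℝ) => sineCoeff φ.ψ n *
      (-(n : ℂ) ^ 2 * mode n (modeInput u n) s + n * modeInput u n s))
    (f := fun s => heatSolution u s φ.laplacian + u s 0 * deriv φ.ψ 0 - u s 1 * deriv φ.ψ π)
    (fun n s => n ^ 2 * ‖sineCoeff φ.ψ n‖ * M + n * ‖sineCoeff φ.ψ n‖ * (‖u s 0‖ + ‖u s 1‖))
    (fun n => (intervalIntegrable_iff.1 (hint n)).aestronglyMeasurable)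
    (fun n => Filter.Eventually.of_forall fun s hs => ?_)
    (Filter.Eventually.of_forall fun s _ => (φ.summable_sineCoeff.mul_right _).add
      (φ.summable_sineCoeff_one.mul_right _)) ?_
    (Filter.Eventually.of_forall fun s hs => ?_)
  · refine (hasSum_heatSolution u ht _ _ _).unique ?_
    convert! h1 using 1
    ext n
    rw [intervalIntegral.integral_const_mul,
      ← mode_eq_integral (integrableOn_modeInput u n) n ht]
  · rw [Set.uIoc_of_le ht.1] at hs
    have h2 := hM n s ⟨hs.1.le, hs.2.trans ht.2⟩
    have h3 : ‖modeInput u n s‖ ≤ ‖u s 0‖ + ‖u s 1‖ := by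
      refine (norm_sub_le _ _).trans ?_
      simp
    rw [norm_mul]
    calc _ ≤ ‖sineCoeff φ.ψ n‖ * (n ^ 2 * M + n * (‖u s 0‖ + ‖u s 1‖)) := by
          gcongr
          refine (norm_add_le _ _).trans ?_
          rw [norm_mul, norm_mul, norm_neg, norm_pow, Complex.norm_natCast]
          gcongr
      _ = _ := by ring
  · have h2 : ∀ s, ∑' n : ℕ, ((n : ℝ) ^ 2 * ‖sineCoeff φ.ψ n‖ * M +
        n * ‖sineCoeff φ.ψ n‖ * (‖u s 0‖ + ‖u s 1‖)) =
        (∑' n : ℕ, (n : ℝ) ^ 2 * ‖sineCoeff φ.ψ n‖) * M +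
        (∑' n : ℕ, (n : ℝ) * ‖sineCoeff φ.ψ n‖) * (‖u s 0‖ + ‖u s 1‖) := by
      intro s
      rw [(φ.summable_sineCoeff.mul_right _).tsum_add (φ.summable_sineCoeff_one.mul_right _),
        tsum_mul_right, tsum_mul_right]
    simp_rw [h2]
    exact intervalIntegrable_const.add (((hu 0).norm.add (hu 1).norm).const_mul _)
  · rw [Set.uIoc_of_le ht.1] at hs
    have h2 := hasSum_heatSolution u ⟨hs.1.le, hs.2.trans ht.2⟩
      ((contDiff_infty_iff_deriv.1 (contDiff_infty_iff_deriv.1 φ.smooth).2).2.of_le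
        (by exact_mod_cast le_top)) φ.zero_left' φ.zero_right'
    have h3 := (φ.hasSum_deriv ⟨le_rfl, Real.pi_pos.le⟩).mul_left (u s 0)
    have h4 := (φ.hasSum_deriv ⟨Real.pi_pos.le, le_rfl⟩).mul_left (u s 1)
    refine HasSum.congr_fun ((h2.add h3).sub h4) fun n => ?_
    change sineCoeff φ.ψ n * _ = sineCoeff (deriv (deriv φ.ψ)) n * _ + _ - _
    rw [φ.sineCoeff_laplacian, mul_zero, Real.cos_zero, Real.cos_nat_mul_pi, modeInput]
    push_cast
    ring

end

/-! ### The trace of the state on `(0,π)` -/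

section

/-- On compact subsets of `(0,π)` the kernel is bounded uniformly in time. -/
theorem exists_bound_dirichletKernel_of_isCompact {S : Set ℝ} (hS : IsCompact S)
    (h : S ⊆ Set.Ioo 0 π) : ∃ M : ℝ, ∀ x ∈ S, ∀ t, ‖dirichletKernel t x‖ ≤ M := by
  refine hS.induction_on (p := fun S => ∃ M : ℝ, ∀ x ∈ S, ∀ t, ‖dirichletKernel t x‖ ≤ M)
    ⟨0, by simp⟩ (fun S T hST ⟨M, hM⟩ => ⟨M, fun x hx => hM x (hST hx)⟩) ?_ ?_
  · rintro S T ⟨M, hM⟩ ⟨N, hN⟩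
    refine ⟨max M N, fun x hx t => ?_⟩
    rcases hx with hx | hx
    · exact (hM x hx t).trans (le_max_left _ _)
    · exact (hN x hx t).trans (le_max_right _ _)
  · intro x hx
    obtain ⟨r, hr, M, hM⟩ := exists_bound_dirichletKernel (ofReal_mem_square (h hx))
    refine ⟨(fun x : ℝ => (x : ℂ)) ⁻¹' Metric.ball (x : ℂ) r, ?_, M, fun y hy => hM y hy⟩
    exact mem_nhdsWithin_of_mem_nhds
      (Complex.continuous_ofReal.continuousAt.preimage_mem_nhds (Metric.ball_mem_nhds _ hr))

/-- The sine series of the kernel, integrated against a continuous function. -/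
theorem hasSum_integral_dirichletKernel_mul {f : ℝ → ℂ} (hf : Continuous f) {t : ℝ} (ht : 0 < t) :
    HasSum (fun n : ℕ => sineCoeff f n * ((n * Real.exp (-(n ^ 2 * t)) : ℝ) : ℂ))
      (∫ x in (0 : ℝ)..π, dirichletKernel t x * f x) := by
  obtain ⟨C, hC⟩ := isCompact_Icc.exists_bound_of_continuousOn (s := Set.Icc (0 : ℝ) π)
    hf.continuousOn
  have hsum : Summable fun n : ℕ => (n : ℝ) * Real.exp (-(n ^ 2 * t)) := by
    refine (Real.summable_pow_mul_exp_neg_nat_mul 1 ht).of_nonneg_of_le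
      (fun n => by positivity) fun n => ?_
    rw [pow_one]
    gcongr
    have h1 : (n : ℝ) ≤ n ^ 2 := by exact_mod_cast Nat.le_self_pow (by norm_num) n
    nlinarith
  have h := intervalIntegral.hasSum_integral_of_dominated_convergence (a := 0) (b := π)
    (μ := volume) (F := fun (n : ℕ) (x : ℝ) => (2 / π : ℂ) * (n * Complex.sin (n * x) *
      Complex.exp (-(n ^ 2 * t))) * f x) (f := fun x : ℝ => dirichletKernel t x * f x)
    (fun n _ => 2 / π * (n * Real.exp (-(n ^ 2 * t))) * C)
    (fun n => (by fun_prop : Continuous fun x : ℝ => (2 / π : ℂ) * (n * Complex.sin (n * x) *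
      Complex.exp (-(n ^ 2 * t))) * f x).aestronglyMeasurable)
    (fun n => Filter.Eventually.of_forall fun x hx => ?_)
    (Filter.Eventually.of_forall fun x _ => (hsum.mul_left _).mul_right _)
    intervalIntegrable_const
    (Filter.Eventually.of_forall fun x _ => (hasSum_sine_dirichletKernel ht x).mul_right _)
  · convert! h using 1
    ext n
    rw [sineCoeff, mul_assoc, ← intervalIntegral.integral_mul_const,
      ← intervalIntegral.integral_const_mul]
    refine intervalIntegral.integral_congr fun x _ => ?_
    push_cast
    ring
  · rw [Set.uIoc_of_le Real.pi_pos.le] at hx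
    have h1 : ‖Complex.sin (n * x)‖ ≤ 1 := by
      rw [← Complex.ofReal_natCast, ← Complex.ofReal_mul, ← Complex.ofReal_sin, Complex.norm_real]
      exact Real.abs_sin_le_one _
    have h2 : ‖Complex.exp (-((n : ℂ) ^ 2 * t))‖ = Real.exp (-(n ^ 2 * t)) := by
      rw [Complex.norm_exp]
      norm_cast
    have h3 : ‖(2 / π : ℂ)‖ = 2 / π := by
      rw [norm_div, Complex.norm_real, Real.norm_of_nonneg Real.pi_pos.le]
      simp
    rw [norm_mul, norm_mul, norm_mul, norm_mul, h2, h3, Complex.norm_natCast]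
    gcongr
    · exact mul_le_of_le_one_right (by positivity) h1
    · exact hC x ⟨hx.1.le, hx.2⟩

/-- An element of `C_c^∞(0,π)`, as a test function. -/
def compactTest (φ : ℝ → ℂ) (hφ : ContDiff ℝ ∞ φ) (hs : tsupport φ ⊆ Set.Ioo 0 π) : HeatTest where
  ψ := φ
  smooth := hφ
  zero_left := image_eq_zero_of_notMem_tsupport fun h => (hs h).1.false
  zero_right := image_eq_zero_of_notMem_tsupport fun h => (hs h).2.false
  zero_left' := image_eq_zero_of_notMem_tsupport fun h =>
    (hs (tsupport_deriv_subset (tsupport_deriv_subset h))).1.false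
  zero_right' := image_eq_zero_of_notMem_tsupport fun h =>
    (hs (tsupport_deriv_subset (tsupport_deriv_subset h))).2.false

variable {τ δ Θ : ℝ} {g φ : ℝ → ℂ}

theorem continuous_mul_of_tsupport_subset {f : ℝ → ℂ} (hf : ContinuousOn f (Set.Ioo 0 π))
    (hφ : Continuous φ) (hs : tsupport φ ⊆ Set.Ioo 0 π) : Continuous fun x => f x * φ x := by
  refine continuous_of_tsupport fun x hx => ?_
  exact ((hf.continuousAt (isOpen_Ioo.mem_nhds (hs (tsupport_mul_subset_right hx)))).mul
    hφ.continuousAt)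

theorem continuousOn_ofReal_comp {F : ℂ → ℂ} {U : Set ℂ} (hF : DifferentiableOn ℂ F U)
    (hU : ∀ x ∈ Set.Ioo 0 π, ((x : ℝ) : ℂ) ∈ U) :
    ContinuousOn (fun x : ℝ => F x) (Set.Ioo 0 π) :=
  hF.continuousOn.comp Complex.continuous_ofReal.continuousOn hU

/-- The trace of `heatInt` on `(0,π)` is the sum of its modes. -/
theorem hasSum_integral_heatInt_mul (hτ : 0 ≤ τ) (hg : IntegrableOn g (Set.Icc 0 τ))
    (hφ : ContDiff ℝ ∞ φ) (hs : tsupport φ ⊆ Set.Ioo 0 π) :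
    HasSum (fun n : ℕ => sineCoeff φ n * mode n g τ)
      (∫ x in (0 : ℝ)..π, heatInt τ g x * φ x) := by
  obtain ⟨M, hM⟩ := exists_bound_dirichletKernel_of_isCompact
    (isCompact_Icc.of_isClosed_subset (isClosed_tsupport φ) (hs.trans Set.Ioo_subset_Icc_self)) hs
  have hφi : Integrable φ (volume.restrict (Set.Ioc 0 π)) :=
    (hφ.continuous.integrableOn_Icc (a := 0) (b := π)).mono_set Set.Ioc_subset_Icc_self
  have hprod : Integrable (Function.uncurry fun x σ : ℝ =>
      dirichletKernel (τ - σ) x * g σ * φ x)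
      ((volume.restrict (Set.Ioc 0 π)).prod (volume.restrict (Set.Icc 0 τ))) := by
    have h1 := hφi.mul_prod hg
    refine (h1.norm.const_mul M).mono' ?_ (Filter.Eventually.of_forall fun p => ?_)
    · have h2 : Measurable fun p : ℝ × ℝ => dirichletKernel (τ - p.2) p.1 :=
        Measurable.comp (g := fun p : ℝ × ℂ => dirichletKernel p.1 p.2)
          (f := fun p : ℝ × ℝ => (τ - p.2, (p.1 : ℂ))) measurable_dirichletKernel (by fun_prop)
      refine (h2.aestronglyMeasurable.mul h1.aestronglyMeasurable).congr
        (Filter.Eventually.of_forall fun p => ?_)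
      simp only [Pi.mul_apply, Function.uncurry]
      ring
    · simp only [Function.uncurry]
      by_cases hp : p.1 ∈ tsupport φ
      · rw [mul_assoc, norm_mul, mul_comm (g p.2)]
        exact mul_le_mul_of_nonneg_right (hM p.1 hp _) (norm_nonneg _)
      · simp [image_eq_zero_of_notMem_tsupport hp]
  have hswap : ∫ x in (0 : ℝ)..π, heatInt τ g x * φ x =
      ∫ σ in (0 : ℝ)..τ, (∫ x in (0 : ℝ)..π, dirichletKernel (τ - σ) x * φ x) * g σ := by
    rw [intervalIntegral.integral_of_le hτ, ← integral_Icc_eq_integral_Ioc]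
    simp_rw [intervalIntegral.integral_of_le Real.pi_pos.le, heatInt, ← integral_mul_const]
    rw [integral_integral_swap hprod]
    simp_rw [mul_right_comm]
  rw [hswap]
  have hsum := (compactTest φ hφ hs).summable_sineCoeff_one
  have hgi := intervalIntegrable_of_integrableOn_Icc hg ⟨hτ, le_rfl⟩
  have h := intervalIntegral.hasSum_integral_of_dominated_convergence (a := 0) (b := τ)
    (μ := volume) (F := fun (n : ℕ) (σ : ℝ) =>
      sineCoeff φ n * ((n * Real.exp (-(n ^ 2 * (τ - σ))) : ℝ) : ℂ) * g σ)
    (f := fun σ => (∫ x in (0 : ℝ)..π, dirichletKernel (τ - σ) x * φ x) * g σ)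
    (fun n σ => n * ‖sineCoeff φ n‖ * ‖g σ‖)
    (fun n => ((by fun_prop : Continuous fun σ : ℝ => sineCoeff φ n *
      ((n * Real.exp (-(n ^ 2 * (τ - σ))) : ℝ) : ℂ)).aestronglyMeasurable).mul
      (intervalIntegrable_iff.1 hgi).aestronglyMeasurable)
    (fun n => Filter.Eventually.of_forall fun σ hσ => ?_)
    (Filter.Eventually.of_forall fun σ _ => hsum.mul_right _) ?_ ?_
  · convert! h using 1
    ext n
    rw [mode_eq_integral_mul, ← intervalIntegral.integral_const_mul]
    simp_rw [mul_assoc]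
  · rw [Set.uIoc_of_le hτ] at hσ
    rw [norm_mul, norm_mul, Complex.norm_real, Real.norm_of_nonneg (by positivity)]
    have h1 : Real.exp (-(n ^ 2 * (τ - σ))) ≤ 1 := by
      rw [Real.exp_le_one_iff, neg_nonpos]
      exact mul_nonneg (by positivity) (by linarith [hσ.2])
    rw [mul_comm (n : ℝ) ‖sineCoeff φ n‖]
    gcongr
    exact mul_le_of_le_one_right (by positivity) h1
  · simp_rw [tsum_mul_right]
    exact hgi.norm.const_mul _
  · -- the sine series of the kernel needs a positive time, which excludes `σ = τ`
    filter_upwards [Measure.ae_ne volume τ] with σ h1 hσ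
    rw [Set.uIoc_of_le hτ] at hσ
    exact (hasSum_integral_dirichletKernel_mul hφ.continuous
      (sub_pos.2 (lt_of_le_of_ne hσ.2 h1))).mul_right _

theorem sineCoeff_reflect (φ : ℝ → ℂ) (n : ℕ) :
    sineCoeff (fun x => φ (π - x)) n = -((-1) ^ n * sineCoeff φ n) := by
  have h := intervalIntegral.integral_comp_sub_left (a := 0) (b := π)
    (fun x => φ x * (Real.sin (n * (π - x)) : ℝ)) π
  simp only [sub_sub_cancel, sub_self, sub_zero] at h
  rw [sineCoeff, h, sineCoeff, mul_left_comm, ← mul_neg]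
  congr 1
  rw [← intervalIntegral.integral_const_mul, ← intervalIntegral.integral_neg]
  refine intervalIntegral.integral_congr fun x _ => ?_
  rw [mul_sub, Real.sin_nat_mul_pi_sub]
  push_cast
  ring

theorem contDiff_reflect (hφ : ContDiff ℝ ∞ φ) : ContDiff ℝ ∞ fun x => φ (π - x) :=
  hφ.comp (contDiff_const.sub contDiff_id)

theorem tsupport_reflect_subset (hs : tsupport φ ⊆ Set.Ioo 0 π) :
    tsupport (fun x => φ (π - x)) ⊆ Set.Ioo 0 π := by
  intro x hx
  have h := hs (tsupport_comp_subset_preimage φ (f := fun x => π - x) (by fun_prop) hx)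
  exact ⟨by linarith [h.2], by linarith [h.1]⟩

theorem mode_modeInput (u : Input τ) (n : ℕ) (hτ : 0 ≤ τ) : mode n (modeInput u n) τ =
    mode n (fun σ => u σ 0) τ - (-1) ^ n * mode n (fun σ => u σ 1) τ := by
  have hi : ∀ i, IntervalIntegrable (fun s : ℝ => Complex.exp ((n : ℂ) ^ 2 * s) * u s i) volume 0 τ :=
    fun i => (intervalIntegrable_of_integrableOn_Icc (integrableOn_input u i)
      ⟨hτ, le_rfl⟩).continuousOn_mul
      (by fun_prop : Continuous fun s : ℝ => Complex.exp ((n : ℂ) ^ 2 * s)).continuousOn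
  have h : ∫ s in (0 : ℝ)..τ, Complex.exp ((n : ℂ) ^ 2 * s) * modeInput u n s =
      (∫ s in (0 : ℝ)..τ, Complex.exp ((n : ℂ) ^ 2 * s) * u s 0) -
      (-1) ^ n * ∫ s in (0 : ℝ)..τ, Complex.exp ((n : ℂ) ^ 2 * s) * u s 1 := by
    rw [← intervalIntegral.integral_const_mul, ← intervalIntegral.integral_sub (hi 0)
      ((hi 1).const_mul _)]
    refine intervalIntegral.integral_congr fun s _ => ?_
    simp only [modeInput]
    ring
  simp only [mode]
  rw [h]
  ring

theorem hasSum_integral_inputFun_mul (hτ : 0 ≤ τ) (u : Input τ) (hφ : ContDiff ℝ ∞ φ)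
    (hs : tsupport φ ⊆ Set.Ioo 0 π) :
    HasSum (fun n : ℕ => sineCoeff φ n * mode n (modeInput u n) τ)
      (∫ x in (0 : ℝ)..π, inputFun τ u x * φ x) := by
  have h1 := hasSum_integral_heatInt_mul hτ (integrableOn_input u 0) hφ hs
  have h2 := hasSum_integral_heatInt_mul hτ (integrableOn_input u 1) (contDiff_reflect hφ)
    (tsupport_reflect_subset hs)
  have h3 : ∫ x in (0 : ℝ)..π, heatInt τ (fun σ => u σ 1) x * φ (π - x) =
      ∫ x in (0 : ℝ)..π, heatInt τ (fun σ => u σ 1) (π - x) * φ x := by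
    have h := intervalIntegral.integral_comp_sub_left (a := 0) (b := π)
      (fun x : ℝ => heatInt τ (fun σ => u σ 1) (π - x) * φ x) π
    simp only [sub_self, sub_zero, Complex.ofReal_sub, sub_sub_cancel] at h
    exact h
  have hc1 := continuous_mul_of_tsupport_subset (continuousOn_ofReal_comp
    (differentiableOn_heatInt (integrableOn_input u 0)) fun x => ofReal_mem_square) hφ.continuous hs
  have hc2 := continuous_mul_of_tsupport_subset (continuousOn_ofReal_comp
    (F := fun s => heatInt τ (fun σ => u σ 1) (π - s))
    ((differentiableOn_heatInt (integrableOn_input u 1)).comp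
      ((differentiableOn_const _).sub differentiableOn_id) fun _ hs => sub_mem_square hs)
    fun x => ofReal_mem_square) hφ.continuous hs
  rw [h3] at h2
  have h4 : ∫ x in (0 : ℝ)..π, inputFun τ u x * φ x =
      (∫ x in (0 : ℝ)..π, heatInt τ (fun σ => u σ 0) x * φ x) +
      ∫ x in (0 : ℝ)..π, heatInt τ (fun σ => u σ 1) (π - x) * φ x := by
    rw [← intervalIntegral.integral_add (hc1.intervalIntegrable _ _) (hc2.intervalIntegrable _ _)]
    simp_rw [inputFun, add_mul]
  rw [h4]
  refine HasSum.congr_fun (h1.add h2) fun n => ?_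
  rw [sineCoeff_reflect, mode_modeInput u n hτ]
  ring

/-- The holomorphic function `inputFun τ u` has the trace `z(τ)`. -/
theorem IsHeatSolution.apply_eq_integral (hτ : 0 ≤ τ) {u : Input τ} {z : ℝ → Wneg}
    (hz : IsHeatSolution τ u z) (hφ : ContDiff ℝ ∞ φ) (hs : tsupport φ ⊆ Set.Ioo 0 π) :
    z τ (compactTest φ hφ hs).toW01 = ∫ x in (0 : ℝ)..π, inputFun τ u x * φ x :=
  (hz.hasSum (compactTest φ hφ hs) ⟨hτ, le_rfl⟩).unique (hasSum_integral_inputFun_mul hτ u hφ hs)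

theorem isInputMap_inputMap (hτ : 0 ≤ τ) (hδ : 0 ≤ δ) (hΘ : rhombus Θ ⊆ square) :
    IsInputMap τ (inputMap τ hδ hΘ : Input τ →L[ℂ] bergman δ Θ) := fun u _ hz =>
  ⟨inputFun τ u, isHolomorphicRep_inputMap hδ hΘ u, fun _ hφ hs => hz.apply_eq_integral hτ hφ hs⟩

/-! ### Uniqueness of the input map -/

theorem convex_rhombus : Convex ℝ (rhombus Θ) := by
  intro x hx y hy a b ha hb hab
  have key : ∀ p q : ℝ, 0 < p → 0 < q → 0 < a * p + b * q := fun p q hp hq => by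
    rcases ha.eq_or_lt with rfl | ha
    · rw [zero_add] at hab
      simpa [hab] using hq
    · positivity
  obtain rfl : b = 1 - a := by linarith
  have ⟨h1, h2⟩ := hx
  have ⟨h3, h4⟩ := hy
  rw [abs_lt] at h1 h2 h3 h4
  have k1 := key _ _ (sub_pos.2 h1.1) (sub_pos.2 h3.1)
  have k2 := key _ _ (sub_pos.2 h1.2) (sub_pos.2 h3.2)
  have k3 := key _ _ (sub_pos.2 h2.1) (sub_pos.2 h4.1)
  have k4 := key _ _ (sub_pos.2 h2.2) (sub_pos.2 h4.2)
  constructor <;> rw [abs_lt] <;>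
    simp only [Complex.add_im, Complex.add_re, Complex.real_smul, Complex.re_ofReal_mul,
      Complex.im_ofReal_mul] <;> constructor <;> linarith

theorem ofReal_mem_rhombus (h0 : 0 < Real.tan Θ) {x : ℝ} (hx : x ∈ Set.Ioo 0 π) :
    (x : ℂ) ∈ rhombus Θ := by
  constructor
  · simpa using mul_pos h0 hx.1
  · simpa using mul_pos h0 (sub_pos.2 hx.2)

/-- Holomorphic functions on the rhombus with the same distribution as trace agree. -/
theorem eqOn_rhombus_of_integral_eq (h0 : 0 < Real.tan Θ) {F G : ℂ → ℂ}
    (hF : DifferentiableOn ℂ F (rhombus Θ)) (hG : DifferentiableOn ℂ G (rhombus Θ))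
    (h : ∀ φ : ℝ → ℂ, ContDiff ℝ ∞ φ → tsupport φ ⊆ Set.Ioo 0 π →
      ∫ x in (0 : ℝ)..π, F x * φ x = ∫ x in (0 : ℝ)..π, G x * φ x) :
    Set.EqOn F G (rhombus Θ) := by
  have hFc := continuousOn_ofReal_comp hF fun x => ofReal_mem_rhombus h0
  have hGc := continuousOn_ofReal_comp hG fun x => ofReal_mem_rhombus h0
  have hae : ∀ᵐ x : ℝ, x ∈ Set.Ioo 0 π → F x - G x = 0 := by
    refine isOpen_Ioo.ae_eq_zero_of_integral_contDiff_smul_eq_zero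
      ((hFc.sub hGc).locallyIntegrableOn measurableSet_Ioo) fun φ hφ _ hs => ?_
    have hψ : ContDiff ℝ ∞ fun x => (φ x : ℂ) := Complex.ofRealCLM.contDiff.comp hφ
    have hsψ : tsupport (fun x => (φ x : ℂ)) ⊆ Set.Ioo 0 π :=
      (closure_mono fun x hx => by simpa using hx).trans hs
    have h1 : ∫ x, φ x • (F x - G x) = ∫ x in (0 : ℝ)..π, (F x * φ x - G x * φ x) := by
      rw [intervalIntegral.integral_of_le Real.pi_pos.le, setIntegral_eq_integral_of_forall_compl_eq_zero]
      · refine integral_congr_ae (Filter.Eventually.of_forall fun x => ?_)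
        simp only [Complex.real_smul]
        ring
      · intro x hx
        have : φ x = 0 := image_eq_zero_of_notMem_tsupport fun h' =>
          hx (Set.Ioo_subset_Ioc_self (hs h'))
        simp [this]
    rw [h1, intervalIntegral.integral_sub
      ((continuous_mul_of_tsupport_subset hFc hψ.continuous hsψ).intervalIntegrable _ _)
      ((continuous_mul_of_tsupport_subset hGc hψ.continuous hsψ).intervalIntegrable _ _),
      h _ hψ hsψ, sub_self]
  have heq : Set.EqOn (fun x : ℝ => F x) (fun x : ℝ => G x) (Set.Ioo 0 π) := by
    refine Measure.eqOn_open_of_ae_eq (μ := volume) ?_ isOpen_Ioo hFc hGc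
    rw [Filter.EventuallyEq, ae_restrict_iff' measurableSet_Ioo]
    filter_upwards [hae] with x hx hx'
    exact sub_eq_zero.1 (hx hx')
  have hmid : π / 2 ∈ Set.Ioo 0 π := ⟨by positivity, by linarith [Real.pi_pos]⟩
  refine (hF.analyticOnNhd isOpen_rhombus).eqOn_of_preconnected_of_frequently_eq
    (hG.analyticOnNhd isOpen_rhombus) convex_rhombus.isPreconnected (ofReal_mem_rhombus h0 hmid) ?_
  have ht : Filter.Tendsto (fun x : ℝ => (x : ℂ)) (nhdsWithin (π / 2) {π / 2}ᶜ)
      (nhdsWithin ((π / 2 : ℝ) : ℂ) {((π / 2 : ℝ) : ℂ)}ᶜ) :=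
    Complex.continuous_ofReal.continuousWithinAt.tendsto_nhdsWithin fun x hx => by
      simpa only [Set.mem_compl_iff, Set.mem_singleton_iff, Complex.ofReal_inj] using hx
  refine ht.frequently (Filter.Eventually.frequently ?_)
  filter_upwards [mem_nhdsWithin_of_mem_nhds (isOpen_Ioo.mem_nhds hmid)] with x hx using heq hx

/-- By existence of solutions and the identity theorem, every input map is given by `inputFun`. -/
theorem IsInputMap.isHolomorphicRep (hτ : 0 ≤ τ) (h0 : 0 < Real.tan Θ) (hΘ : rhombus Θ ⊆ square)
    {Φ : Input τ →L[ℂ] bergman δ Θ} (hΦ : IsInputMap τ Φ) (u : Input τ) :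
    IsHolomorphicRep (Φ u : Lp ℂ 2 (bergmanMeasure δ Θ)) (inputFun τ u) := by
  have hz := isHeatSolution_heatSolution hτ u
  obtain ⟨F, ⟨hF, hFae⟩, hFint⟩ := hΦ u _ hz
  have hG := (differentiableOn_inputFun u).mono hΘ
  refine ⟨hG, hFae.trans ?_⟩
  have heq := eqOn_rhombus_of_integral_eq h0 hF hG fun φ hφ hs =>
    (hFint φ hφ hs).symm.trans (hz.apply_eq_integral hτ hφ hs)
  refine bergmanMeasure_ac ?_
  filter_upwards [ae_restrict_mem measurableSet_rhombus] with s hs using heq hs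

theorem not_isHilbertSchmidt (hτ : 0 < τ) (hδ : 0 ≤ δ) (h0 : 0 < Real.tan Θ)
    (hΘ : rhombus Θ ⊆ square)
    (htop : ∫⁻ s in rhombus Θ, ENNReal.ofReal (weight δ s) *
      ENNReal.ofReal (‖s‖ ^ 2 / (s ^ 2 / 4).re ^ 2) = ⊤)
    {Φ : Input τ →L[ℂ] bergman δ Θ} (hΦ : IsInputMap τ Φ) : ¬ IsHilbertSchmidt Φ := fun hHS =>
  (lintegral_lt_top_of_isHilbertSchmidt hτ hδ hΘ
    (fun u => hΦ.isHolomorphicRep hτ.le h0 hΘ u) hHS).ne htop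

end

end DirichletHeat

end

/-- The Dirichlet input map is a well-defined bounded operator from `L²([0,τ]; ℂ²)` into
`A²_δ(D_Θ)`, and it is not Hilbert–Schmidt. -/
theorem proposition5p7 (τ δ Θ : ℝ) (hτ : 0 < τ)
    (h : (δ = 0 ∧ Θ ∈ Set.Ioo 0 (Real.pi / 4)) ∨ (δ ∈ Set.Ioo (0 : ℝ) 1 ∧ Θ = Real.pi / 4)) :
    (∀ u : DirichletHeat.Input τ, ∃ z, DirichletHeat.IsHeatSolution τ u z) ∧
    (∃ Φ : DirichletHeat.Input τ →L[ℂ] DirichletHeat.bergman δ Θ,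
      DirichletHeat.IsInputMap τ Φ) ∧
    ∀ Φ : DirichletHeat.Input τ →L[ℂ] DirichletHeat.bergman δ Θ,
      DirichletHeat.IsInputMap τ Φ → ¬ DirichletHeat.IsHilbertSchmidt Φ := by
  have hπ := Real.pi_pos
  obtain ⟨hδ, h0, h1, htop⟩ : 0 ≤ δ ∧ 0 < Real.tan Θ ∧ Real.tan Θ ≤ 1 ∧
      ∫⁻ s in DirichletHeat.rhombus Θ, ENNReal.ofReal (DirichletHeat.weight δ s) *
        ENNReal.ofReal (‖s‖ ^ 2 / (s ^ 2 / 4).re ^ 2) = ⊤ := by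
    rcases h with ⟨rfl, hΘ⟩ | ⟨hδ, rfl⟩
    · have h0 : 0 < Real.tan Θ := Real.tan_pos_of_pos_of_lt_pi_div_two hΘ.1 (by linarith [hΘ.2])
      have h1 : Real.tan Θ ≤ 1 := by
        rw [← Real.tan_pi_div_four]
        exact (Real.tan_lt_tan_of_lt_of_lt_pi_div_two (by linarith [hΘ.1]) (by linarith)
          hΘ.2).le
      exact ⟨le_rfl, h0, h1, DirichletHeat.lintegral_vertex_eq_top h0 h1⟩
    · refine ⟨hδ.1.le, ?_, ?_, DirichletHeat.lintegral_side_eq_top hδ.1.le⟩ <;>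
        simp [Real.tan_pi_div_four]
  have hΘ := DirichletHeat.rhombus_subset_square h0 h1
  exact ⟨fun u => ⟨_, DirichletHeat.isHeatSolution_heatSolution hτ.le u⟩,
    ⟨_, DirichletHeat.isInputMap_inputMap hτ.le hδ hΘ⟩,
    fun Φ hΦ => DirichletHeat.not_isHilbertSchmidt hτ hδ h0 hΘ htop hΦ⟩
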